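/- Let $k$ be a field of characteristic $0$; $\otimes=\otimes_k$; algebras are associative and unital. For a tensor, $v=v'\otimes v''$ is Sweedler notation and $(x\otimes y)^\sigma=y\otimes x$; moreover $(p\otimes q)\otimes_1 y:=p\otimes y\otimes q$. Products with a tensor on the far left or right use the outer structure $a(x\otimes y)b=ax\otimes yb$; $a*(x\otimes y)*b:=xb\otimes ay$ is the inner one. **Graded double Poisson vertex algebras of degree $-1$.** These consist of an algebra $V=\bigoplus_{n\ge0}V_n$ with product of weight $0$, a derivation $\partial$ of weight $1$, and a $k$-linear map $V\otimes V\to(V\otimes V)[\lambda]$, $a\otimes b\mapsto\{a_\lambda b\}$, such that for $a\in V_i$, $b\in V_j$ the coefficient of $\lambda^q$ lies in $(V\otimes V)_{i+j-q-1}$ (and is $0$ if $i+j-q-1<0$), and for all $a,b,c\in V$, with $\partial$ acting on tensors by the Leibniz rule, - $\{\partial a_\lambda b\}=-\lambda\{a_\lambda b\}$, $\{a_\lambda\partial b\}=(\lambda+\partial)\{a_\lambda b\}$; - $\{a_\lambda bc\}=b\{a_\lambda c\}+\{a_\lambda b\}c$, and if $\{a_\lambda c\}=\sum_n p_n\otimes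 q_n\lambda^n$, $\{b_\lambda c\}=\sum_n r_n\otimes s_n\lambda^n$, then $\{ab_\lambda c\}=\sum_n p_n\big((\lambda+\partial)^nb\big)\otimes q_n+\sum_n r_n\otimes\big((\lambda+\partial)^na\big)s_n$; - $\{a_\lambda b\}=-\{b_{-\lambda-\partial}a\}^\sigma$, with $\partial$ acting on the coefficients; - $\{a_\lambda\{b_\mu c\}\}_L=\{b_\mu\{a_\lambda c\}\}_R+\{\{a_\lambda b\}_{\lambda+\mu}c\}_L$ in $V^{\otimes3}[\lambda,\mu]$, where $\{a_\lambda(x\otimes y)\}_L=\{a_\lambda x\}\otimes y$, $\{a_\lambda(x\otimes y)\}_R=x\otimes\{a_\lambda y\}$, and $\{(x\otimes y)_\lambda c\}_L=\sum_n p_n\otimes\big((\lambda+\partial)^ny\big)\otimes q_n$ if $\{x_\lambda c\}=\sum_n p_n\otimes q_n\lambda^n$. **Free generation.** For an algebra $A$, an $A$-bimodule $E$ (with $k$ acting centrally) and a $k$-linear derivation $\partial:A\to E$, let $\mathcal F(A,E,\partial)$ be the free algebra with derivation $T$ generated by the algebra $A$ (weight $0$) and the $A$-bimodule $E$ (weight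 $1$), $T$ of weight $1$, modulo the differential ideal generated by $Ta-\partial a$, $a\in A$. A graded differential algebra $V$ is *freely generated in weights $0$ and $1$* if the canonical map $\mathcal F(V_0,V_1,\partial|_{V_0})\to V$ is bijective. **Double Courant–Dorfman algebras.** These are tuples $(A,E,\langle\!\langle -,-\rangle\!\rangle ,\partial,[\![ -,-]\!] )$ with $(A,E,\partial)$ as above and $k$-linear maps $\langle\!\langle -,-\rangle\!\rangle :E\otimes E\to A\otimes A$ and $[\![ -,-]\!] :E\otimes E\to E\otimes A\oplus A\otimes E$. One puts $[\![ e,a]\!] =\langle\!\langle e,\partial a\rangle\!\rangle $, $[\![ a,e]\!] =-\langle\!\langle \partial a,e\rangle\!\rangle $, $[\![ a,b]\!] =0$ for $a,b\in A$, $e\in E$, and requires, for all $a,b\in A$, $e,f,g\in E$, - $\langle\!\langle e,afb\rangle\!\rangle =a\langle\!\langle e,f\rangle\!\rangle b$, $\langle\!\langle aeb,f\rangle\!\rangle =a*\langle\!\langle e,f\rangle\!\rangle *b$, $\langle\!\langle e,f\rangle\!\rangle =\langle\!\langle f,e\rangle\!\rangle ^\sigma$; - $\partial\langle\!\langle e,f\rangle\!\rangle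 =[\![ e,f]\!] +[\![ f,e]\!] ^\sigma$, $[\![ \partial a,e]\!] =0$, $\langle\!\langle \partial a,\partial b\rangle\!\rangle =0$; - $[\![ e,fa]\!] =[\![ e,f]\!] a+f\langle\!\langle e,\partial a\rangle\!\rangle $, $[\![ e,af]\!] =a[\![ e,f]\!] +\langle\!\langle e,\partial a\rangle\!\rangle f$; - $[\![ e,[\![ f,g]\!] ]\!] _L=[\![ f,[\![ e,g]\!] ]\!] _R+[\![ [\![ e,f]\!] ,g]\!] _L$ in $E\otimes A\otimes A\oplus A\otimes E\otimes A\oplus A\otimes A\otimes E$; - $\langle\!\langle e,\partial\langle\!\langle f,g\rangle\!\rangle \rangle\!\rangle _L=\langle\!\langle f,[\![ e,g]\!] \rangle\!\rangle _R+\langle\!\langle [\![ e,f]\!] ,g\rangle\!\rangle _L$ in $A^{\otimes3}$. Here $[\![ e,x\otimes y]\!] _L=[\![ e,x]\!] \otimes y$ and $[\![ e,x\otimes y]\!] _R=x\otimes[\![ e,y]\!] $ on $E\otimes A\oplus A\otimes E$, while $[\![ f\otimes a,g]\!] _L=[\![ f,g]\!] \otimes_1a+\langle\!\langle f,g\rangle\!\rangle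 \otimes_1\partial a$ and $[\![ a\otimes f,g]\!] _L=-\langle\!\langle \partial a,g\rangle\!\rangle \otimes_1f$. Moreover $\langle\!\langle e,f\otimes a\rangle\!\rangle _L=\langle\!\langle e,f\rangle\!\rangle \otimes a$, $\langle\!\langle e,a\otimes f\rangle\!\rangle _R=a\otimes\langle\!\langle e,f\rangle\!\rangle $, $\langle\!\langle f\otimes a,g\rangle\!\rangle _L=\langle\!\langle f,g\rangle\!\rangle \otimes_1a$, and $\langle\!\langle e,a\otimes f\rangle\!\rangle _L=\langle\!\langle e,f\otimes a\rangle\!\rangle _R=\langle\!\langle a\otimes f,g\rangle\!\rangle _L=0$. **Theorem.** Graded double Poisson vertex algebras of degree $-1$ freely generated in weights $0$ and $1$ and double Courant–Dorfman algebras are in one-to-one correspondence. Precisely: 1. Let $V$ be such a vertex algebra, $A=V_0$, $E=V_1$. There is a unique double Courant–Dorfman structure on $(A,E,\partial|_A)$ with $\{e_\lambda f\}=[\![ e,f]\!] +\langle\!\langle e,f\rangle\!\rangle \lambda$ for all $e,f\in E$. It also satisfies $\{e_\lambda a\}=\langle\!\langle e,\partial a\rangle\!\rangle $, $\{a_\lambda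 e\}=-\langle\!\langle \partial a,e\rangle\!\rangle $, $\{a_\lambda b\}=0$ for $a,b\in A$. 2. Let $(A,E,\langle\!\langle -,-\rangle\!\rangle ,\partial,[\![ -,-]\!] )$ be a double Courant–Dorfman algebra. The graded differential algebra $\mathcal F(A,E,\partial)$ is freely generated in weights $0$ and $1$, and it carries a unique structure of a graded double Poisson vertex algebra of degree $-1$ with $\{e_\lambda f\}=[\![ e,f]\!] +\langle\!\langle e,f\rangle\!\rangle \lambda$ for $e,f\in E$. It also satisfies the other three formulas of 1. 3. The constructions are mutually inverse up to canonical isomorphism: for $V$ as in 1, the canonical map $\mathcal F(V_0,V_1,\partial)\to V$ is an isomorphism of graded double Poisson vertex algebras; for a double Courant–Dorfman algebra on $(A,E,\partial)$, the canonical map from $(A,E)$ to the weight $0$ and $1$ parts of $\mathcal F(A,E,\partial)$ is an isomorphism of double Courant–Dorfman algebras. In particular they induce mutually inverse bijections between the sets of isomorphism classes. -/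

import Mathlib

open scoped TensorProduct DirectSum
open TensorProduct

universe u

noncomputable section

namespace DoubleCourant

/-! ## Polynomials with coefficients in a module -/

section Polynomials

variable (k : Type u) [Field k]

/-- `M[lam]`: polynomials in one variable with coefficients in `M`; the value at `n` is the
coefficient of the `n`-th power of the variable. -/
abbrev LPoly (M : Type u) [AddCommGroup M] : Type u := ℕ →₀ M

variable {M N : Type u} [AddCommGroup M] [Module k M] [AddCommGroup N] [Module k N]

/-- The constant polynomial. -/
def const : M →ₗ[k] LPoly M := Finsupp.lsingle 0

/-- Multiplication by the variable. -/
def mulVar : LPoly M →ₗ[k] LPoly M := Finsupp.lmapDomain M k Nat.succ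

/-- Apply a linear map to every coefficient. -/
def coeffMap (f : M →ₗ[k] N) : LPoly M →ₗ[k] LPoly N := Finsupp.mapRange.linearMap f

/-- `∑ₙ mₙ lamⁿ ↦ ∑ₙ Lⁿ (f mₙ)`: apply `f` to the coefficients, and substitute the operator `L`
(acting from the left) for the variable. -/
def subst (L : N →ₗ[k] N) (f : M →ₗ[k] N) : LPoly M →ₗ[k] N :=
  Finsupp.lsum k fun n => (L ^ n) ∘ₗ f

/-- `P ⊗ v ↦ P(lam + T)_→ ⊗ v`, that is, `(∑ₙ mₙ lamⁿ) ⊗ v ↦ ∑ₙ (lam + T)ⁿ (mₙ ⊗ v)`,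
where `T` acts on `v` only. -/
def arrow (T : N →ₗ[k] N) : LPoly M ⊗[k] N →ₗ[k] LPoly (M ⊗[k] N) :=
  subst k (mulVar k + coeffMap k (T.lTensor M)) (const k) ∘ₗ
    (finsuppLeft k k M N ℕ).toLinearMap

/-- The constants in `M[lam, mu] = (M[mu])[lam]`. -/
def const₂ : M →ₗ[k] LPoly (LPoly M) := const k ∘ₗ const k

/-- Multiplication by `lam` on `M[lam, mu]`. -/
def mulLam : LPoly (LPoly M) →ₗ[k] LPoly (LPoly M) := mulVar k

/-- Multiplication by `mu` on `M[lam, mu]`. -/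
def mulMu : LPoly (LPoly M) →ₗ[k] LPoly (LPoly M) := coeffMap k (mulVar k)

/-- `P ↦ P(lam)`, from polynomials in one variable to polynomials in `lam` and `mu`. -/
def atLam : LPoly M →ₗ[k] LPoly (LPoly M) := subst k (mulLam k) (const₂ k)

/-- `P ↦ P(mu)`. -/
def atMu : LPoly M →ₗ[k] LPoly (LPoly M) := subst k (mulMu k) (const₂ k)

/-- `P ↦ P(lam + mu)`. -/
def atLamMu : LPoly M →ₗ[k] LPoly (LPoly M) := subst k (mulLam k + mulMu k) (const₂ k)

/-- `(p ⊗ q) ⊗ y ↦ p ⊗ (y ⊗ q)`, the operation written `(p ⊗ q) ⊗₁ y`. -/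
def jump (P Q Y : Type u) [AddCommGroup P] [Module k P] [AddCommGroup Q] [Module k Q]
    [AddCommGroup Y] [Module k Y] : (P ⊗[k] Q) ⊗[k] Y →ₗ[k] P ⊗[k] (Y ⊗[k] Q) :=
  (TensorProduct.comm k Q Y).toLinearMap.lTensor P ∘ₗ (TensorProduct.assoc k P Q Y).toLinearMap

/-- `(p ⊗ q) ⊗ y ↦ p ⊗ (q ⊗ y)`. -/
def asc (P Q Y : Type u) [AddCommGroup P] [Module k P] [AddCommGroup Q] [Module k Q]
    [AddCommGroup Y] [Module k Y] : (P ⊗[k] Q) ⊗[k] Y →ₗ[k] P ⊗[k] (Q ⊗[k] Y) :=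
  (TensorProduct.assoc k P Q Y).toLinearMap

end Polynomials

/-! ## Algebras with a derivation into a bimodule; graded differential algebras -/

/-- A triple `(A, E, ∂)`: an associative unital `k`-algebra `A`, an `A`-bimodule `E` (the right
action is an action of `Aᵐᵒᵖ`; the field `k` acts centrally), and a `k`-linear derivation
`∂ : A → E`. -/
structure DerBimod (k : Type u) [Field k] where
  A : Type u
  E : Type u
  [ringA : Ring A]
  [algA : Algebra k A]
  [addE : AddCommGroup E]
  [modE : Module k E]
  [leftE : Module A E]
  [rightE : Module Aᵐᵒᵖ E]
  [bimodE : SMulCommClass A Aᵐᵒᵖ E]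
  [towerLeft : IsScalarTower k A E]
  [towerRight : IsScalarTower k Aᵐᵒᵖ E]
  d : A →ₗ[k] E
  d_mul : ∀ a b : A, d (a * b) = MulOpposite.op b • d a + a • d b

attribute [instance] DerBimod.ringA DerBimod.algA DerBimod.addE DerBimod.modE DerBimod.leftE
  DerBimod.rightE DerBimod.bimodE DerBimod.towerLeft DerBimod.towerRight

/-- A differential algebra `(V, T)` with a weight grading `V = ⨁_{n ≥ 0} V_n` for which the product
has weight `0` and the derivation `T` has weight `1`. -/
structure GrDiffAlg (k : Type u) [Field k] where
  V : Type u
  [ringV : Ring V]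
  [algV : Algebra k V]
  wt : ℕ → Submodule k V
  [gradedV : GradedAlgebra wt]
  T : V →ₗ[k] V
  T_mul : ∀ x y : V, T (x * y) = T x * y + x * T y
  T_wt : ∀ (n : ℕ) (x : V), x ∈ wt n → T x ∈ wt (n + 1)

attribute [instance] GrDiffAlg.ringV GrDiffAlg.algV GrDiffAlg.gradedV

variable {k : Type u} [Field k]

namespace GrDiffAlg

variable (V : GrDiffAlg k)

instance ringLow : Ring (V.wt 0) := SetLike.GradeZero.instRing V.wt

instance algLow : Algebra k (V.wt 0) := SetLike.GradeZero.instAlgebra V.wt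

/-- Left multiplication of weight one elements by weight zero elements. -/
instance leftLow : Module (V.wt 0) (V.wt 1) where
  smul a e := ⟨(a : V.V) * e, by
    simpa using SetLike.GradedMul.mul_mem (A := V.wt) a.2 e.2⟩
  one_smul e := Subtype.ext (one_mul (e : V.V))
  mul_smul a b e := Subtype.ext (mul_assoc (a : V.V) b e)
  smul_zero a := Subtype.ext (mul_zero (a : V.V))
  smul_add a e f := Subtype.ext (mul_add (a : V.V) e f)
  add_smul a b e := Subtype.ext (add_mul (a : V.V) b e)
  zero_smul e := Subtype.ext (zero_mul (e : V.V))

/-- Right multiplication of weight one elements by weight zero elements. -/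
instance rightLow : Module (V.wt 0)ᵐᵒᵖ (V.wt 1) where
  smul a e := ⟨(e : V.V) * (a.unop : V.wt 0), by
    simpa using SetLike.GradedMul.mul_mem (A := V.wt) e.2 a.unop.2⟩
  one_smul e := Subtype.ext (mul_one (e : V.V))
  mul_smul a b e := Subtype.ext (mul_assoc (e : V.V) (b.unop : V.wt 0) (a.unop : V.wt 0)).symm
  smul_zero a := Subtype.ext (zero_mul ((a.unop : V.wt 0) : V.V))
  smul_add a e f := Subtype.ext (add_mul (e : V.V) f (a.unop : V.wt 0))
  add_smul a b e := Subtype.ext (mul_add (e : V.V) (a.unop : V.wt 0) (b.unop : V.wt 0))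
  zero_smul e := Subtype.ext (mul_zero (e : V.V))

theorem coe_smul (a : V.wt 0) (e : V.wt 1) : ((a • e : V.wt 1) : V.V) = (a : V.V) * e := rfl

theorem coe_op_smul (a : V.wt 0) (e : V.wt 1) :
    ((MulOpposite.op a • e : V.wt 1) : V.V) = (e : V.V) * a := rfl

instance bimodLow : SMulCommClass (V.wt 0) (V.wt 0)ᵐᵒᵖ (V.wt 1) where
  smul_comm a b e := Subtype.ext (mul_assoc (a : V.V) e (b.unop : V.wt 0)).symm

instance towerLeftLow : IsScalarTower k (V.wt 0) (V.wt 1) where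
  smul_assoc c a e := Subtype.ext (smul_mul_assoc c (a : V.V) (e : V.V))

instance towerRightLow : IsScalarTower k (V.wt 0)ᵐᵒᵖ (V.wt 1) where
  smul_assoc c a e := Subtype.ext (mul_smul_comm c (e : V.V) ((a.unop : V.wt 0) : V.V))

/-- The weight zero and one parts: `A = V₀`, `E = V₁`, `∂ = T : V₀ → V₁`. -/
def low : DerBimod k where
  A := V.wt 0
  E := V.wt 1
  d := V.T.restrict (V.T_wt 0)
  d_mul a b := Subtype.ext (V.T_mul (a : V.V) b)

/-- The inclusion `V₀ ⊆ V`. -/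
def inclA : V.low.A →ₗ[k] V.V := (V.wt 0).subtype

/-- The inclusion `V₁ ⊆ V`. -/
def inclE : V.low.E →ₗ[k] V.V := (V.wt 1).subtype

/-- The weight `n` part of `V ⊗ V`. -/
def wtTensor (n : ℕ) : Submodule k (V.V ⊗[k] V.V) :=
  ⨆ (i : ℕ) (j : ℕ) (_ : i + j = n), Submodule.map₂ (TensorProduct.mk k V.V V.V) (V.wt i) (V.wt j)

end GrDiffAlg

/-! ## The free differential algebra generated by `(A, E, ∂)` -/

namespace DerBimod

variable (D : DerBimod k)

/-- Formal symbols `T⁽ⁿ⁾ a` and `T⁽ⁿ⁾ e`, for `a ∈ A` and `e ∈ E`. -/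
abbrev Gen : Type u := ℕ × (D.A ⊕ D.E)

/-- The free algebra on these symbols. -/
abbrev Pre : Type u := FreeAlgebra k D.Gen

def preA (a : D.A) : D.Pre := FreeAlgebra.ι k (0, Sum.inl a)

def preE (e : D.E) : D.Pre := FreeAlgebra.ι k (0, Sum.inr e)

/-- The homomorphism `x ↦ x + ε T(x)` to the dual numbers, determined by `T (T⁽ⁿ⁾x) = T⁽ⁿ⁺¹⁾ x`. -/
def preDual : D.Pre →ₐ[k] TrivSqZeroExt D.Pre D.Pre :=
  FreeAlgebra.lift k fun g =>
    TrivSqZeroExt.inl (FreeAlgebra.ι k g) + TrivSqZeroExt.inr (FreeAlgebra.ι k (g.1 + 1, g.2))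

/-- The derivation `T` of the free algebra with `T (T⁽ⁿ⁾x) = T⁽ⁿ⁺¹⁾ x` on the generators. -/
def preT : D.Pre →ₗ[k] D.Pre where
  toFun x := (D.preDual x).snd
  map_add' x y := by simp
  map_smul' c x := by simp

theorem preDual_fst (x : D.Pre) : (D.preDual x).fst = x := by
  have : (TrivSqZeroExt.fstHom k D.Pre D.Pre).comp D.preDual = AlgHom.id k D.Pre := by
    apply FreeAlgebra.hom_ext
    funext g
    simp [preDual]
  exact DFunLike.congr_fun this x

theorem preT_ι (g : D.Gen) :
    D.preT (FreeAlgebra.ι k g) = FreeAlgebra.ι k (g.1 + 1, g.2) := by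
  simp [preT, preDual]

theorem preT_mul (x y : D.Pre) : D.preT (x * y) = D.preT x * y + x * D.preT y := by
  change (D.preDual (x * y)).snd = (D.preDual x).snd * y + x * (D.preDual y).snd
  rw [map_mul, TrivSqZeroExt.snd_mul, preDual_fst, preDual_fst]
  simp [add_comm]

theorem preT_algebraMap (c : k) : D.preT (algebraMap k D.Pre c) = 0 := by
  simp [preT, TrivSqZeroExt.algebraMap_eq_inl']

/-- The defining relations: `A` is mapped by a homomorphism of unital algebras, `E` by a
homomorphism of bimodules, and `T a = ∂ a` for `a ∈ A`; the last clause closes the relations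
under `T`, so that the ideal they generate is a differential ideal. -/
inductive Rel : D.Pre → D.Pre → Prop
  | add_A (a b : D.A) : Rel (D.preA (a + b)) (D.preA a + D.preA b)
  | smul_A (c : k) (a : D.A) : Rel (D.preA (c • a)) (c • D.preA a)
  | one_A : Rel (D.preA 1) 1
  | mul_A (a b : D.A) : Rel (D.preA (a * b)) (D.preA a * D.preA b)
  | add_E (e f : D.E) : Rel (D.preE (e + f)) (D.preE e + D.preE f)
  | smul_E (c : k) (e : D.E) : Rel (D.preE (c • e)) (c • D.preE e)
  | left_E (a : D.A) (e : D.E) : Rel (D.preE (a • e)) (D.preA a * D.preE e)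
  | right_E (a : D.A) (e : D.E) : Rel (D.preE (MulOpposite.op a • e)) (D.preE e * D.preA a)
  | der (a : D.A) : Rel (D.preT (D.preA a)) (D.preE (D.d a))
  | diff {x y : D.Pre} : Rel x y → Rel (D.preT x) (D.preT y)

/-- The free differential algebra generated by `A` and `E`, modulo the differential ideal generated
by `T a - ∂ a`, `a ∈ A`. -/
abbrev FreeAlg : Type u := RingQuot D.Rel

/-- The quotient map. -/
def quo : D.Pre →ₐ[k] D.FreeAlg := RingQuot.mkAlgHom k D.Rel

theorem quo_rel {x y : D.Pre} (h : D.Rel x y) : D.quo x = D.quo y := RingQuot.mkAlgHom_rel k h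

theorem quo_surjective : Function.Surjective D.quo := RingQuot.mkAlgHom_surjective k D.Rel

/-- `[x] ↦ [x] + ε [T x]`. -/
def freeDual : D.FreeAlg →ₐ[k] TrivSqZeroExt D.FreeAlg D.FreeAlg :=
  RingQuot.liftAlgHom k ⟨
    { toFun := fun x => TrivSqZeroExt.inl (D.quo x) + TrivSqZeroExt.inr (D.quo (D.preT x))
      map_one' := by
        have : D.preT 1 = 0 := by simpa using D.preT_algebraMap 1
        simp [this]
      map_mul' := fun x y => by
        ext <;> simp [preT_mul, add_comm]
      map_zero' := by simp
      map_add' := fun x y => by ext <;> simp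
      commutes' := fun c => by
        rw [preT_algebraMap]
        simp [TrivSqZeroExt.algebraMap_eq_inl'] },
    fun x y h => by
      change TrivSqZeroExt.inl (D.quo x) + TrivSqZeroExt.inr (D.quo (D.preT x)) =
        TrivSqZeroExt.inl (D.quo y) + TrivSqZeroExt.inr (D.quo (D.preT y))
      rw [D.quo_rel h, D.quo_rel (Rel.diff h)]⟩

/-- The derivation `T` of the quotient. -/
def freeT : D.FreeAlg →ₗ[k] D.FreeAlg where
  toFun x := (D.freeDual x).snd
  map_add' x y := by simp
  map_smul' c x := by simp

theorem freeDual_mk (x : D.Pre) :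
    D.freeDual (D.quo x) = TrivSqZeroExt.inl (D.quo x) + TrivSqZeroExt.inr (D.quo (D.preT x)) :=
  RingQuot.liftAlgHom_mkAlgHom_apply k _ _ x

theorem freeT_mk (x : D.Pre) : D.freeT (D.quo x) = D.quo (D.preT x) := by
  change (D.freeDual (D.quo x)).snd = _
  rw [freeDual_mk]; simp

theorem freeT_mul (x y : D.FreeAlg) : D.freeT (x * y) = D.freeT x * y + x * D.freeT y := by
  obtain ⟨x, rfl⟩ := D.quo_surjective x
  obtain ⟨y, rfl⟩ := D.quo_surjective y
  rw [← map_mul, freeT_mk, freeT_mk, freeT_mk, preT_mul, map_add, map_mul, map_mul]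

/-- The weight of a generator: `n` for `T⁽ⁿ⁾ a` and `n + 1` for `T⁽ⁿ⁾ e`. -/
def genWt : D.Gen → ℕ
  | (n, Sum.inl _) => n
  | (n, Sum.inr _) => n + 1

/-- The class of a product of generators. -/
def word (l : List D.Gen) : D.FreeAlg := (l.map fun g => D.quo (FreeAlgebra.ι k g)).prod

/-- The weight `n` part is spanned by the products of generators of total weight `n`. -/
def freeWt (n : ℕ) : Submodule k D.FreeAlg :=
  Submodule.span k {x | ∃ l : List D.Gen, (l.map D.genWt).sum = n ∧ x = D.word l}

theorem word_mem (l : List D.Gen) : D.word l ∈ D.freeWt (l.map D.genWt).sum :=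
  Submodule.subset_span ⟨l, rfl, rfl⟩

theorem gen_mem (g : D.Gen) : D.quo (FreeAlgebra.ι k g) ∈ D.freeWt (D.genWt g) := by
  simpa [word] using D.word_mem [g]

instance gradedMonoid : SetLike.GradedMonoid D.freeWt where
  one_mem := by simpa [word] using D.word_mem []
  mul_mem i j x y hx hy := by
    have h := Submodule.mul_mem_mul hx hy
    rw [freeWt, freeWt, Submodule.span_mul_span] at h
    refine Submodule.span_le.2 ?_ h
    rintro _ ⟨_, ⟨l, rfl, rfl⟩, _, ⟨m, rfl, rfl⟩, rfl⟩
    simpa [word] using D.word_mem (l ++ m)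

theorem freeT_wt (n : ℕ) (x : D.FreeAlg) (hx : x ∈ D.freeWt n) : D.freeT x ∈ D.freeWt (n + 1) := by
  induction hx using Submodule.span_induction with
  | mem x hx =>
    obtain ⟨l, rfl, rfl⟩ := hx
    induction l with
    | nil =>
      have : D.freeT 1 = 0 := by
        have h := D.freeT_mul 1 1
        simpa using h
      simp [word, this]
    | cons g l ih =>
      have h1 : D.word (g :: l) = D.quo (FreeAlgebra.ι k g) * D.word l := by simp [word]
      rw [h1, freeT_mul, freeT_mk, preT_ι]
      have h2 : D.genWt (g.1 + 1, g.2) = D.genWt g + 1 := by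
        rcases g with ⟨n, a | e⟩ <;> rfl
      have h3 := SetLike.GradedMul.mul_mem (A := D.freeWt) (D.gen_mem (g.1 + 1, g.2)) (D.word_mem l)
      have h4 := SetLike.GradedMul.mul_mem (A := D.freeWt) (D.gen_mem g) ih
      rw [h2] at h3
      simp only [List.map_cons, List.sum_cons]
      refine add_mem ?_ ?_
      · convert h3 using 2; omega
      · convert h4 using 2; omega
  | zero => simp
  | add x y _ _ hx hy => rw [map_add]; exact add_mem hx hy
  | smul c x _ hx => rw [map_smul]; exact Submodule.smul_mem _ _ hx

/-- `T` on the external direct sum of the weight spaces. -/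
def sumT : (⨁ n, D.freeWt n) →ₗ[k] ⨁ n, D.freeWt n :=
  DirectSum.toModule k ℕ _ fun n =>
    DirectSum.lof k ℕ (fun n => D.freeWt n) (n + 1) ∘ₗ D.freeT.restrict (D.freeT_wt n)

theorem sumT_of (n : ℕ) (x : D.freeWt n) :
    D.sumT (DirectSum.of (fun n => D.freeWt n) n x) =
      DirectSum.of (fun n => D.freeWt n) (n + 1) ⟨D.freeT x, D.freeT_wt n x x.2⟩ := by
  rw [← DirectSum.lof_eq_of k, sumT, DirectSum.toModule_lof]; rfl

theorem of_congr {m n : ℕ} (h : m = n) (x : D.freeWt m) (y : D.freeWt n)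
    (hxy : (x : D.FreeAlg) = y) :
    DirectSum.of (fun n => D.freeWt n) m x = DirectSum.of (fun n => D.freeWt n) n y :=
  DirectSum.of_eq_of_gradedMonoid_eq (Sigma.subtype_ext h hxy)

theorem sumT_mul (x y : ⨁ n, D.freeWt n) : D.sumT (x * y) = D.sumT x * y + x * D.sumT y := by
  induction x using DirectSum.induction_on with
  | zero => simp
  | add x x' hx hx' => simp only [add_mul, map_add, hx, hx']; abel
  | of m x =>
    induction y using DirectSum.induction_on with
    | zero => simp
    | add y y' hy hy' => simp only [mul_add, map_add, hy, hy']; abel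
    | of n y =>
      rw [DirectSum.of_mul_of, sumT_of, sumT_of, sumT_of, DirectSum.of_mul_of, DirectSum.of_mul_of,
        D.of_congr (show m + 1 + n = m + n + 1 by omega) _
          ⟨D.freeT x * y, by
            have := SetLike.GradedMul.mul_mem (A := D.freeWt) (D.freeT_wt m x x.2) y.2
            rwa [show m + 1 + n = m + n + 1 by omega] at this⟩ rfl]
      refine Eq.trans (congrArg _ (Subtype.ext (D.freeT_mul x y))) (map_add _ _ _)

/-- The decomposition of elements of the free algebra into weight components. -/
def preDecomp : D.Pre →ₐ[k] ⨁ n, D.freeWt n :=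
  FreeAlgebra.lift k fun g =>
    DirectSum.of (fun n => D.freeWt n) (D.genWt g) ⟨D.quo (FreeAlgebra.ι k g), D.gen_mem g⟩

theorem preDecomp_ι (g : D.Gen) : D.preDecomp (FreeAlgebra.ι k g) =
    DirectSum.of (fun n => D.freeWt n) (D.genWt g) ⟨D.quo (FreeAlgebra.ι k g), D.gen_mem g⟩ := by
  simp [preDecomp]

theorem preDecomp_preT (x : D.Pre) : D.preDecomp (D.preT x) = D.sumT (D.preDecomp x) := by
  induction x using FreeAlgebra.induction with
  | grade0 c =>
    rw [preT_algebraMap, map_zero, AlgHom.commutes, Algebra.algebraMap_eq_smul_one, map_smul]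
    have hT : D.freeT 1 = 0 := by simpa using D.freeT_mul 1 1
    have h1 : D.sumT 1 = 0 := by
      refine (D.sumT_of 0 ⟨1, SetLike.GradedOne.one_mem⟩).trans ?_
      refine Eq.trans (congrArg _ (Subtype.ext hT)) (map_zero _)
    rw [h1, smul_zero]
  | grade1 g =>
    rw [preT_ι, preDecomp_ι, preDecomp_ι, sumT_of]
    refine D.of_congr ?_ _ _ ?_
    · rcases g with ⟨n, a | e⟩ <;> rfl
    · change D.quo _ = D.freeT (D.quo _)
      rw [freeT_mk, preT_ι]
  | mul x y hx hy => rw [preT_mul, map_add, map_mul, map_mul, hx, hy, map_mul, sumT_mul]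
  | add x y hx hy => rw [map_add, map_add, map_add, map_add, hx, hy]

theorem preDecomp_rel {x y : D.Pre} (h : D.Rel x y) : D.preDecomp x = D.preDecomp y := by
  induction h with
  | diff _ ih => rw [preDecomp_preT, preDecomp_preT, ih]
  | add_A a b =>
    rw [map_add, preA, preA, preA, preDecomp_ι, preDecomp_ι, preDecomp_ι]
    exact (congrArg (DirectSum.of (fun n => D.freeWt n) 0)
      (Subtype.ext ((D.quo_rel (Rel.add_A a b)).trans (map_add _ _ _)))).trans (map_add _ _ _)
  | smul_A c a =>
    rw [map_smul, preA, preA, preDecomp_ι, preDecomp_ι]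
    exact (congrArg (DirectSum.lof k ℕ (fun n => D.freeWt n) 0)
      (Subtype.ext ((D.quo_rel (Rel.smul_A c a)).trans (map_smul _ _ _)))).trans (map_smul _ _ _)
  | one_A =>
    rw [map_one, preA, preDecomp_ι]
    exact D.of_congr rfl _ _ ((D.quo_rel Rel.one_A).trans (map_one _))
  | mul_A a b =>
    rw [map_mul, preA, preA, preA, preDecomp_ι, preDecomp_ι, preDecomp_ι, DirectSum.of_mul_of]
    exact D.of_congr rfl _ _ ((D.quo_rel (Rel.mul_A a b)).trans (map_mul _ _ _))
  | add_E e f =>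
    rw [map_add, preE, preE, preE, preDecomp_ι, preDecomp_ι, preDecomp_ι]
    exact (congrArg (DirectSum.of (fun n => D.freeWt n) 1)
      (Subtype.ext ((D.quo_rel (Rel.add_E e f)).trans (map_add _ _ _)))).trans (map_add _ _ _)
  | smul_E c e =>
    rw [map_smul, preE, preE, preDecomp_ι, preDecomp_ι]
    exact (congrArg (DirectSum.lof k ℕ (fun n => D.freeWt n) 1)
      (Subtype.ext ((D.quo_rel (Rel.smul_E c e)).trans (map_smul _ _ _)))).trans (map_smul _ _ _)
  | left_E a e =>
    rw [map_mul, preA, preE, preE, preDecomp_ι, preDecomp_ι, preDecomp_ι, DirectSum.of_mul_of]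
    exact D.of_congr rfl _ _ ((D.quo_rel (Rel.left_E a e)).trans (map_mul _ _ _))
  | right_E a e =>
    rw [map_mul, preA, preE, preE, preDecomp_ι, preDecomp_ι, preDecomp_ι, DirectSum.of_mul_of]
    exact D.of_congr rfl _ _ ((D.quo_rel (Rel.right_E a e)).trans (map_mul _ _ _))
  | der a =>
    rw [preDecomp_preT, preA, preE, preDecomp_ι, preDecomp_ι, sumT_of]
    refine D.of_congr rfl _ _ ?_
    change D.freeT (D.quo _) = D.quo _
    rw [freeT_mk]
    exact D.quo_rel (Rel.der a)

/-- The decomposition into weight components. -/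
def decomp : D.FreeAlg →ₐ[k] ⨁ n, D.freeWt n :=
  RingQuot.liftAlgHom k ⟨D.preDecomp, fun _ _ h => D.preDecomp_rel h⟩

theorem decomp_mk (x : D.Pre) : D.decomp (D.quo x) = D.preDecomp x :=
  RingQuot.liftAlgHom_mkAlgHom_apply k _ _ x

theorem decomp_word (l : List D.Gen) :
    D.decomp (D.word l) = DirectSum.of (fun n => D.freeWt n) _ ⟨D.word l, D.word_mem l⟩ := by
  induction l with
  | nil =>
    have : D.word [] = 1 := by simp [word]
    refine (congrArg D.decomp this).trans ((map_one _).trans ?_)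
    exact D.of_congr rfl _ _ this.symm
  | cons g l ih =>
    have h1 : D.word (g :: l) = D.quo (FreeAlgebra.ι k g) * D.word l := by simp [word]
    refine (congrArg D.decomp h1).trans ?_
    rw [map_mul, ih, decomp_mk, preDecomp_ι, DirectSum.of_mul_of]
    exact D.of_congr (by simp) _ _ h1.symm

instance gradedFree : GradedAlgebra D.freeWt :=
  GradedAlgebra.ofAlgHom D.freeWt D.decomp
    (by
      apply RingQuot.ringQuot_ext'
      apply FreeAlgebra.hom_ext
      funext g
      change DirectSum.coeAlgHom D.freeWt (D.decomp (D.quo (FreeAlgebra.ι k g))) =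
        D.quo (FreeAlgebra.ι k g)
      rw [decomp_mk, preDecomp_ι, DirectSum.coeAlgHom_of])
    (fun n x => by
      obtain ⟨x, hx⟩ := x
      rw [← DirectSum.lof_eq_of k]
      induction hx using Submodule.span_induction with
      | mem x hx =>
        obtain ⟨l, rfl, rfl⟩ := hx
        exact D.decomp_word l
      | zero => rw [map_zero]; exact (map_zero _).symm
      | add x y hx hy hx' hy' => rw [map_add, hx', hy', ← map_add]; rfl
      | smul c x hx hx' => rw [map_smul, hx', ← map_smul]; rfl)

/-- The free graded differential algebra generated by `A` in weight `0` and `E` in weight `1`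
subject to `T a = ∂ a`. -/
def free : GrDiffAlg k where
  V := D.FreeAlg
  wt := D.freeWt
  T := D.freeT
  T_mul := D.freeT_mul
  T_wt := D.freeT_wt

/-- The canonical map `A → V` for the free algebra `V`. -/
def freeA : D.A →ₗ[k] D.free.V where
  toFun a := D.quo (D.preA a)
  map_add' a b := (D.quo_rel (Rel.add_A a b)).trans (map_add _ _ _)
  map_smul' c a := (D.quo_rel (Rel.smul_A c a)).trans (map_smul _ _ _)

/-- The canonical map `E → V` for the free algebra `V`. -/
def freeE : D.E →ₗ[k] D.free.V where
  toFun e := D.quo (D.preE e)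
  map_add' e f := (D.quo_rel (Rel.add_E e f)).trans (map_add _ _ _)
  map_smul' c e := (D.quo_rel (Rel.smul_E c e)).trans (map_smul _ _ _)

/-- A morphism of triples `(A, E, ∂)`. -/
structure Hom (D D' : DerBimod k) where
  onA : D.A →ₐ[k] D'.A
  onE : D.E →ₗ[k] D'.E
  left_smul : ∀ (a : D.A) (e : D.E), onE (a • e) = onA a • onE e
  right_smul : ∀ (a : D.A) (e : D.E),
    onE (MulOpposite.op a • e) = MulOpposite.op (onA a) • onE e
  comm_d : ∀ a : D.A, onE (D.d a) = D'.d (onA a)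

/-- The canonical map from `(A, E, ∂)` to the weight zero and one parts of the free algebra. -/
def unit : D.Hom D.free.low where
  onA := AlgHom.ofLinearMap (D.freeA.codRestrict (D.freeWt 0) fun a => D.gen_mem (0, Sum.inl a))
    (Subtype.ext ((D.quo_rel Rel.one_A).trans (map_one _)))
    (fun a b => Subtype.ext ((D.quo_rel (Rel.mul_A a b)).trans (map_mul _ _ _)))
  onE := D.freeE.codRestrict (D.freeWt 1) fun e => D.gen_mem (0, Sum.inr e)
  left_smul a e := Subtype.ext ((D.quo_rel (Rel.left_E a e)).trans (map_mul _ _ _))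
  right_smul a e := Subtype.ext ((D.quo_rel (Rel.right_E a e)).trans (map_mul _ _ _))
  comm_d a := Subtype.ext ((D.quo_rel (Rel.der a)).symm.trans (D.freeT_mk _).symm)

end DerBimod

namespace GrDiffAlg

variable (V : GrDiffAlg k)

/-- Evaluation of formal symbols: `T⁽ⁿ⁾ x ↦ Tⁿ x` for `x` in `V₀` or `V₁`. -/
def preEval : V.low.Pre →ₐ[k] V.V :=
  FreeAlgebra.lift k fun g => (V.T ^ g.1) (Sum.elim V.inclA V.inclE g.2)

theorem preEval_preT (x : V.low.Pre) : V.preEval (V.low.preT x) = V.T (V.preEval x) := by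
  have h1 : V.T 1 = 0 := by simpa using V.T_mul 1 1
  induction x using FreeAlgebra.induction with
  | grade0 c =>
    rw [DerBimod.preT_algebraMap, map_zero, AlgHom.commutes, Algebra.algebraMap_eq_smul_one,
      map_smul, h1, smul_zero]
  | grade1 g =>
    rw [DerBimod.preT_ι]
    simp [preEval, pow_succ']
  | mul x y hx hy => rw [DerBimod.preT_mul, map_add, map_mul, map_mul, hx, hy, map_mul, V.T_mul]
  | add x y hx hy => rw [map_add, map_add, map_add, map_add, hx, hy]

theorem preEval_preA (a : V.low.A) : V.preEval (V.low.preA a) = V.inclA a := by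
  simp [preEval, DerBimod.preA]

theorem preEval_preE (e : V.low.E) : V.preEval (V.low.preE e) = V.inclE e := by
  simp [preEval, DerBimod.preE]

theorem preEval_rel {x y : V.low.Pre} (h : V.low.Rel x y) : V.preEval x = V.preEval y := by
  induction h with
  | diff _ ih => rw [preEval_preT, preEval_preT, ih]
  | der a => rw [preEval_preT, preEval_preA, preEval_preE]; rfl
  | one_A => rw [preEval_preA]; exact (map_one V.preEval).symm
  | add_A a b => simp only [map_add, preEval_preA]
  | smul_A c a => simp only [map_smul, preEval_preA]
  | mul_A a b => simp only [map_mul, preEval_preA]; rfl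
  | add_E e f => simp only [map_add, preEval_preE]
  | smul_E c e => simp only [map_smul, preEval_preE]
  | left_E a e => simp only [map_mul, preEval_preA, preEval_preE]; rfl
  | right_E a e => simp only [map_mul, preEval_preA, preEval_preE]; rfl

/-- The canonical homomorphism to `V` from the free differential algebra generated by the weight
zero and one parts of `V`. -/
def counit : V.low.free.V →ₐ[k] V.V :=
  RingQuot.liftAlgHom k ⟨V.preEval, fun _ _ h => V.preEval_rel h⟩

/-- `V` is freely generated in weights `0` and `1`: it is, through the canonical map, the free
differential algebra generated by `V₀` and `V₁` subject to the relations in weights `0` and `1`. -/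
def FreelyGenerated : Prop := Function.Bijective V.counit

end GrDiffAlg

/-! ## Double Poisson vertex algebras -/

section DPVA

variable (V : GrDiffAlg k)

/-- `T` on `V ⊗ V`, by the Leibniz rule. -/
def tensorT : V.V ⊗[k] V.V →ₗ[k] V.V ⊗[k] V.V := V.T.rTensor V.V + V.T.lTensor V.V

/-- `(p ⊗ q) ⊗ b ↦ p b ⊗ q`. -/
def insertLeft : (V.V ⊗[k] V.V) ⊗[k] V.V →ₗ[k] V.V ⊗[k] V.V :=
  (LinearMap.mul' k V.V).rTensor V.V ∘ₗ (TensorProduct.assoc k V.V V.V V.V).symm.toLinearMap ∘ₗ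
    jump k V.V V.V V.V

/-- `(p ⊗ q) ⊗ a ↦ p ⊗ a q`. -/
def insertRight : (V.V ⊗[k] V.V) ⊗[k] V.V →ₗ[k] V.V ⊗[k] V.V :=
  (LinearMap.mul' k V.V).lTensor V.V ∘ₗ jump k V.V V.V V.V

variable {V}
variable (br : V.V →ₗ[k] V.V →ₗ[k] LPoly (V.V ⊗[k] V.V))

/-- `b ⊗ c ↦ {a_lam b} ⊗ c`. -/
def brL (a : V.V) : V.V ⊗[k] V.V →ₗ[k] LPoly (V.V ⊗[k] (V.V ⊗[k] V.V)) :=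
  coeffMap k (asc k V.V V.V V.V) ∘ₗ (finsuppLeft k k (V.V ⊗[k] V.V) V.V ℕ).toLinearMap ∘ₗ
    (br a).rTensor V.V

/-- `b ⊗ c ↦ b ⊗ {a_lam c}`. -/
def brR (a : V.V) : V.V ⊗[k] V.V →ₗ[k] LPoly (V.V ⊗[k] (V.V ⊗[k] V.V)) :=
  (finsuppRight k k V.V (V.V ⊗[k] V.V) ℕ).toLinearMap ∘ₗ (br a).lTensor V.V

/-- `a ⊗ b ↦ {a_{lam + T} c}_→ ⊗₁ b`. -/
def brFirst (c : V.V) : V.V ⊗[k] V.V →ₗ[k] LPoly (V.V ⊗[k] (V.V ⊗[k] V.V)) :=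
  coeffMap k (jump k V.V V.V V.V) ∘ₗ arrow k V.T ∘ₗ (br.flip c).rTensor V.V

end DPVA

/-- A structure of a graded double Poisson vertex algebra of degree `-1` on the graded differential
algebra `V`: a double `lam`-bracket of weight `-1` that is skewsymmetric and satisfies the Jacobi
identity. -/
@[ext]
structure DoublePVA (V : GrDiffAlg k) where
  /-- The double `lam`-bracket `{a_lam b}`. -/
  br : V.V →ₗ[k] V.V →ₗ[k] LPoly (V.V ⊗[k] V.V)
  /-- The coefficient of `lam^q` in `{v_lam w}` has weight `i + j - q - 1`, if this is nonnegative. -/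
  weight : ∀ (i j q n : ℕ) (v w : V.V), v ∈ V.wt i → w ∈ V.wt j → n + q + 1 = i + j →
    br v w q ∈ V.wtTensor n
  /-- Coefficients that would have negative weight vanish. -/
  weight_zero : ∀ (i j q : ℕ) (v w : V.V), v ∈ V.wt i → w ∈ V.wt j → i + j < q + 1 →
    br v w q = 0
  /-- `{T a_lam b} = - lam {a_lam b}`. -/
  sesq_left : ∀ a b : V.V, br (V.T a) b = - mulVar k (br a b)
  /-- `{a_lam T b} = (lam + T) {a_lam b}`. -/
  sesq_right : ∀ a b : V.V, br a (V.T b) = mulVar k (br a b) + coeffMap k (tensorT V) (br a b)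
  /-- `{a_lam bc} = b {a_lam c} + {a_lam b} c`, with the outer bimodule structure. -/
  leibniz_left : ∀ a b c : V.V, br a (b * c) =
    coeffMap k ((LinearMap.mulLeft k b).rTensor V.V) (br a c) +
      coeffMap k ((LinearMap.mulRight k c).lTensor V.V) (br a b)
  /-- `{ab_lam c} = {a_{lam + T} c}_→ *₁ b + (e^{T ∂_lam} a) *₁ {b_lam c}`. -/
  leibniz_right : ∀ a b c : V.V, br (a * b) c =
    coeffMap k (insertLeft V) (arrow k V.T (br a c ⊗ₜ[k] b)) +
      coeffMap k (insertRight V) (arrow k V.T (br b c ⊗ₜ[k] a))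
  /-- `{a_lam b} = - {b_{- lam - T} a}^σ`. -/
  skew : ∀ a b : V.V, br a b =
    - coeffMap k (TensorProduct.comm k V.V V.V).toLinearMap
        (subst k (- mulVar k - coeffMap k (tensorT V)) (const k) (br b a))
  /-- `{a_lam {b_mu c}}_L = {b_mu {a_lam c}}_R + {{a_lam b}_{lam + mu} c}_L`. -/
  jacobi : ∀ a b c : V.V,
    subst k (mulMu k) (atLam k ∘ₗ brL br a) (br b c) =
      subst k (mulLam k) (atMu k ∘ₗ brR br b) (br a c) +
        subst k (mulLam k) (atLamMu k ∘ₗ brFirst br c) (br a b)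

/-! ## Double Courant–Dorfman algebras -/

section CD

variable (D : DerBimod k)

/-- `E ⊗ A ⊕ A ⊗ E`. -/
abbrev T₂ : Type u := (D.E ⊗[k] D.A) × (D.A ⊗[k] D.E)

/-- `E ⊗ A ⊗ A ⊕ A ⊗ E ⊗ A ⊕ A ⊗ A ⊗ E`. -/
abbrev T₃ : Type u :=
  (D.E ⊗[k] (D.A ⊗[k] D.A)) × (D.A ⊗[k] (D.E ⊗[k] D.A)) × (D.A ⊗[k] (D.A ⊗[k] D.E))

/-- The permutation `σ` on `E ⊗ A ⊕ A ⊗ E`. -/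
def swap₂ : T₂ D →ₗ[k] T₂ D :=
  LinearMap.prod
    ((TensorProduct.comm k D.A D.E).toLinearMap ∘ₗ LinearMap.snd k _ _)
    ((TensorProduct.comm k D.E D.A).toLinearMap ∘ₗ LinearMap.fst k _ _)

/-- `∂` on `A ⊗ A`, by the Leibniz rule: `x ⊗ y ↦ ∂x ⊗ y + x ⊗ ∂y`. -/
def dTensor : D.A ⊗[k] D.A →ₗ[k] T₂ D := LinearMap.prod (D.d.rTensor D.A) (D.d.lTensor D.A)

/-- Left action of `a` on `E`. -/
def lactE (a : D.A) : D.E →ₗ[k] D.E := Algebra.lsmul k k D.E a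

/-- Right action of `a` on `E`. -/
def ractE (a : D.A) : D.E →ₗ[k] D.E := Algebra.lsmul k k D.E (MulOpposite.op a)

/-- Outer left action of `a` on `E ⊗ A ⊕ A ⊗ E`. -/
def outerL (a : D.A) : T₂ D →ₗ[k] T₂ D :=
  LinearMap.prodMap ((lactE D a).rTensor D.A) ((LinearMap.mulLeft k a).rTensor D.E)

/-- Outer right action of `a` on `E ⊗ A ⊕ A ⊗ E`. -/
def outerR (a : D.A) : T₂ D →ₗ[k] T₂ D :=
  LinearMap.prodMap ((LinearMap.mulRight k a).lTensor D.E) ((ractE D a).lTensor D.A)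

/-- `x ↦ f x`, as a map `A → E`. -/
def elemR (f : D.E) : D.A →ₗ[k] D.E where
  toFun x := MulOpposite.op x • f
  map_add' x y := by rw [MulOpposite.op_add, add_smul]
  map_smul' c x := by rw [MulOpposite.op_smul, smul_assoc]; rfl

/-- `x ↦ x f`, as a map `A → E`. -/
def elemL (f : D.E) : D.A →ₗ[k] D.E where
  toFun x := x • f
  map_add' x y := add_smul x y f
  map_smul' c x := smul_assoc c x f

/-- `f P ∈ E ⊗ A` for `P ∈ A ⊗ A` and `f ∈ E` (outer product). -/
def elemMulL (f : D.E) : D.A ⊗[k] D.A →ₗ[k] T₂ D :=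
  LinearMap.inl k _ _ ∘ₗ (elemR D f).rTensor D.A

/-- `P f ∈ A ⊗ E` for `P ∈ A ⊗ A` and `f ∈ E` (outer product). -/
def elemMulR (f : D.E) : D.A ⊗[k] D.A →ₗ[k] T₂ D :=
  LinearMap.inr k _ _ ∘ₗ (elemL D f).lTensor D.A

variable {D}
variable (pr : D.E →ₗ[k] D.E →ₗ[k] D.A ⊗[k] D.A) (br : D.E →ₗ[k] D.E →ₗ[k] T₂ D)

/-- The component `⟦e, f⟧_l ∈ E ⊗ A`. -/
def brl : D.E →ₗ[k] D.E →ₗ[k] D.E ⊗[k] D.A := br.compr₂ (LinearMap.fst k _ _)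

/-- The component `⟦e, f⟧_r ∈ A ⊗ E`. -/
def brr : D.E →ₗ[k] D.E →ₗ[k] D.A ⊗[k] D.E := br.compr₂ (LinearMap.snd k _ _)

/-- `⟦e, -⟧_L`: `f ⊗ a ↦ ⟦e, f⟧ ⊗ a` and `a ⊗ f ↦ ⟪e, ∂a⟫ ⊗ f`. -/
def cdL (e : D.E) : T₂ D →ₗ[k] T₃ D :=
  LinearMap.prod
    (asc k D.E D.A D.A ∘ₗ (brl br e).rTensor D.A ∘ₗ LinearMap.fst k _ _)
    (LinearMap.prod
      (asc k D.A D.E D.A ∘ₗ (brr br e).rTensor D.A ∘ₗ LinearMap.fst k _ _)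
      (asc k D.A D.A D.E ∘ₗ (pr e ∘ₗ D.d).rTensor D.E ∘ₗ LinearMap.snd k _ _))

/-- `⟦e, -⟧_R`: `f ⊗ a ↦ f ⊗ ⟪e, ∂a⟫` and `a ⊗ f ↦ a ⊗ ⟦e, f⟧`. -/
def cdR (e : D.E) : T₂ D →ₗ[k] T₃ D :=
  LinearMap.prod
    ((pr e ∘ₗ D.d).lTensor D.E ∘ₗ LinearMap.fst k _ _)
    (LinearMap.prod
      ((brl br e).lTensor D.A ∘ₗ LinearMap.snd k _ _)
      ((brr br e).lTensor D.A ∘ₗ LinearMap.snd k _ _))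

/-- `⟦-, g⟧_L`: `e ⊗ a ↦ ⟦e, g⟧ ⊗₁ a + ⟪e, g⟫ ⊗₁ ∂a` and `a ⊗ e ↦ - ⟪∂a, g⟫ ⊗₁ e`. -/
def cdFirst (g : D.E) : T₂ D →ₗ[k] T₃ D :=
  LinearMap.prod
    (jump k D.E D.A D.A ∘ₗ ((brl br).flip g).rTensor D.A ∘ₗ LinearMap.fst k _ _)
    (LinearMap.prod
      (jump k D.A D.A D.E ∘ₗ TensorProduct.map (pr.flip g) D.d ∘ₗ LinearMap.fst k _ _ -
        jump k D.A D.A D.E ∘ₗ (pr.flip g ∘ₗ D.d).rTensor D.E ∘ₗ LinearMap.snd k _ _)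
      (jump k D.A D.E D.A ∘ₗ ((brr br).flip g).rTensor D.A ∘ₗ LinearMap.fst k _ _))

/-- `⟪e, -⟫_L`: `f ⊗ a ↦ ⟪e, f⟫ ⊗ a`, and zero on `A ⊗ E`. -/
def prL (e : D.E) : T₂ D →ₗ[k] D.A ⊗[k] (D.A ⊗[k] D.A) :=
  asc k D.A D.A D.A ∘ₗ (pr e).rTensor D.A ∘ₗ LinearMap.fst k _ _

/-- `⟪e, -⟫_R`: `a ⊗ f ↦ a ⊗ ⟪e, f⟫`, and zero on `E ⊗ A`. -/
def prR (e : D.E) : T₂ D →ₗ[k] D.A ⊗[k] (D.A ⊗[k] D.A) :=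
  (pr e).lTensor D.A ∘ₗ LinearMap.snd k _ _

/-- `⟪-, g⟫_L`: `e ⊗ a ↦ ⟪e, g⟫ ⊗₁ a`, and zero on `A ⊗ E`. -/
def prFirst (g : D.E) : T₂ D →ₗ[k] D.A ⊗[k] (D.A ⊗[k] D.A) :=
  jump k D.A D.A D.A ∘ₗ (pr.flip g).rTensor D.A ∘ₗ LinearMap.fst k _ _

end CD

/-- A structure of a double Courant–Dorfman algebra on `(A, E, ∂)`. The bracket is given on
`E ⊗ E`; in total degree at most one it is fixed by `⟦e, a⟧ = ⟪e, ∂a⟫`, `⟦a, e⟧ = - ⟪∂a, e⟫`,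
`⟦a, b⟧ = 0`. -/
@[ext]
structure DoubleCD (D : DerBimod k) where
  /-- The pairing `⟪e, f⟫ ∈ A ⊗ A`. -/
  pr : D.E →ₗ[k] D.E →ₗ[k] D.A ⊗[k] D.A
  /-- The bracket `⟦e, f⟧ ∈ E ⊗ A ⊕ A ⊗ E`. -/
  br : D.E →ₗ[k] D.E →ₗ[k] T₂ D
  /-- `⟪e, a f⟫ = a ⟪e, f⟫` (outer). -/
  pr_outer_left : ∀ (a : D.A) (e f : D.E),
    pr e (a • f) = (LinearMap.mulLeft k a).rTensor D.A (pr e f)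
  /-- `⟪e, f a⟫ = ⟪e, f⟫ a` (outer). -/
  pr_outer_right : ∀ (a : D.A) (e f : D.E),
    pr e (MulOpposite.op a • f) = (LinearMap.mulRight k a).lTensor D.A (pr e f)
  /-- `⟪a e, f⟫ = a * ⟪e, f⟫` (inner). -/
  pr_inner_left : ∀ (a : D.A) (e f : D.E),
    pr (a • e) f = (LinearMap.mulLeft k a).lTensor D.A (pr e f)
  /-- `⟪e a, f⟫ = ⟪e, f⟫ * a` (inner). -/
  pr_inner_right : ∀ (a : D.A) (e f : D.E),
    pr (MulOpposite.op a • e) f = (LinearMap.mulRight k a).rTensor D.A (pr e f)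
  /-- `⟪e, f⟫ = ⟪f, e⟫^σ`. -/
  pr_symm : ∀ e f : D.E, pr e f = TensorProduct.comm k D.A D.A (pr f e)
  /-- `∂ ⟪e, f⟫ = ⟦e, f⟧ + ⟦f, e⟧^σ`. -/
  d_pr : ∀ e f : D.E, dTensor D (pr e f) = br e f + swap₂ D (br f e)
  /-- `⟦∂a, e⟧ = 0`. -/
  br_d : ∀ (a : D.A) (e : D.E), br (D.d a) e = 0
  /-- `⟪∂a, ∂b⟫ = 0`. -/
  pr_d_d : ∀ a b : D.A, pr (D.d a) (D.d b) = 0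
  /-- `⟦e, f a⟧ = ⟦e, f⟧ a + f ⟪e, ∂a⟫`. -/
  br_right : ∀ (e f : D.E) (a : D.A),
    br e (MulOpposite.op a • f) = outerR D a (br e f) + elemMulL D f (pr e (D.d a))
  /-- `⟦e, a f⟧ = a ⟦e, f⟧ + ⟪e, ∂a⟫ f`. -/
  br_left : ∀ (e f : D.E) (a : D.A),
    br e (a • f) = outerL D a (br e f) + elemMulR D f (pr e (D.d a))
  /-- `⟦e, ⟦f, g⟧⟧_L = ⟦f, ⟦e, g⟧⟧_R + ⟦⟦e, f⟧, g⟧_L`. -/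
  jacobi : ∀ e f g : D.E,
    cdL pr br e (br f g) = cdR pr br f (br e g) + cdFirst pr br g (br e f)
  /-- `⟪e, ∂⟪f, g⟫⟫_L = ⟪f, ⟦e, g⟧⟫_R + ⟪⟦e, f⟧, g⟫_L`. -/
  pr_inv : ∀ e f g : D.E,
    prL pr e (dTensor D (pr f g)) = prR pr f (br e g) + prFirst pr g (br e f)

/-! ## The formulas relating the two structures -/

section Formulas

variable {D : DerBimod k} {V : GrDiffAlg k}

/-- `{e_lam f} = ⟦e, f⟧ + ⟪e, f⟫ lam`, where `A` and `E` are mapped to `V` by `iA` and `iE`. -/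
def BracketFormula (iA : D.A →ₗ[k] V.V) (iE : D.E →ₗ[k] V.V) (S : DoubleCD D)
    (B : DoublePVA V) : Prop :=
  ∀ e f : D.E, B.br (iE e) (iE f) =
    const k (TensorProduct.map iE iA (S.br e f).1 + TensorProduct.map iA iE (S.br e f).2) +
      mulVar k (const k (TensorProduct.map iA iA (S.pr e f)))

/-- `{e_lam a} = ⟪e, ∂a⟫`, `{a_lam e} = - ⟪∂a, e⟫`, `{a_lam b} = 0`, where `A` and `E` are mapped
to `V` by `iA` and `iE`. -/
def ActionFormulas (iA : D.A →ₗ[k] V.V) (iE : D.E →ₗ[k] V.V) (S : DoubleCD D)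
    (B : DoublePVA V) : Prop :=
  (∀ (e : D.E) (a : D.A), B.br (iE e) (iA a) =
    const k (TensorProduct.map iA iA (S.pr e (D.d a)))) ∧
  (∀ (a : D.A) (e : D.E), B.br (iA a) (iE e) =
    - const k (TensorProduct.map iA iA (S.pr (D.d a) e))) ∧
  (∀ a b : D.A, B.br (iA a) (iA b) = 0)

end Formulas

/-! ## Isomorphisms -/

/-- The algebra homomorphism `h` is an isomorphism of graded double Poisson vertex algebras: it is
bijective and preserves weights, derivations and double `lam`-brackets. -/
structure IsPVAIso {V W : GrDiffAlg k} (B : DoublePVA V) (C : DoublePVA W)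
    (h : V.V →ₐ[k] W.V) : Prop where
  bijective : Function.Bijective h
  map_wt : ∀ (n : ℕ) (x : V.V), x ∈ V.wt n ↔ h x ∈ W.wt n
  map_T : ∀ x : V.V, h (V.T x) = W.T (h x)
  map_br : ∀ x y : V.V,
    coeffMap k (TensorProduct.map h.toLinearMap h.toLinearMap) (B.br x y) = C.br (h x) (h y)

/-- The morphism `h` of triples `(A, E, ∂)` is an isomorphism of double Courant–Dorfman algebras:
it is bijective and preserves pairings and brackets. -/
structure IsCDIso {D D' : DerBimod k} (S : DoubleCD D) (S' : DoubleCD D')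
    (h : D.Hom D') : Prop where
  bijective_A : Function.Bijective h.onA
  bijective_E : Function.Bijective h.onE
  map_pr : ∀ e f : D.E,
    TensorProduct.map h.onA.toLinearMap h.onA.toLinearMap (S.pr e f) = S'.pr (h.onE e) (h.onE f)
  map_brl : ∀ e f : D.E,
    TensorProduct.map h.onE h.onA.toLinearMap (S.br e f).1 = (S'.br (h.onE e) (h.onE f)).1
  map_brr : ∀ e f : D.E,
    TensorProduct.map h.onA.toLinearMap h.onE (S.br e f).2 = (S'.br (h.onE e) (h.onE f)).2

/-- A graded double Poisson vertex algebra of degree `-1` that is freely generated in weights `0`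
and `1`. -/
structure FreeDPVA (k : Type u) [Field k] where
  alg : GrDiffAlg k
  free : alg.FreelyGenerated
  str : DoublePVA alg

/-- A double Courant–Dorfman algebra. -/
structure DCDAlg (k : Type u) [Field k] where
  base : DerBimod k
  str : DoubleCD base

theorem coeffMap_comp {M N P : Type u} [AddCommGroup M] [Module k M] [AddCommGroup N] [Module k N]
    [AddCommGroup P] [Module k P] (g : N →ₗ[k] P) (f : M →ₗ[k] N) (x : LPoly M) :
    coeffMap k g (coeffMap k f x) = coeffMap k (g ∘ₗ f) x := by
  ext n; simp [coeffMap]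

theorem coeffMap_id {M : Type u} [AddCommGroup M] [Module k M] (x : LPoly M) :
    coeffMap k (LinearMap.id : M →ₗ[k] M) x = x := by
  ext n; simp [coeffMap]

theorem IsPVAIso.refl {V : GrDiffAlg k} (B : DoublePVA V) : IsPVAIso B B (AlgHom.id k V.V) where
  bijective := Function.bijective_id
  map_wt _ _ := Iff.rfl
  map_T _ := rfl
  map_br x y := by
    have : TensorProduct.map (AlgHom.id k V.V).toLinearMap (AlgHom.id k V.V).toLinearMap =
      LinearMap.id := TensorProduct.map_id
    rw [this, coeffMap_id]; rfl

theorem IsPVAIso.trans {V W X : GrDiffAlg k} {B : DoublePVA V} {C : DoublePVA W} {F : DoublePVA X}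
    {h : V.V →ₐ[k] W.V} {g : W.V →ₐ[k] X.V} (hh : IsPVAIso B C h) (hg : IsPVAIso C F g) :
    IsPVAIso B F (g.comp h) where
  bijective := hg.bijective.comp hh.bijective
  map_wt n x := (hh.map_wt n x).trans (hg.map_wt n (h x))
  map_T x := by simp [hh.map_T, hg.map_T]
  map_br x y := by
    have : TensorProduct.map (g.comp h).toLinearMap (g.comp h).toLinearMap =
      TensorProduct.map g.toLinearMap g.toLinearMap ∘ₗ
        TensorProduct.map h.toLinearMap h.toLinearMap := TensorProduct.ext' fun _ _ => rfl
    rw [this, ← coeffMap_comp, hh.map_br, hg.map_br]; rfl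

theorem IsPVAIso.exists_symm {V W : GrDiffAlg k} {B : DoublePVA V} {C : DoublePVA W}
    {h : V.V →ₐ[k] W.V} (hh : IsPVAIso B C h) : ∃ g : W.V →ₐ[k] V.V, IsPVAIso C B g := by
  let e := AlgEquiv.ofBijective h hh.bijective
  have he : ∀ x, h (e.symm x) = x := fun x => e.apply_symm_apply x
  have he' : ∀ x, e.symm (h x) = x := fun x => e.symm_apply_apply x
  refine ⟨e.symm.toAlgHom, e.symm.bijective, ?_, ?_, ?_⟩
  · intro n x
    have := hh.map_wt n (e.symm x)
    rw [he] at this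
    exact this.symm
  · intro x
    change e.symm (W.T x) = V.T (e.symm x)
    rw [← he' (V.T (e.symm x)), hh.map_T, he]
  · intro x y
    have := hh.map_br (e.symm x) (e.symm y)
    rw [he, he] at this
    rw [← this, coeffMap_comp, ← TensorProduct.map_comp]
    have h2 : e.symm.toAlgHom.toLinearMap ∘ₗ h.toLinearMap = LinearMap.id :=
      LinearMap.ext he'
    rw [h2, TensorProduct.map_id, coeffMap_id]
    rfl

/-- Isomorphism of graded double Poisson vertex algebras freely generated in weights `0`, `1`. -/
instance FreeDPVA.isoSetoid (k : Type u) [Field k] : Setoid (FreeDPVA k) where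
  r V W := ∃ h : V.alg.V →ₐ[k] W.alg.V, IsPVAIso V.str W.str h
  iseqv :=
    { refl := fun V => ⟨_, IsPVAIso.refl V.str⟩
      symm := fun ⟨_, h⟩ => h.exists_symm
      trans := fun ⟨_, h⟩ ⟨_, g⟩ => ⟨_, h.trans g⟩ }

/-- The identity morphism. -/
def DerBimod.Hom.id (D : DerBimod k) : D.Hom D where
  onA := AlgHom.id k D.A
  onE := LinearMap.id
  left_smul _ _ := rfl
  right_smul _ _ := rfl
  comm_d _ := rfl

/-- The composition of morphisms. -/
def DerBimod.Hom.comp {D D' D'' : DerBimod k} (g : D'.Hom D'') (h : D.Hom D') : D.Hom D'' where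
  onA := g.onA.comp h.onA
  onE := g.onE ∘ₗ h.onE
  left_smul a e := by simp [h.left_smul, g.left_smul]
  right_smul a e := by simp [h.right_smul, g.right_smul]
  comm_d a := by simp [h.comm_d, g.comm_d]

theorem IsCDIso.refl {D : DerBimod k} (S : DoubleCD D) : IsCDIso S S (DerBimod.Hom.id D) where
  bijective_A := Function.bijective_id
  bijective_E := Function.bijective_id
  map_pr _ _ := DFunLike.congr_fun (TensorProduct.map_id (R := k) (M := D.A) (N := D.A)) _
  map_brl _ _ := DFunLike.congr_fun (TensorProduct.map_id (R := k) (M := D.E) (N := D.A)) _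
  map_brr _ _ := DFunLike.congr_fun (TensorProduct.map_id (R := k) (M := D.A) (N := D.E)) _

theorem IsCDIso.trans {D D' D'' : DerBimod k} {S : DoubleCD D} {S' : DoubleCD D'}
    {S'' : DoubleCD D''} {h : D.Hom D'} {g : D'.Hom D''} (hh : IsCDIso S S' h)
    (hg : IsCDIso S' S'' g) : IsCDIso S S'' (g.comp h) where
  bijective_A := hg.bijective_A.comp hh.bijective_A
  bijective_E := hg.bijective_E.comp hh.bijective_E
  map_pr e f := by
    refine (DFunLike.congr_fun (TensorProduct.map_comp g.onA.toLinearMap g.onA.toLinearMap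
      h.onA.toLinearMap h.onA.toLinearMap) (S.pr e f)).trans ?_
    rw [LinearMap.comp_apply, hh.map_pr, hg.map_pr]; rfl
  map_brl e f := by
    refine (DFunLike.congr_fun (TensorProduct.map_comp g.onE g.onA.toLinearMap
      h.onE h.onA.toLinearMap) (S.br e f).1).trans ?_
    rw [LinearMap.comp_apply, hh.map_brl, hg.map_brl]; rfl
  map_brr e f := by
    refine (DFunLike.congr_fun (TensorProduct.map_comp g.onA.toLinearMap g.onE
      h.onA.toLinearMap h.onE) (S.br e f).2).trans ?_
    rw [LinearMap.comp_apply, hh.map_brr, hg.map_brr]; rfl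

theorem IsCDIso.exists_symm {D D' : DerBimod k} {S : DoubleCD D} {S' : DoubleCD D'}
    {h : D.Hom D'} (hh : IsCDIso S S' h) : ∃ g : D'.Hom D, IsCDIso S' S g := by
  let α := AlgEquiv.ofBijective h.onA hh.bijective_A
  let ε := LinearEquiv.ofBijective h.onE hh.bijective_E
  have hα : ∀ x, h.onA (α.symm x) = x := fun x => α.apply_symm_apply x
  have hα' : ∀ x, α.symm (h.onA x) = x := fun x => α.symm_apply_apply x
  have hε : ∀ x, h.onE (ε.symm x) = x := fun x => ε.apply_symm_apply x
  have hε' : ∀ x, ε.symm (h.onE x) = x := fun x => ε.symm_apply_apply x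
  have cα : α.symm.toAlgHom.toLinearMap ∘ₗ h.onA.toLinearMap = LinearMap.id := LinearMap.ext hα'
  have cε : ε.symm.toLinearMap ∘ₗ h.onE = LinearMap.id := LinearMap.ext hε'
  refine ⟨⟨α.symm.toAlgHom, ε.symm.toLinearMap, ?_, ?_, ?_⟩, α.symm.bijective, ε.symm.bijective,
    ?_, ?_, ?_⟩
  · intro a e
    apply hh.bijective_E.1
    rw [h.left_smul]
    exact (hε _).trans (congrArg₂ (· • ·) (hα a) (hε e)).symm
  · intro a e
    apply hh.bijective_E.1
    rw [h.right_smul]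
    exact (hε _).trans (congrArg₂ (fun a e => MulOpposite.op a • e) (hα a) (hε e)).symm
  · intro a
    apply hh.bijective_E.1
    rw [h.comm_d]
    exact (hε _).trans (congrArg D'.d (hα a)).symm
  · intro e f
    have := hh.map_pr (ε.symm e) (ε.symm f)
    rw [hε, hε] at this
    rw [← this, ← LinearMap.comp_apply, ← TensorProduct.map_comp, cα, TensorProduct.map_id]
    rfl
  · intro e f
    have := hh.map_brl (ε.symm e) (ε.symm f)
    rw [hε, hε] at this
    rw [← this, ← LinearMap.comp_apply, ← TensorProduct.map_comp, cα, cε, TensorProduct.map_id]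
    rfl
  · intro e f
    have := hh.map_brr (ε.symm e) (ε.symm f)
    rw [hε, hε] at this
    rw [← this, ← LinearMap.comp_apply, ← TensorProduct.map_comp, cα, cε, TensorProduct.map_id]
    rfl

/-- Isomorphism of double Courant–Dorfman algebras. -/
instance DCDAlg.isoSetoid (k : Type u) [Field k] : Setoid (DCDAlg k) where
  r C C' := ∃ h : C.base.Hom C'.base, IsCDIso C.str C'.str h
  iseqv :=
    { refl := fun C => ⟨_, IsCDIso.refl C.str⟩
      symm := fun ⟨_, h⟩ => h.exists_symm
      trans := fun ⟨_, h⟩ ⟨_, g⟩ => ⟨_, h.trans g⟩ }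

end DoubleCourant

end

open DoubleCourant

/-!
A `lam`-bracket is determined by its values on generators, and on the generators `A` and `E` of the
weights zero and one the axioms of a double Poisson vertex algebra are, coefficient by coefficient
in `lam` and `mu`, the axioms of a double Courant–Dorfman algebra.

*Skewsymmetry.* The second argument of the bracket is a derivation for the outer bimodule structure
on `(V ⊗ V)[lam]` and for the operator `lam + T`, the first one is a derivation for an inner
structure and for `- lam`. The involution `sk`, which sends `P(lam)` to `P(- lam - T)^σ`, exchanges
the two structures (`sk_inL`, `sk_inR`, `sk_mulVar`). So the set of `b` with `{a_lam b} = - sk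
{b_lam a}` is closed under products and `T`, and skewsymmetry need only be checked on generators
(`IsSesqLeibniz.skew_of_generators`).

*Jacobi identity.* Put `nu = - lam - mu - T`. The cyclic permutation `cyc` of the three tensor
factors and of `lam`, `mu`, `nu` has order three, and for a skewsymmetric bracket the Jacobi
identity says that the sum of `{a_lam {b_mu c}}_L` over the cyclic permutations vanishes
(`IsSesqLeibniz.jac_iff`). It is therefore invariant under cyclic permutations of `a, b, c`. It is
closed under products and `T` in the last argument, so it too need only be checked on generators
(`IsSesqLeibniz.jac_of_generators`).

*Generators.* For three elements of `E`, the coefficients of the Jacobi identity are the Jacobi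
identity of `⟦-, -⟧`, in the constant term, and two conditions on the pairing, in `lam` and `mu`
(`IsGivenBy.jac_EEE_iff`). The coefficient of `mu` is the invariance of the pairing, and the
coefficient of `lam` is a cyclic permutation of it (`DoubleCD.pr_inv_cyclic`). For two elements of
`E` and one of `A` one obtains a special case of the invariance (`IsGivenBy.jac_EEA_iff`), and with
at most one element of `E` all terms vanish.

*Existence.* The free differential algebra has the universal property for derivations into
differential bimodules (`DerBimod.extendsDerivations`). It is applied twice: first to extend the
bracket of generators in the second argument, and then in the first, where skewsymmetry on
generators supplies the relations (`exists_bracket`). The weights are right because they are right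
on generators (`IsSesqLeibniz.mem_wtPoly`). This gives `exists_doublePVA`.

*The converse.* For weight reasons `{e_lam f}` has degree at most one in `lam` when `e` and `f` have
weight one, with coefficients in `E ⊗ A ⊕ A ⊗ E` and `A ⊗ A` (`DoublePVA.br_low`), and
sesquilinearity determines the brackets with elements of `A` (`IsGivenBy.of_EE`). As `A` and `E` are
direct summands of `V`, their tensor products embed into those of `V`, so the axioms of `V` can be
read off as those of a double Courant–Dorfman algebra (`DoubleCD.ofIsGivenBy`).

*Comparison.* The weight zero and one parts of the free differential algebra are `A` and `E`: it
maps to the square zero extension `A ⊕ E`, which separates the elements of `A` and of `E`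
(`DerBimod.freeA_injective`, `DerBimod.freeE_injective`), and generation gives surjectivity
(`DerBimod.exists_of_mem_low`). Hence unit and counit are bijective on the underlying objects, and
they preserve all operations because they do so on generators (`isPVAIso_of_isCDIso`).
-/

noncomputable section

namespace DoubleCourant

variable {k : Type u} [Field k]

/-! ### Polynomials with module coefficients -/

section Poly

variable {M N P : Type u} [AddCommGroup M] [Module k M] [AddCommGroup N] [Module k N]
  [AddCommGroup P] [Module k P]

variable (k) in
/-- Induction on polynomials. All identities between operators on polynomials below follow from
their compatibility with constants and with multiplication by the variable. -/
@[elab_as_elim]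
theorem LPoly.induction {p : LPoly M → Prop} (hc : ∀ m, p (const k m))
    (hv : ∀ x, p x → p (mulVar k x)) (ha : ∀ x y, p x → p y → p (x + y)) (x : LPoly M) : p x := by
  have key : ∀ (n : ℕ) (m : M), p (Finsupp.single n m) := by
    intro n
    induction n with
    | zero => exact hc
    | succ n ih =>
      intro m
      have := hv _ (ih m)
      simpa [mulVar] using this
  induction x using Finsupp.induction_linear with
  | zero => simpa using hc 0
  | add x y hx hy => exact ha x y hx hy
  | single n m => exact key n m

variable (k) in
/-- Induction on polynomials in two variables. -/
@[elab_as_elim]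
theorem LPoly.induction₂ {p : LPoly (LPoly M) → Prop} (hc : ∀ m, p (const₂ k m))
    (hl : ∀ x, p x → p (mulLam k x)) (hm : ∀ x, p x → p (mulMu k x))
    (ha : ∀ x y, p x → p y → p (x + y)) (x : LPoly (LPoly M)) : p x := by
  refine LPoly.induction k (fun m => ?_) hl ha x
  refine LPoly.induction k (p := fun m => p (const k m)) hc (fun y hy => ?_) (fun y z hy hz => ?_) m
  · have := hm _ hy
    simpa [mulMu, coeffMap, const] using this
  · have := ha _ _ hy hz
    simpa using this

@[simp] theorem coeffMap_const (f : M →ₗ[k] N) (m : M) :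
    coeffMap k f (const k m) = const k (f m) := by
  simp [coeffMap, const]

@[simp] theorem coeffMap_mulVar (f : M →ₗ[k] N) (x : LPoly M) :
    coeffMap k f (mulVar k x) = mulVar k (coeffMap k f x) := by
  induction x using Finsupp.induction_linear with
  | zero => simp
  | add x y hx hy => simp [hx, hy]
  | single n m => simp [coeffMap, mulVar]

@[simp] theorem subst_const (L : N →ₗ[k] N) (f : M →ₗ[k] N) (m : M) :
    subst k L f (const k m) = f m := by
  simp [subst, const]

@[simp] theorem subst_mulVar (L : N →ₗ[k] N) (f : M →ₗ[k] N) (x : LPoly M) :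
    subst k L f (mulVar k x) = L (subst k L f x) := by
  induction x using Finsupp.induction_linear with
  | zero => simp
  | add x y hx hy => simp only [map_add, hx, hy]
  | single n m => simp [subst, mulVar, pow_succ']

theorem coeffMap_coeffMap (g : N →ₗ[k] P) (f : M →ₗ[k] N) (x : LPoly M) :
    coeffMap k g (coeffMap k f x) = coeffMap k (g ∘ₗ f) x := coeffMap_comp g f x

theorem coeffMap_add_map (f g : M →ₗ[k] N) (x : LPoly M) :
    coeffMap k (f + g) x = coeffMap k f x + coeffMap k g x := by
  ext n; simp [coeffMap]

theorem coeffMap_smul_map (c : k) (f : M →ₗ[k] N) (x : LPoly M) :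
    coeffMap k (c • f) x = c • coeffMap k f x := by
  ext n; simp [coeffMap]

theorem coeffMap_zero_map (x : LPoly M) : coeffMap k (0 : M →ₗ[k] N) x = 0 := by
  ext n; simp [coeffMap]

theorem const_apply_zero (m : M) : const k m 0 = m := by simp [const]

theorem const_apply_succ (m : M) (n : ℕ) : const k m (n + 1) = 0 := by simp [const]

theorem mulVar_apply_zero (x : LPoly M) : mulVar k x 0 = 0 := by
  simp only [mulVar, Finsupp.lmapDomain_apply]
  exact Finsupp.mapDomain_of_notMem_range _ _ (by simp)

theorem mulVar_apply_succ (x : LPoly M) (n : ℕ) : mulVar k x (n + 1) = x n := by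
  simp only [mulVar, Finsupp.lmapDomain_apply]
  exact Finsupp.mapDomain_apply Nat.succ_injective x n

/-- Comparison of coefficients for polynomials of degree at most one. -/
theorem const_add_mulVar_inj {x y x' y' : M} :
    const k x + mulVar k (const k y) = const k x' + mulVar k (const k y') ↔ x = x' ∧ y = y' := by
  refine ⟨fun h => ?_, by rintro ⟨rfl, rfl⟩; rfl⟩
  have h0 := DFunLike.congr_fun h 0
  have h1 := DFunLike.congr_fun h 1
  simp only [Finsupp.add_apply, const_apply_zero, mulVar_apply_zero, add_zero,
    const_apply_succ _ 0, mulVar_apply_succ _ 0, zero_add] at h0 h1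
  exact ⟨h0, h1⟩

theorem const_injective : Function.Injective (const k : M →ₗ[k] LPoly M) :=
  Finsupp.single_injective 0

theorem eq_const_of_apply_succ {x : LPoly M} (h : ∀ n, x (n + 1) = 0) : x = const k (x 0) := by
  ext n
  cases n with
  | zero => rw [const_apply_zero]
  | succ n => rw [h, const_apply_succ]

theorem eq_const_add_mulVar {x : LPoly M} (h : ∀ n, x (n + 2) = 0) :
    x = const k (x 0) + mulVar k (const k (x 1)) := by
  ext n
  rw [Finsupp.add_apply]
  match n with
  | 0 => rw [const_apply_zero, mulVar_apply_zero, add_zero]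
  | 1 => rw [const_apply_succ, mulVar_apply_succ, const_apply_zero, zero_add]
  | n + 2 => rw [h, const_apply_succ, mulVar_apply_succ, const_apply_succ, add_zero]

/-! ### Polynomials in two variables -/

variable (k) in
/-- Apply a linear map to every coefficient of a polynomial in two variables. -/
def coeffMap₂ (f : M →ₗ[k] N) : LPoly (LPoly M) →ₗ[k] LPoly (LPoly N) := coeffMap k (coeffMap k f)

@[simp] theorem coeffMap₂_const₂ (f : M →ₗ[k] N) (m : M) :
    coeffMap₂ k f (const₂ k m) = const₂ k (f m) := by simp [coeffMap₂, const₂]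

@[simp] theorem coeffMap₂_mulLam (f : M →ₗ[k] N) (x : LPoly (LPoly M)) :
    coeffMap₂ k f (mulLam k x) = mulLam k (coeffMap₂ k f x) := by simp [coeffMap₂, mulLam]

@[simp] theorem coeffMap₂_mulMu (f : M →ₗ[k] N) (x : LPoly (LPoly M)) :
    coeffMap₂ k f (mulMu k x) = mulMu k (coeffMap₂ k f x) := by
  simp only [coeffMap₂, mulMu, coeffMap_coeffMap]
  congr 1
  congr 1
  refine LinearMap.ext fun y => ?_
  simp

theorem mulLam_mulMu (x : LPoly (LPoly M)) : mulLam k (mulMu k x) = mulMu k (mulLam k x) := by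
  simp [mulMu, mulLam]

@[simp] theorem atLam_const (m : M) : atLam k (const k m) = const₂ k m := by simp [atLam]

@[simp] theorem atMu_const (m : M) : atMu k (const k m) = const₂ k m := by simp [atMu]

@[simp] theorem atLamMu_const (m : M) : atLamMu k (const k m) = const₂ k m := by simp [atLamMu]

@[simp] theorem atLam_mulVar (x : LPoly M) : atLam k (mulVar k x) = mulLam k (atLam k x) := by
  simp [atLam]

@[simp] theorem atMu_mulVar (x : LPoly M) : atMu k (mulVar k x) = mulMu k (atMu k x) := by
  simp [atMu]

@[simp] theorem atLamMu_mulVar (x : LPoly M) :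
    atLamMu k (mulVar k x) = mulLam k (atLamMu k x) + mulMu k (atLamMu k x) := by
  simp [atLamMu]

theorem atLam_coeffMap (f : M →ₗ[k] N) (x : LPoly M) :
    atLam k (coeffMap k f x) = coeffMap₂ k f (atLam k x) := by
  refine LPoly.induction k (fun m => ?_) (fun x hx => ?_) (fun x y hx hy => ?_) x
  · simp
  · simp [hx]
  · simp only [map_add, hx, hy]

theorem atMu_coeffMap (f : M →ₗ[k] N) (x : LPoly M) :
    atMu k (coeffMap k f x) = coeffMap₂ k f (atMu k x) := by
  refine LPoly.induction k (fun m => ?_) (fun x hx => ?_) (fun x y hx hy => ?_) x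
  · simp
  · simp [hx]
  · simp only [map_add, hx, hy]

theorem atLamMu_coeffMap (f : M →ₗ[k] N) (x : LPoly M) :
    atLamMu k (coeffMap k f x) = coeffMap₂ k f (atLamMu k x) := by
  refine LPoly.induction k (fun m => ?_) (fun x hx => ?_) (fun x y hx hy => ?_) x
  · simp
  · simp [hx]
  · simp only [map_add, hx, hy]

/-- Comparison of coefficients for polynomials of total degree at most one in two variables. -/
theorem const₂_add_inj {x y z x' y' z' : M} :
    const₂ k x + mulLam k (const₂ k y) + mulMu k (const₂ k z) =
      const₂ k x' + mulLam k (const₂ k y') + mulMu k (const₂ k z') ↔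
    x = x' ∧ y = y' ∧ z = z' := by
  refine ⟨fun h => ?_, by rintro ⟨rfl, rfl, rfl⟩; rfl⟩
  have key : ∀ x y z : M, const₂ k x + mulLam k (const₂ k y) + mulMu k (const₂ k z) =
      const k (const k x + mulVar k (const k z)) + mulVar k (const k (const k y)) := by
    intro x y z
    simp only [const₂, mulLam, mulMu, LinearMap.comp_apply, coeffMap_const, map_add]
    abel
  rw [key, key, const_add_mulVar_inj, const_add_mulVar_inj] at h
  exact ⟨h.1.1, const_injective h.2, h.1.2⟩

/-! ### The substitution `P ↦ P(lam + T)_→` -/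

@[simp] theorem arrow_const (T : N →ₗ[k] N) (m : M) (v : N) :
    arrow k T (const k m ⊗ₜ[k] v) = const k (m ⊗ₜ[k] v) := by
  simp [arrow, const, subst, finsuppLeft_apply_tmul]

@[simp] theorem arrow_mulVar (T : N →ₗ[k] N) (x : LPoly M) (v : N) :
    arrow k T (mulVar k x ⊗ₜ[k] v) =
      mulVar k (arrow k T (x ⊗ₜ[k] v)) + coeffMap k (T.lTensor M) (arrow k T (x ⊗ₜ[k] v)) := by
  have h : (finsuppLeft k k M N ℕ) (mulVar k x ⊗ₜ[k] v) =
      mulVar k ((finsuppLeft k k M N ℕ) (x ⊗ₜ[k] v)) := by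
    induction x using Finsupp.induction_linear with
    | zero => simp
    | add x y hx hy => simp only [map_add, add_tmul, hx, hy]
    | single n m => simp [mulVar, finsuppLeft_apply_tmul]
  simp [arrow, h]

/-- Applying `T` to the inserted argument amounts to `T` on the last tensor factor. -/
theorem arrow_T (T : N →ₗ[k] N) (x : LPoly M) (v : N) :
    arrow k T (x ⊗ₜ[k] T v) = coeffMap k (T.lTensor M) (arrow k T (x ⊗ₜ[k] v)) := by
  refine LPoly.induction k (fun m => ?_) (fun x hx => ?_) (fun x y hx hy => ?_) x
  · simp
  · simp [hx]
  · simp only [map_add, add_tmul, hx, hy]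

theorem arrow_coeffMap (T : N →ₗ[k] N) (f : M →ₗ[k] P) (x : LPoly M) (v : N) :
    arrow k T (coeffMap k f x ⊗ₜ[k] v) = coeffMap k (f.rTensor N) (arrow k T (x ⊗ₜ[k] v)) := by
  refine LPoly.induction k (fun m => ?_) (fun x hx => ?_) (fun x y hx hy => ?_) x
  · simp
  · simp only [coeffMap_mulVar, arrow_mulVar, hx, map_add, coeffMap_coeffMap]
    congr 2
    congr 1
    rw [LinearMap.lTensor_comp_rTensor, LinearMap.rTensor_comp_lTensor]
  · simp only [map_add, add_tmul, hx, hy]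

theorem finsuppLeft_tmul_eq (x : LPoly M) (v : N) :
    finsuppLeft k k M N ℕ (x ⊗ₜ[k] v) = coeffMap k ((TensorProduct.mk k M N).flip v) x := by
  ext n
  simp [coeffMap, finsuppLeft_apply_tmul_apply]

theorem finsuppRight_tmul_eq (x : LPoly N) (v : M) :
    finsuppRight k k M N ℕ (v ⊗ₜ[k] x) = coeffMap k (TensorProduct.mk k M N v) x := by
  ext n
  simp [coeffMap, finsuppRight_apply_tmul_apply]

end Poly

/-! ### Outer and inner multiplication, and the skewsymmetry operator -/

section Skew

variable (V : GrDiffAlg k)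

theorem GrDiffAlg.T_one : V.T 1 = 0 := by simpa using V.T_mul 1 1

variable {V}

/-- The outer left multiplication `P ↦ a P` on `(V ⊗ V)[lam]`. -/
def outL (a : V.V) : LPoly (V.V ⊗[k] V.V) →ₗ[k] LPoly (V.V ⊗[k] V.V) :=
  coeffMap k ((LinearMap.mulLeft k a).rTensor V.V)

/-- The outer right multiplication `P ↦ P a` on `(V ⊗ V)[lam]`. -/
def outR (a : V.V) : LPoly (V.V ⊗[k] V.V) →ₗ[k] LPoly (V.V ⊗[k] V.V) :=
  coeffMap k ((LinearMap.mulRight k a).lTensor V.V)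

/-- The twisted inner left multiplication
`∑ₙ pₙ ⊗ qₙ lamⁿ ↦ ∑ₙ pₙ ⊗ ((lam + T)ⁿ a) qₙ` on `(V ⊗ V)[lam]`. -/
def inL (a : V.V) : LPoly (V.V ⊗[k] V.V) →ₗ[k] LPoly (V.V ⊗[k] V.V) :=
  coeffMap k (insertRight V) ∘ₗ arrow k V.T ∘ₗ
    (TensorProduct.mk k (LPoly (V.V ⊗[k] V.V)) V.V).flip a

/-- The twisted inner right multiplication
`∑ₙ pₙ ⊗ qₙ lamⁿ ↦ ∑ₙ pₙ ((lam + T)ⁿ a) ⊗ qₙ` on `(V ⊗ V)[lam]`. -/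
def inR (a : V.V) : LPoly (V.V ⊗[k] V.V) →ₗ[k] LPoly (V.V ⊗[k] V.V) :=
  coeffMap k (insertLeft V) ∘ₗ arrow k V.T ∘ₗ
    (TensorProduct.mk k (LPoly (V.V ⊗[k] V.V)) V.V).flip a

/-- The derivation `T` on the coefficients. -/
def coT : LPoly (V.V ⊗[k] V.V) →ₗ[k] LPoly (V.V ⊗[k] V.V) := coeffMap k (tensorT V)

/-- The operator `P(lam) ↦ P(- lam - T)^σ`, which expresses skewsymmetry. -/
def sk : LPoly (V.V ⊗[k] V.V) →ₗ[k] LPoly (V.V ⊗[k] V.V) :=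
  coeffMap k (TensorProduct.comm k V.V V.V).toLinearMap ∘ₗ
    subst k (- mulVar k - coeffMap k (tensorT V)) (const k)

theorem insertRight_tmul (p q a : V.V) : insertRight V ((p ⊗ₜ q) ⊗ₜ a) = p ⊗ₜ[k] (a * q) := rfl

theorem insertLeft_tmul (p q a : V.V) : insertLeft V ((p ⊗ₜ q) ⊗ₜ a) = (p * a) ⊗ₜ[k] q := rfl

theorem tensorT_tmul (p q : V.V) :
    tensorT V (p ⊗ₜ q) = V.T p ⊗ₜ[k] q + p ⊗ₜ[k] V.T q := rfl

theorem outL_const (a : V.V) (m : V.V ⊗[k] V.V) :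
    outL a (const k m) = const k ((LinearMap.mulLeft k a).rTensor V.V m) := by simp [outL]

theorem outR_const (a : V.V) (m : V.V ⊗[k] V.V) :
    outR a (const k m) = const k ((LinearMap.mulRight k a).lTensor V.V m) := by simp [outR]

theorem outL_mulVar (a : V.V) (x : LPoly (V.V ⊗[k] V.V)) :
    outL a (mulVar k x) = mulVar k (outL a x) := by simp [outL]

theorem outR_mulVar (a : V.V) (x : LPoly (V.V ⊗[k] V.V)) :
    outR a (mulVar k x) = mulVar k (outR a x) := by simp [outR]

theorem coT_const (m : V.V ⊗[k] V.V) : coT (const k m) = const k (tensorT V m) := by simp [coT]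

theorem coT_mulVar (x : LPoly (V.V ⊗[k] V.V)) :
    coT (mulVar k x) = mulVar k (coT x) := by simp [coT]

theorem inL_const (a : V.V) (m : V.V ⊗[k] V.V) :
    inL a (const k m) = const k (insertRight V (m ⊗ₜ a)) := by simp [inL]

theorem inR_const (a : V.V) (m : V.V ⊗[k] V.V) :
    inR a (const k m) = const k (insertLeft V (m ⊗ₜ a)) := by simp [inR]

theorem inL_mulVar (a : V.V) (x : LPoly (V.V ⊗[k] V.V)) :
    inL a (mulVar k x) = mulVar k (inL a x) + inL (V.T a) x := by
  simp [inL, arrow_T]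

theorem inR_mulVar (a : V.V) (x : LPoly (V.V ⊗[k] V.V)) :
    inR a (mulVar k x) = mulVar k (inR a x) + inR (V.T a) x := by
  simp [inR, arrow_T]

theorem sk_const (m : V.V ⊗[k] V.V) :
    sk (const k m) = const k (TensorProduct.comm k V.V V.V m) := by simp [sk]

theorem comm_tensorT (m : V.V ⊗[k] V.V) :
    TensorProduct.comm k V.V V.V (tensorT V m) = tensorT V (TensorProduct.comm k V.V V.V m) := by
  induction m with
  | zero => simp
  | add x y hx hy => simp only [map_add, hx, hy]
  | tmul p q => simp [tensorT_tmul, add_comm]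

theorem sk_mulVar (x : LPoly (V.V ⊗[k] V.V)) :
    sk (mulVar k x) = - mulVar k (sk x) - coT (sk x) := by
  simp only [sk, LinearMap.comp_apply, subst_mulVar, LinearMap.sub_apply, LinearMap.neg_apply,
    map_sub, map_neg, coeffMap_mulVar, coT, coeffMap_coeffMap]
  congr 2
  congr 1
  exact LinearMap.ext comm_tensorT

theorem sk_coT (x : LPoly (V.V ⊗[k] V.V)) : sk (coT x) = coT (sk x) := by
  refine LPoly.induction k (fun m => ?_) (fun x hx => ?_) (fun x y hx hy => ?_) x
  · simp only [coT_const, sk_const, comm_tensorT]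
  · simp only [coT_mulVar, sk_mulVar, hx, map_sub, map_neg]
  · simp only [map_add, hx, hy]

theorem sk_sk (x : LPoly (V.V ⊗[k] V.V)) : sk (sk x) = x := by
  refine LPoly.induction k (fun m => ?_) (fun x hx => ?_) (fun x y hx hy => ?_) x
  · simp [sk_const]
  · simp only [sk_mulVar, sk_coT, hx, map_sub, map_neg]
    abel
  · simp only [map_add, hx, hy]

/-- `coT` and the outer multiplications satisfy the Leibniz rule. -/
theorem coT_outL (a : V.V) (x : LPoly (V.V ⊗[k] V.V)) :
    coT (outL a x) = outL (V.T a) x + outL a (coT x) := by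
  simp only [coT, outL, coeffMap_coeffMap, ← coeffMap_add_map]
  congr 2
  ext p q
  simp [tensorT_tmul, V.T_mul, add_tmul, add_assoc]

theorem coT_outR (a : V.V) (x : LPoly (V.V ⊗[k] V.V)) :
    coT (outR a x) = outR (V.T a) x + outR a (coT x) := by
  simp only [coT, outR, coeffMap_coeffMap, ← coeffMap_add_map]
  congr 2
  ext p q
  simp [tensorT_tmul, V.T_mul, tmul_add]
  abel

/-- `sk` intertwines the inner and the outer left multiplications; with `sk_sk` this reduces the
laws of the inner structure to those of the outer one. -/
theorem sk_inL (a : V.V) (x : LPoly (V.V ⊗[k] V.V)) : sk (inL a x) = outL a (sk x) := by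
  revert a
  refine LPoly.induction k (fun m a => ?_) (fun x hx a => ?_) (fun x y hx hy a => ?_) x
  · rw [inL_const, sk_const, sk_const, outL_const]
    congr 1
    induction m with
    | zero => simp
    | add x y hx hy => simp only [map_add, add_tmul, hx, hy]
    | tmul p q => simp [insertRight_tmul]
  · simp only [inL_mulVar, map_add, sk_mulVar, hx, map_sub, map_neg, outL_mulVar, coT_outL]
    abel
  · simp only [map_add, hx, hy]

theorem sk_inR (a : V.V) (x : LPoly (V.V ⊗[k] V.V)) : sk (inR a x) = outR a (sk x) := by
  revert a
  refine LPoly.induction k (fun m a => ?_) (fun x hx a => ?_) (fun x y hx hy a => ?_) x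
  · rw [inR_const, sk_const, sk_const, outR_const]
    congr 1
    induction m with
    | zero => simp
    | add x y hx hy => simp only [map_add, add_tmul, hx, hy]
    | tmul p q => simp [insertLeft_tmul]
  · simp only [inR_mulVar, map_add, sk_mulVar, hx, map_sub, map_neg, outR_mulVar, coT_outR]
    abel
  · simp only [map_add, hx, hy]

theorem sk_outL (a : V.V) (x : LPoly (V.V ⊗[k] V.V)) : sk (outL a x) = inL a (sk x) := by
  conv_lhs => rw [← sk_sk x, ← sk_inL, sk_sk]

theorem sk_outR (a : V.V) (x : LPoly (V.V ⊗[k] V.V)) : sk (outR a x) = inR a (sk x) := by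
  conv_lhs => rw [← sk_sk x, ← sk_inR, sk_sk]

/-- Conjugation by `sk` turns the inner multiplications into the outer ones. -/
theorem inL_eq (a : V.V) (x : LPoly (V.V ⊗[k] V.V)) : inL a x = sk (outL a (sk x)) := by
  rw [← sk_inL, sk_sk]

theorem inR_eq (a : V.V) (x : LPoly (V.V ⊗[k] V.V)) : inR a x = sk (outR a (sk x)) := by
  rw [← sk_inR, sk_sk]

theorem outL_outR (a b : V.V) (x : LPoly (V.V ⊗[k] V.V)) :
    outL a (outR b x) = outR b (outL a x) := by
  simp only [outL, outR, coeffMap_coeffMap]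
  congr 2
  ext p q
  simp

theorem outL_mul (a b : V.V) (x : LPoly (V.V ⊗[k] V.V)) :
    outL (a * b) x = outL a (outL b x) := by
  simp only [outL, coeffMap_coeffMap, LinearMap.mulLeft_mul, LinearMap.rTensor_comp]

theorem outR_mul (a b : V.V) (x : LPoly (V.V ⊗[k] V.V)) :
    outR (a * b) x = outR b (outR a x) := by
  simp only [outR, coeffMap_coeffMap, LinearMap.mulRight_mul, LinearMap.lTensor_comp]

theorem outL_one (x : LPoly (V.V ⊗[k] V.V)) : outL (1 : V.V) x = x := by
  simp only [outL, LinearMap.mulLeft_one, LinearMap.rTensor_id, coeffMap_id]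

theorem outR_one (x : LPoly (V.V ⊗[k] V.V)) : outR (1 : V.V) x = x := by
  simp only [outR, LinearMap.mulRight_one, LinearMap.lTensor_id, coeffMap_id]

theorem outL_inL (a b : V.V) (x : LPoly (V.V ⊗[k] V.V)) :
    outL a (inL b x) = inL b (outL a x) := by
  revert b
  refine LPoly.induction k (fun m b => ?_) (fun x hx b => ?_) (fun x y hx hy b => ?_) x
  · rw [inL_const, outL_const, outL_const, inL_const]
    congr 1
    induction m with
    | zero => simp
    | add x y hx hy => simp only [map_add, add_tmul, hx, hy]
    | tmul p q => simp [insertRight_tmul]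
  · simp only [inL_mulVar, map_add, hx, outL_mulVar]
  · simp only [map_add, hx, hy]

theorem outR_inL (a b : V.V) (x : LPoly (V.V ⊗[k] V.V)) :
    outR a (inL b x) = inL b (outR a x) := by
  revert b
  refine LPoly.induction k (fun m b => ?_) (fun x hx b => ?_) (fun x y hx hy b => ?_) x
  · rw [inL_const, outR_const, outR_const, inL_const]
    congr 1
    induction m with
    | zero => simp
    | add x y hx hy => simp only [map_add, add_tmul, hx, hy]
    | tmul p q => simp [insertRight_tmul, mul_assoc]
  · simp only [inL_mulVar, map_add, hx, outR_mulVar]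
  · simp only [map_add, hx, hy]

theorem outL_inR (a b : V.V) (x : LPoly (V.V ⊗[k] V.V)) :
    outL a (inR b x) = inR b (outL a x) := by
  revert b
  refine LPoly.induction k (fun m b => ?_) (fun x hx b => ?_) (fun x y hx hy b => ?_) x
  · rw [inR_const, outL_const, outL_const, inR_const]
    congr 1
    induction m with
    | zero => simp
    | add x y hx hy => simp only [map_add, add_tmul, hx, hy]
    | tmul p q => simp [insertLeft_tmul, mul_assoc]
  · simp only [inR_mulVar, map_add, hx, outL_mulVar]
  · simp only [map_add, hx, hy]

theorem outR_inR (a b : V.V) (x : LPoly (V.V ⊗[k] V.V)) :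
    outR a (inR b x) = inR b (outR a x) := by
  revert b
  refine LPoly.induction k (fun m b => ?_) (fun x hx b => ?_) (fun x y hx hy b => ?_) x
  · rw [inR_const, outR_const, outR_const, inR_const]
    congr 1
    induction m with
    | zero => simp
    | add x y hx hy => simp only [map_add, add_tmul, hx, hy]
    | tmul p q => simp [insertLeft_tmul]
  · simp only [inR_mulVar, map_add, hx, outR_mulVar]
  · simp only [map_add, hx, hy]

theorem coT_inL (a : V.V) (x : LPoly (V.V ⊗[k] V.V)) :
    coT (inL a x) = inL (V.T a) x + inL a (coT x) := by
  rw [inL_eq, ← sk_coT, coT_outL, map_add, inL_eq, inL_eq, sk_coT]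

theorem coT_inR (a : V.V) (x : LPoly (V.V ⊗[k] V.V)) :
    coT (inR a x) = inR (V.T a) x + inR a (coT x) := by
  rw [inR_eq, ← sk_coT, coT_outR, map_add, inR_eq, inR_eq, sk_coT]

end Skew

/-! ### Brackets satisfying sesquilinearity and the Leibniz rules -/

/-- A double `lam`-bracket that satisfies sesquilinearity and both Leibniz rules; neither
skewsymmetry nor the Jacobi identity is required. -/
structure IsSesqLeibniz {V : GrDiffAlg k}
    (br : V.V →ₗ[k] V.V →ₗ[k] LPoly (V.V ⊗[k] V.V)) : Prop where
  sesq_left : ∀ a b : V.V, br (V.T a) b = - mulVar k (br a b)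
  sesq_right : ∀ a b : V.V, br a (V.T b) = mulVar k (br a b) + coT (br a b)
  leibniz_left : ∀ a b c : V.V, br a (b * c) = outL b (br a c) + outR c (br a b)
  leibniz_right : ∀ a b c : V.V, br (a * b) c = inR b (br a c) + inL a (br b c)

theorem DoublePVA.isSesqLeibniz {V : GrDiffAlg k} (B : DoublePVA V) : IsSesqLeibniz B.br where
  sesq_left := B.sesq_left
  sesq_right := B.sesq_right
  leibniz_left := B.leibniz_left
  leibniz_right := B.leibniz_right

theorem DoublePVA.br_eq_neg_sk {V : GrDiffAlg k} (B : DoublePVA V) (a b : V.V) :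
    B.br a b = - sk (B.br b a) := B.skew a b

/-- The differential algebra `V` is generated by the images of `iA` and `iE`, as an
induction principle. -/
def GeneratedBy {V : GrDiffAlg k} {D : DerBimod k} (iA : D.A →ₗ[k] V.V) (iE : D.E →ₗ[k] V.V) :
    Prop :=
  ∀ p : V.V → Prop, (∀ a, p (iA a)) → (∀ e, p (iE e)) → (∀ x y, p x → p y → p (x + y)) →
    (∀ x y, p x → p y → p (x * y)) → (∀ x, p x → p (V.T x)) → ∀ x, p x

section Generation

variable {V : GrDiffAlg k} {D : DerBimod k} {iA : D.A →ₗ[k] V.V} {iE : D.E →ₗ[k] V.V}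
  {br : V.V →ₗ[k] V.V →ₗ[k] LPoly (V.V ⊗[k] V.V)}

/-- Skewsymmetry is preserved under products, because `sk` exchanges the two Leibniz rules. -/
theorem IsSesqLeibniz.skew_mul (hb : IsSesqLeibniz br) {a b c : V.V}
    (h1 : br a b = - sk (br b a)) (h2 : br a c = - sk (br c a)) :
    br a (b * c) = - sk (br (b * c) a) := by
  rw [hb.leibniz_left, hb.leibniz_right, map_add, sk_inL, sk_inR, h1, h2, map_neg, map_neg]
  abel

theorem IsSesqLeibniz.skew_T (hb : IsSesqLeibniz br) {a b : V.V}
    (h : br a b = - sk (br b a)) : br a (V.T b) = - sk (br (V.T b) a) := by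
  rw [hb.sesq_right, hb.sesq_left, map_neg, sk_mulVar, h, map_neg, map_neg]
  abel

theorem skew_symm {a b : V.V} (h : br a b = - sk (br b a)) : br b a = - sk (br a b) := by
  rw [h, map_neg, sk_sk, neg_neg]

/-- Skewsymmetry follows from skewsymmetry on generators. -/
theorem IsSesqLeibniz.skew_of_generators (hb : IsSesqLeibniz br) (hg : GeneratedBy iA iE)
    (hAA : ∀ a b, br (iA a) (iA b) = - sk (br (iA b) (iA a)))
    (hAE : ∀ a e, br (iA a) (iE e) = - sk (br (iE e) (iA a)))
    (hEE : ∀ e f, br (iE e) (iE f) = - sk (br (iE f) (iE e))) (x y : V.V) :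
    br x y = - sk (br y x) := by
  -- It suffices to check generators in one argument. Skewsymmetry is a symmetric relation, so the
  -- reduction applies to both arguments in turn.
  have step : ∀ x, (∀ a, br x (iA a) = - sk (br (iA a) x)) →
      (∀ e, br x (iE e) = - sk (br (iE e) x)) → ∀ y, br x y = - sk (br y x) := by
    intro x h1 h2
    refine hg _ h1 h2 (fun y z hy hz => ?_) (fun y z hy hz => hb.skew_mul hy hz)
      (fun y hy => hb.skew_T hy)
    simp only [map_add, LinearMap.add_apply, hy, hz, neg_add]
  refine step x (fun a => skew_symm ?_) (fun e => skew_symm ?_) y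
  · exact step _ (hAA a) (hAE a) x
  · exact step _ (fun a => skew_symm (hAE a e)) (hEE e) x

end Generation

/-! ### The Jacobi identity -/

section Jacobi

variable {V : GrDiffAlg k}

/-- `V ⊗ V ⊗ V`. -/
abbrev GrDiffAlg.Tri (V : GrDiffAlg k) : Type u := V.V ⊗[k] (V.V ⊗[k] V.V)

/-- The cyclic permutation `x ⊗ y ⊗ z ↦ z ⊗ x ⊗ y`. -/
def rot : V.Tri →ₗ[k] V.Tri :=
  (TensorProduct.comm k (V.V ⊗[k] V.V) V.V).toLinearMap ∘ₗ
    (TensorProduct.assoc k V.V V.V V.V).symm.toLinearMap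

theorem rot_tmul (x y z : V.V) : rot (x ⊗ₜ (y ⊗ₜ z)) = z ⊗ₜ[k] (x ⊗ₜ[k] y) := rfl

/-- `T` on `V ⊗ V ⊗ V`, by the Leibniz rule. -/
def triT : V.Tri →ₗ[k] V.Tri := V.T.rTensor (V.V ⊗[k] V.V) + (tensorT V).lTensor V.V

theorem triT_tmul (x y z : V.V) : triT (x ⊗ₜ (y ⊗ₜ z)) =
    V.T x ⊗ₜ[k] (y ⊗ₜ[k] z) + x ⊗ₜ[k] (V.T y ⊗ₜ[k] z) + x ⊗ₜ[k] (y ⊗ₜ[k] V.T z) := by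
  simp [triT, tensorT_tmul, tmul_add, add_assoc]

variable (V) in
/-- `(V ⊗ V ⊗ V)[lam, mu]`. -/
abbrev GrDiffAlg.TriPoly : Type u := LPoly (LPoly V.Tri)

/-- `T` on the coefficients of polynomials in two variables. -/
def triCoT : V.TriPoly →ₗ[k] V.TriPoly := coeffMap₂ k triT

/-- The cyclic permutation of the tensor factors of `(V ⊗ V ⊗ V)[lam, mu]` together with the
variables `lam`, `mu`, `nu := - lam - mu - T`: it substitutes `mu` for `lam` and `nu` for `mu`. -/
def cyc : V.TriPoly →ₗ[k] V.TriPoly :=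
  subst k (mulMu k) (subst k (- mulLam k - mulMu k - triCoT) (const₂ k ∘ₗ rot))

theorem cyc_const₂ (m : V.Tri) : cyc (const₂ k m) = const₂ k (rot m) := by
  simp [cyc, const₂]

theorem cyc_mulLam (x : V.TriPoly) : cyc (mulLam k x) = mulMu k (cyc x) := by
  simp [cyc, mulLam]

theorem triCoT_mulMu (x : V.TriPoly) : triCoT (mulMu k x) = mulMu k (triCoT x) := by
  simp [triCoT]

theorem triCoT_mulLam (x : V.TriPoly) : triCoT (mulLam k x) = mulLam k (triCoT x) := by
  simp [triCoT]

theorem cyc_mulMu (x : V.TriPoly) :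
    cyc (mulMu k x) = - mulLam k (cyc x) - mulMu k (cyc x) - triCoT (cyc x) := by
  refine LPoly.induction k (fun m => ?_) (fun x hx => ?_) (fun x y hx hy => ?_) x
  · simp [cyc, mulMu]
  · have h1 : mulVar k x = mulLam k x := rfl
    rw [h1, ← mulLam_mulMu, cyc_mulLam, hx, cyc_mulLam, triCoT_mulMu, mulLam_mulMu]
    simp only [map_sub, map_neg]
  · simp only [map_add, hx, hy]
    abel

theorem rot_triT (m : V.Tri) : rot (triT m) = triT (rot m) := by
  have : (rot ∘ₗ triT : V.Tri →ₗ[k] V.Tri) = triT ∘ₗ rot := by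
    ext x y z
    simp only [LinearMap.comp_apply, AlgebraTensorModule.curry_apply, TensorProduct.curry_apply,
      LinearMap.restrictScalars_self,
      triT_tmul, rot_tmul, map_add]
    abel
  exact DFunLike.congr_fun this m

theorem rot_rot_rot (m : V.Tri) : rot (rot (rot m)) = m := by
  have : (rot ∘ₗ rot ∘ₗ rot : V.Tri →ₗ[k] V.Tri) = LinearMap.id := by
    ext x y z; rfl
  exact DFunLike.congr_fun this m

theorem cyc_triCoT (x : V.TriPoly) : cyc (triCoT x) = triCoT (cyc x) := by
  refine LPoly.induction₂ k (fun m => ?_) (fun x hx => ?_) (fun x hx => ?_) (fun x y hx hy => ?_) x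
  · simp [cyc_const₂, triCoT, rot_triT]
  · rw [triCoT_mulLam, cyc_mulLam, cyc_mulLam, hx, triCoT_mulMu]
  · rw [triCoT_mulMu, cyc_mulMu, cyc_mulMu, hx]
    simp only [map_sub, map_neg, triCoT_mulLam, triCoT_mulMu]
  · simp only [map_add, hx, hy]

theorem cyc_cyc_mulLam (x : V.TriPoly) : cyc (cyc (mulLam k x)) =
    - mulLam k (cyc (cyc x)) - mulMu k (cyc (cyc x)) - triCoT (cyc (cyc x)) := by
  rw [cyc_mulLam, cyc_mulMu]

theorem cyc_cyc_mulMu (x : V.TriPoly) : cyc (cyc (mulMu k x)) = mulLam k (cyc (cyc x)) := by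
  simp only [cyc_mulMu, map_sub, map_neg, cyc_mulLam, cyc_triCoT]
  abel

/-- `lam`, `mu` and `nu` are permuted cyclically, so `cyc` has order three. -/
theorem cyc_cyc_cyc (x : V.TriPoly) : cyc (cyc (cyc x)) = x := by
  refine LPoly.induction₂ k (fun m => ?_) (fun x hx => ?_) (fun x hx => ?_) (fun x y hx hy => ?_) x
  · rw [cyc_const₂, cyc_const₂, cyc_const₂, rot_rot_rot]
  · rw [cyc_mulLam, cyc_cyc_mulMu, hx]
  · rw [cyc_cyc_mulMu, cyc_mulLam, hx]
  · simp only [map_add, hx, hy]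

variable (br : V.V →ₗ[k] V.V →ₗ[k] LPoly (V.V ⊗[k] V.V))

theorem brL_tmul (a b c : V.V) : brL br a (b ⊗ₜ c) =
    coeffMap k (asc k V.V V.V V.V ∘ₗ (TensorProduct.mk k _ V.V).flip c) (br a b) := by
  simp [brL, finsuppLeft_tmul_eq, coeffMap_coeffMap]

theorem brR_tmul (a b c : V.V) : brR br a (b ⊗ₜ c) =
    coeffMap k (TensorProduct.mk k V.V (V.V ⊗[k] V.V) b) (br a c) := by
  simp [brR, finsuppRight_tmul_eq]

theorem brFirst_tmul (a b c : V.V) : brFirst br c (a ⊗ₜ b) =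
    coeffMap k (jump k V.V V.V V.V) (arrow k V.T (br a c ⊗ₜ b)) := by
  simp [brFirst]

/-- The left side `Q(mu) ↦ {a_lam Q(mu)}_L` of the Jacobi identity, extended to polynomials. -/
def jacL (a : V.V) : LPoly (V.V ⊗[k] V.V) →ₗ[k] V.TriPoly :=
  subst k (mulMu k) (atLam k ∘ₗ brL br a)

/-- The operator `Q(lam) ↦ {b_mu Q(lam)}_R` in the Jacobi identity. -/
def jacR (b : V.V) : LPoly (V.V ⊗[k] V.V) →ₗ[k] V.TriPoly :=
  subst k (mulLam k) (atMu k ∘ₗ brR br b)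

/-- The operator `Q(lam) ↦ {Q(lam)_{lam + mu} c}_L` in the Jacobi identity. -/
def jacF (c : V.V) : LPoly (V.V ⊗[k] V.V) →ₗ[k] V.TriPoly :=
  subst k (mulLam k) (atLamMu k ∘ₗ brFirst br c)

theorem jacL_const (a : V.V) (m) : jacL br a (const k m) = atLam k (brL br a m) := by
  simp [jacL]

theorem jacR_const (a : V.V) (m) : jacR br a (const k m) = atMu k (brR br a m) := by
  simp [jacR]

theorem jacF_const (a : V.V) (m) : jacF br a (const k m) = atLamMu k (brFirst br a m) := by
  simp [jacF]

theorem jacL_mulVar (a : V.V) (x) : jacL br a (mulVar k x) = mulMu k (jacL br a x) := by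
  simp [jacL]

theorem jacR_mulVar (a : V.V) (x) : jacR br a (mulVar k x) = mulLam k (jacR br a x) := by
  simp [jacR]

theorem jacF_mulVar (a : V.V) (x) : jacF br a (mulVar k x) = mulLam k (jacF br a x) := by
  simp [jacF]

/-- The Jacobi identity for the elements `a`, `b`, `c`. -/
def Jac (a b c : V.V) : Prop :=
  jacL br a (br b c) = jacR br b (br a c) + jacF br c (br a b)

variable {br}

/-- `{a_lam T m}_L = (lam + T) {a_lam m}_L`. -/
theorem IsSesqLeibniz.brL_tensorT (hb : IsSesqLeibniz br) (a : V.V) (m : V.V ⊗[k] V.V) :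
    brL br a (tensorT V m) = mulVar k (brL br a m) + coeffMap k triT (brL br a m) := by
  induction m with
  | zero => simp
  | add x y hx hy => simp only [map_add, hx, hy]; abel
  | tmul p q =>
    have h : triT ∘ₗ asc k V.V V.V V.V ∘ₗ (TensorProduct.mk k _ V.V).flip q =
        asc k V.V V.V V.V ∘ₗ (TensorProduct.mk k _ V.V).flip q ∘ₗ tensorT V +
          asc k V.V V.V V.V ∘ₗ (TensorProduct.mk k _ V.V).flip (V.T q) := by
      ext x y
      change triT (x ⊗ₜ (y ⊗ₜ q)) = asc k V.V V.V V.V ((tensorT V (x ⊗ₜ y)) ⊗ₜ q) +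
        x ⊗ₜ (y ⊗ₜ V.T q)
      rw [tensorT_tmul, triT_tmul, add_tmul, map_add]
      rfl
    rw [tensorT_tmul, map_add, brL_tmul, brL_tmul, brL_tmul, hb.sesq_right, coeffMap_coeffMap, h,
      coeffMap_add_map, map_add, coeffMap_mulVar, coT, coeffMap_coeffMap, add_assoc]
    rfl

/-- `{a_lam T m}_R = (lam + T) {a_lam m}_R`. -/
theorem IsSesqLeibniz.brR_tensorT (hb : IsSesqLeibniz br) (a : V.V) (m : V.V ⊗[k] V.V) :
    brR br a (tensorT V m) = mulVar k (brR br a m) + coeffMap k triT (brR br a m) := by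
  induction m with
  | zero => simp
  | add x y hx hy => simp only [map_add, hx, hy]; abel
  | tmul p q =>
    have h : triT ∘ₗ TensorProduct.mk k V.V (V.V ⊗[k] V.V) p =
        TensorProduct.mk k V.V (V.V ⊗[k] V.V) p ∘ₗ tensorT V +
          TensorProduct.mk k V.V (V.V ⊗[k] V.V) (V.T p) := by
      ext x y
      change triT (p ⊗ₜ (x ⊗ₜ y)) = p ⊗ₜ (tensorT V (x ⊗ₜ y)) + V.T p ⊗ₜ (x ⊗ₜ y)
      rw [tensorT_tmul, triT_tmul, tmul_add]
      abel
    rw [tensorT_tmul, map_add, brR_tmul, brR_tmul, brR_tmul, hb.sesq_right, coeffMap_coeffMap, h,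
      coeffMap_add_map, map_add, coeffMap_mulVar, coT, coeffMap_coeffMap]
    abel

theorem IsSesqLeibniz.jacL_coT (hb : IsSesqLeibniz br) (a : V.V) (x : LPoly (V.V ⊗[k] V.V)) :
    jacL br a (coT x) = mulLam k (jacL br a x) + triCoT (jacL br a x) := by
  refine LPoly.induction k (fun m => ?_) (fun x hx => ?_) (fun x y hx hy => ?_) x
  · rw [coT_const, jacL_const, jacL_const, hb.brL_tensorT, map_add, atLam_mulVar, atLam_coeffMap]
    rfl
  · rw [coT_mulVar, jacL_mulVar, jacL_mulVar, hx, map_add, triCoT_mulMu, mulLam_mulMu]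
  · simp only [map_add, hx, hy]; abel

theorem IsSesqLeibniz.jacR_coT (hb : IsSesqLeibniz br) (a : V.V) (x : LPoly (V.V ⊗[k] V.V)) :
    jacR br a (coT x) = mulMu k (jacR br a x) + triCoT (jacR br a x) := by
  refine LPoly.induction k (fun m => ?_) (fun x hx => ?_) (fun x y hx hy => ?_) x
  · rw [coT_const, jacR_const, jacR_const, hb.brR_tensorT, map_add, atMu_mulVar, atMu_coeffMap]
    rfl
  · rw [coT_mulVar, jacR_mulVar, jacR_mulVar, hx, map_add, triCoT_mulLam, mulLam_mulMu]
  · simp only [map_add, hx, hy]; abel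

/-- `{b_mu Q^σ}_R` is the cyclic permutation of `{b_lam Q}_L`. -/
theorem IsSesqLeibniz.jacR_sk (hb : IsSesqLeibniz br) (b : V.V) (x : LPoly (V.V ⊗[k] V.V)) :
    jacR br b (sk x) = cyc (jacL br b x) := by
  refine LPoly.induction k (fun m => ?_) (fun x hx => ?_) (fun x y hx hy => ?_) x
  · have h1 : ∀ y : LPoly V.Tri, cyc (atLam k y) = atMu k (coeffMap k rot y) := fun y => by
      refine LPoly.induction k (fun m => ?_) (fun x hx => ?_) (fun x y hx hy => ?_) y
      · simp [cyc_const₂]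
      · simp [cyc_mulLam, hx]
      · simp only [map_add, hx, hy]
    rw [sk_const, jacR_const, jacL_const, h1]
    congr 1
    induction m with
    | zero => simp
    | add x y hx hy => simp only [map_add, hx, hy]
    | tmul p q =>
      rw [comm_tmul, brR_tmul, brL_tmul, coeffMap_coeffMap]
      congr 2
      ext x y
      rfl
  · rw [sk_mulVar, map_sub, map_neg, hb.jacR_coT, jacR_mulVar, hx, jacL_mulVar, cyc_mulMu]
    abel
  · simp only [map_add, hx, hy]

theorem triT_jump (m : (V.V ⊗[k] V.V) ⊗[k] V.V) : triT (jump k V.V V.V V.V m) =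
    jump k V.V V.V V.V ((V.T.lTensor (V.V ⊗[k] V.V) + (tensorT V).rTensor V.V) m) := by
  have h : triT ∘ₗ jump k V.V V.V V.V = jump k V.V V.V V.V ∘ₗ
      (V.T.lTensor (V.V ⊗[k] V.V) + (tensorT V).rTensor V.V) := by
    ext x y z
    change triT (x ⊗ₜ (z ⊗ₜ y)) = jump k V.V V.V V.V ((x ⊗ₜ y) ⊗ₜ V.T z +
      (tensorT V (x ⊗ₜ y)) ⊗ₜ z)
    rw [tensorT_tmul, triT_tmul, add_tmul, map_add, map_add]
    change _ = x ⊗ₜ (V.T z ⊗ₜ y) + (V.T x ⊗ₜ (z ⊗ₜ y) + x ⊗ₜ (z ⊗ₜ V.T y))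
    abel
  exact DFunLike.congr_fun h m

/-- For a skewsymmetric bracket, `{Q_{lam + mu} c}_L` is, up to the sign, a cyclic permutation of
`{c_lam Q}_L`. -/
theorem jacF_eq_neg_cyc (hs : ∀ x y, br x y = - sk (br y x)) (c : V.V)
    (x : LPoly (V.V ⊗[k] V.V)) : jacF br c x = - cyc (cyc (jacL br c x)) := by
  refine LPoly.induction k (fun m => ?_) (fun x hx => ?_) (fun x y hx hy => ?_) x
  · rw [jacF_const, jacL_const]
    induction m with
    | zero => simp
    | add x y hx hy => simp only [map_add, hx, hy, neg_add]
    | tmul p q =>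
      rw [brFirst_tmul, brL_tmul, hs p c, neg_tmul, map_neg, map_neg, map_neg, neg_inj]
      refine LPoly.induction k (fun m => ?_) (fun x hx => ?_) (fun x y hx hy => ?_) (br c p)
      · rw [sk_const, arrow_const, coeffMap_const, coeffMap_const, atLamMu_const, atLam_const,
          cyc_const₂, cyc_const₂]
        congr 1
        induction m with
        | zero => simp
        | add x y hx hy => simp only [map_add, add_tmul, hx, hy]
        | tmul x y => rfl
      · rw [coeffMap_mulVar, atLam_mulVar, cyc_cyc_mulLam, ← hx, sk_mulVar, sub_tmul, neg_tmul,
          map_sub, map_neg, arrow_mulVar, coT, arrow_coeffMap]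
        have h : triT ∘ₗ jump k V.V V.V V.V = jump k V.V V.V V.V ∘ₗ
            (V.T.lTensor (V.V ⊗[k] V.V) + (tensorT V).rTensor V.V) := LinearMap.ext triT_jump
        have h2 : ∀ y : LPoly ((V.V ⊗[k] V.V) ⊗[k] V.V),
            triCoT (atLamMu k (coeffMap k (jump k V.V V.V V.V) y)) =
            atLamMu k (coeffMap k (jump k V.V V.V V.V) (coeffMap k (V.T.lTensor _) y)) +
            atLamMu k (coeffMap k (jump k V.V V.V V.V) (coeffMap k ((tensorT V).rTensor _) y)) := by
          intro y
          rw [triCoT, ← atLamMu_coeffMap, coeffMap_coeffMap, h, ← map_add, ← map_add,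
            ← coeffMap_add_map, coeffMap_coeffMap]
        rw [h2]
        simp only [map_sub, map_neg, map_add, coeffMap_mulVar, atLamMu_mulVar]
        abel
      · simp only [map_add, add_tmul, hx, hy]
  · rw [jacF_mulVar, hx, jacL_mulVar, cyc_cyc_mulMu, map_neg]
  · simp only [map_add, hx, hy, neg_add]

/-- The Jacobi identity of a skewsymmetric bracket in cyclically symmetric form: the cyclic sum of
`{a_lam {b_mu c}}_L` vanishes. -/
theorem IsSesqLeibniz.jac_iff (hb : IsSesqLeibniz br) (hs : ∀ x y, br x y = - sk (br y x))
    (a b c : V.V) : Jac br a b c ↔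
      jacL br a (br b c) + cyc (jacL br b (br c a)) + cyc (cyc (jacL br c (br a b))) = 0 := by
  rw [Jac, jacF_eq_neg_cyc hs, hs a c, map_neg, hb.jacR_sk, ← sub_eq_zero]
  congr! 1
  abel

theorem IsSesqLeibniz.jac_rotate (hb : IsSesqLeibniz br) (hs : ∀ x y, br x y = - sk (br y x))
    {a b c : V.V} (h : Jac br a b c) : Jac br c a b := by
  rw [hb.jac_iff hs] at h ⊢
  have := congrArg cyc h
  rw [map_add, map_add, cyc_cyc_cyc, map_zero] at this
  rw [← this]
  abel

end Jacobi

section JacobiDerivation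

variable {V : GrDiffAlg k} {br : V.V →ₗ[k] V.V →ₗ[k] LPoly (V.V ⊗[k] V.V)}

/-- The outer left multiplication on `(V ⊗ V ⊗ V)[lam, mu]`. -/
def triL (a : V.V) : V.TriPoly →ₗ[k] V.TriPoly :=
  coeffMap₂ k ((LinearMap.mulLeft k a).rTensor (V.V ⊗[k] V.V))

/-- The outer right multiplication on `(V ⊗ V ⊗ V)[lam, mu]`. -/
def triR (a : V.V) : V.TriPoly →ₗ[k] V.TriPoly :=
  coeffMap₂ k (((LinearMap.mulRight k a).lTensor V.V).lTensor V.V)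

/-- The product in the middle factor, `(x ⊗ y, p ⊗ q) ↦ x ⊗ y p ⊗ q`. -/
def mid : V.V ⊗[k] V.V →ₗ[k] V.V ⊗[k] V.V →ₗ[k] V.Tri :=
  TensorProduct.curry
    ((LinearMap.mul' k V.V).rTensor V.V |>.lTensor V.V |>.comp
      ((TensorProduct.assoc k V.V V.V V.V).symm.toLinearMap.lTensor V.V |>.comp
        (TensorProduct.assoc k V.V V.V (V.V ⊗[k] V.V)).toLinearMap))

/-- The product `P(lam) Q(mu)` in the middle factor. -/
def midPoly (P : LPoly (V.V ⊗[k] V.V)) : LPoly (V.V ⊗[k] V.V) →ₗ[k] V.TriPoly :=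
  subst k (mulMu k) (atLam k ∘ₗ (coeffHom P))
where
  /-- `m ↦ P m`, for the product in the middle factor. -/
  coeffHom (P : LPoly (V.V ⊗[k] V.V)) : V.V ⊗[k] V.V →ₗ[k] LPoly V.Tri :=
    { toFun := fun m => coeffMap k (mid.flip m) P
      map_add' := fun m n => by rw [map_add, coeffMap_add_map]
      map_smul' := fun c m => by rw [map_smul, coeffMap_smul_map]; rfl }

theorem midPoly_const (P : LPoly (V.V ⊗[k] V.V)) (m : V.V ⊗[k] V.V) :
    midPoly P (const k m) = atLam k (coeffMap k (mid.flip m) P) := by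
  simp [midPoly, midPoly.coeffHom]

theorem midPoly_mulVar (P x : LPoly (V.V ⊗[k] V.V)) :
    midPoly P (mulVar k x) = mulMu k (midPoly P x) := by
  simp [midPoly]

theorem midPoly_mulVar_left (P x : LPoly (V.V ⊗[k] V.V)) :
    midPoly (mulVar k P) x = mulLam k (midPoly P x) := by
  refine LPoly.induction k (fun m => ?_) (fun x hx => ?_) (fun x y hx hy => ?_) x
  · simp [midPoly_const]
  · rw [midPoly_mulVar, midPoly_mulVar, hx, mulLam_mulMu]
  · simp only [map_add, hx, hy]

theorem midPoly_add_left (P P' x : LPoly (V.V ⊗[k] V.V)) :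
    midPoly (P + P') x = midPoly P x + midPoly P' x := by
  refine LPoly.induction k (fun m => ?_) (fun x hx => ?_) (fun x y hx hy => ?_) x
  · simp only [midPoly_const, map_add]
  · simp only [midPoly_mulVar, hx, map_add]
  · simp only [map_add, hx, hy]; abel

theorem midPoly_const_left (m : V.V ⊗[k] V.V) (x : LPoly (V.V ⊗[k] V.V)) :
    midPoly (const k m) x = atMu k (coeffMap k (mid m) x) := by
  refine LPoly.induction k (fun m => ?_) (fun x hx => ?_) (fun x y hx hy => ?_) x
  · simp [midPoly_const]
  · simp [midPoly_mulVar, hx]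
  · simp only [map_add, hx, hy]

/-- `{a_lam c Q}_L = c {a_lam Q}_L + {a_lam c} Q`, with the last product in the middle factor. -/
theorem IsSesqLeibniz.jacL_outL (hb : IsSesqLeibniz br) (a c : V.V) (x : LPoly (V.V ⊗[k] V.V)) :
    jacL br a (outL c x) = triL c (jacL br a x) + midPoly (br a c) x := by
  refine LPoly.induction k (fun m => ?_) (fun x hx => ?_) (fun x y hx hy => ?_) x
  · rw [outL_const, jacL_const, jacL_const, midPoly_const, triL, ← atLam_coeffMap, ← map_add]
    congr 1
    induction m with
    | zero => simp [coeffMap_zero_map]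
    | add x y hx hy => simp only [map_add, hx, hy, coeffMap_add_map]; abel
    | tmul p q =>
      rw [LinearMap.rTensor_tmul, LinearMap.mulLeft_apply, brL_tmul, brL_tmul, hb.leibniz_left,
        map_add, outL, outR, coeffMap_coeffMap, coeffMap_coeffMap, coeffMap_coeffMap]
      congr 2
      · congr 1
        ext x y
        rfl
      · congr 1
        ext x y
        rfl
  · simp only [outL_mulVar, jacL_mulVar, midPoly_mulVar, hx, map_add, triL, coeffMap₂_mulMu]
  · simp only [map_add, hx, hy]; abel

theorem jacL_outR (a d : V.V) (x : LPoly (V.V ⊗[k] V.V)) :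
    jacL br a (outR d x) = triR d (jacL br a x) := by
  refine LPoly.induction k (fun m => ?_) (fun x hx => ?_) (fun x y hx hy => ?_) x
  · rw [outR_const, jacL_const, jacL_const, triR, ← atLam_coeffMap]
    congr 1
    induction m with
    | zero => simp
    | add x y hx hy => simp only [map_add, hx, hy]
    | tmul p q =>
      rw [LinearMap.lTensor_tmul, LinearMap.mulRight_apply, brL_tmul, brL_tmul, coeffMap_coeffMap]
      congr 2
      ext x y
      rfl
  · simp only [outR_mulVar, jacL_mulVar, hx, triR, coeffMap₂_mulMu]
  · simp only [map_add, hx, hy]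

theorem jacR_outL (b c : V.V) (x : LPoly (V.V ⊗[k] V.V)) :
    jacR br b (outL c x) = triL c (jacR br b x) := by
  refine LPoly.induction k (fun m => ?_) (fun x hx => ?_) (fun x y hx hy => ?_) x
  · rw [outL_const, jacR_const, jacR_const, triL, ← atMu_coeffMap]
    congr 1
    induction m with
    | zero => simp
    | add x y hx hy => simp only [map_add, hx, hy]
    | tmul p q =>
      rw [LinearMap.rTensor_tmul, LinearMap.mulLeft_apply, brR_tmul, brR_tmul, coeffMap_coeffMap]
      congr 2
  · simp only [outL_mulVar, jacR_mulVar, hx, triL, coeffMap₂_mulLam]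
  · simp only [map_add, hx, hy]

/-- `{b_mu Q d}_R = {b_mu Q}_R d + Q {b_mu d}`, with the last product in the middle factor. -/
theorem IsSesqLeibniz.jacR_outR (hb : IsSesqLeibniz br) (b d : V.V) (x : LPoly (V.V ⊗[k] V.V)) :
    jacR br b (outR d x) = triR d (jacR br b x) + midPoly x (br b d) := by
  refine LPoly.induction k (fun m => ?_) (fun x hx => ?_) (fun x y hx hy => ?_) x
  · rw [outR_const, jacR_const, jacR_const, midPoly_const_left, triR, ← atMu_coeffMap, ← map_add]
    congr 1
    induction m with
    | zero => simp [coeffMap_zero_map]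
    | add x y hx hy => simp only [map_add, hx, hy, coeffMap_add_map]; abel
    | tmul p q =>
      rw [LinearMap.lTensor_tmul, LinearMap.mulRight_apply, brR_tmul, brR_tmul, hb.leibniz_left,
        map_add, outL, outR, coeffMap_coeffMap, coeffMap_coeffMap, coeffMap_coeffMap, add_comm]
      congr 2
      congr 1
      ext x y
      rfl
  · simp only [outR_mulVar, jacR_mulVar, midPoly_mulVar_left, hx, map_add, triR, coeffMap₂_mulLam]
  · simp only [map_add, hx, hy, midPoly_add_left]; abel

theorem IsSesqLeibniz.jacF_mul (hb : IsSesqLeibniz br) (c d : V.V) (x : LPoly (V.V ⊗[k] V.V)) :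
    jacF br (c * d) x = triL c (jacF br d x) + triR d (jacF br c x) := by
  refine LPoly.induction k (fun m => ?_) (fun x hx => ?_) (fun x y hx hy => ?_) x
  · rw [jacF_const, jacF_const, jacF_const, triL, triR, ← atLamMu_coeffMap, ← atLamMu_coeffMap,
      ← map_add]
    congr 1
    induction m with
    | zero => simp
    | add x y hx hy => simp only [map_add, hx, hy]; abel
    | tmul p q =>
      rw [brFirst_tmul, brFirst_tmul, brFirst_tmul, hb.leibniz_left, add_tmul, map_add, map_add,
        outL, outR, arrow_coeffMap, arrow_coeffMap, coeffMap_coeffMap, coeffMap_coeffMap,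
        coeffMap_coeffMap, coeffMap_coeffMap]
      congr 3
      · ext x y z; rfl
      · ext x y z; rfl
  · simp only [jacF_mulVar, hx, map_add, triL, triR, coeffMap₂_mulLam]
  · simp only [map_add, hx, hy]; abel

theorem IsSesqLeibniz.jacF_T (hb : IsSesqLeibniz br) (c : V.V) (x : LPoly (V.V ⊗[k] V.V)) :
    jacF br (V.T c) x =
      mulLam k (jacF br c x) + mulMu k (jacF br c x) + triCoT (jacF br c x) := by
  refine LPoly.induction k (fun m => ?_) (fun x hx => ?_) (fun x y hx hy => ?_) x
  · rw [jacF_const, jacF_const, triCoT, ← atLamMu_coeffMap, ← atLamMu_mulVar, ← map_add]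
    congr 1
    induction m with
    | zero => simp
    | add x y hx hy => simp only [map_add, hx, hy]; abel
    | tmul p q =>
      rw [brFirst_tmul, brFirst_tmul, hb.sesq_right, add_tmul, map_add, arrow_mulVar, coT,
        arrow_coeffMap, coeffMap_coeffMap]
      have h : triT ∘ₗ jump k V.V V.V V.V = jump k V.V V.V V.V ∘ₗ V.T.lTensor (V.V ⊗[k] V.V) +
          jump k V.V V.V V.V ∘ₗ (tensorT V).rTensor V.V := by
        refine LinearMap.ext fun m => ?_
        simp only [LinearMap.comp_apply, triT_jump, LinearMap.add_apply, map_add]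
      rw [h, coeffMap_add_map, ← coeffMap_coeffMap, ← coeffMap_coeffMap, map_add, map_add,
        coeffMap_mulVar]
      abel
  · simp only [jacF_mulVar, hx, map_add, mulLam_mulMu, triCoT_mulLam]
  · simp only [map_add, hx, hy]; abel

/-- The Jacobi identity is a derivation identity in the last argument. The middle terms
`{a_lam c} {b_mu d}` of both sides agree. -/
theorem IsSesqLeibniz.jac_mul (hb : IsSesqLeibniz br) {a b c d : V.V} (hc : Jac br a b c)
    (hd : Jac br a b d) : Jac br a b (c * d) := by
  rw [Jac] at *
  rw [hb.leibniz_left, hb.leibniz_left, map_add, map_add, hb.jacL_outL, jacL_outR, hc, hd,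
    jacR_outL, hb.jacR_outR, hb.jacF_mul, map_add, map_add]
  abel

theorem IsSesqLeibniz.jac_T (hb : IsSesqLeibniz br) {a b c : V.V} (hc : Jac br a b c) :
    Jac br a b (V.T c) := by
  rw [Jac] at *
  rw [hb.sesq_right, hb.sesq_right, map_add, map_add, hb.jacL_coT, jacL_mulVar, jacR_mulVar,
    hb.jacR_coT, hc, hb.jacF_T]
  simp only [map_add]
  abel

theorem brFirst_add (c d : V.V) (m : V.V ⊗[k] V.V) :
    brFirst br (c + d) m = brFirst br c m + brFirst br d m := by
  induction m with
  | zero => simp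
  | add x y hx hy => simp only [map_add, hx, hy]; abel
  | tmul p q => simp only [brFirst_tmul, map_add, add_tmul]

theorem jac_add {a b c d : V.V} (hc : Jac br a b c) (hd : Jac br a b d) :
    Jac br a b (c + d) := by
  have h : ∀ x, jacF br (c + d) x = jacF br c x + jacF br d x := fun x => by
    refine LPoly.induction k (fun m => ?_) (fun x hx => ?_) (fun x y hx hy => ?_) x
    · simp only [jacF_const, brFirst_add, map_add]
    · simp only [jacF_mulVar, hx, map_add]
    · simp only [map_add, hx, hy]; abel
  rw [Jac] at *
  rw [h, map_add, map_add, map_add, map_add, hc, hd]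
  abel

/-- For a skewsymmetric bracket, the Jacobi identity follows from the Jacobi identity on
generators: it is a differential derivation identity in the last argument, and cyclically
symmetric. -/
theorem IsSesqLeibniz.jac_of_generators (hb : IsSesqLeibniz br)
    (hs : ∀ x y, br x y = - sk (br y x)) {D : DerBimod k} {iA : D.A →ₗ[k] V.V}
    {iE : D.E →ₗ[k] V.V} (hg : GeneratedBy iA iE)
    (hAAA : ∀ a b c, Jac br (iA a) (iA b) (iA c))
    (hEAA : ∀ e a b, Jac br (iE e) (iA a) (iA b))
    (hEEA : ∀ e f a, Jac br (iE e) (iE f) (iA a))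
    (hEEE : ∀ e f g, Jac br (iE e) (iE f) (iE g)) (x y z : V.V) : Jac br x y z := by
  have rotate : ∀ {a b c : V.V}, Jac br a b c → Jac br c a b := fun h => hb.jac_rotate hs h
  have step : ∀ a b, (∀ c, Jac br a b (iA c)) → (∀ e, Jac br a b (iE e)) → ∀ c, Jac br a b c :=
    fun a b h1 h2 => hg _ h1 h2 (fun _ _ => jac_add) (fun _ _ => hb.jac_mul) (fun _ => hb.jac_T)
  -- Two generators in the first arguments and an arbitrary last argument.
  have hAA : ∀ a b z, Jac br (iA a) (iA b) z :=
    fun a b => step _ _ (hAAA a b) (fun e => rotate (rotate (hEAA e a b)))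
  have hAE : ∀ a e z, Jac br (iA a) (iE e) z :=
    fun a e => step _ _ (fun b => rotate (hEAA e b a)) (fun f => rotate (hEEA e f a))
  have hEA : ∀ e a z, Jac br (iE e) (iA a) z :=
    fun e a => step _ _ (hEAA e a) (fun f => rotate (rotate (hEEA f e a)))
  have hEE : ∀ e f z, Jac br (iE e) (iE f) z :=
    fun e f => step _ _ (hEEA e f) (hEEE e f)
  -- A generator in the last argument: rotating puts it into the second one, and the last argument
  -- `y` is reduced to generators.
  have hA : ∀ a y z, Jac br y z (iA a) := fun a y z =>
    rotate (step z (iA a) (fun b => rotate (hAA a b z)) (fun e => rotate (hAE a e z)) y)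
  have hE : ∀ e y z, Jac br y z (iE e) := fun e y z =>
    rotate (step z (iE e) (fun b => rotate (hEA e b z)) (fun f => rotate (hEE e f z)) y)
  exact step x y (fun a => hA a x y) (fun e => hE e x y) z

end JacobiDerivation

/-! ### Derivations on the free differential algebra -/

/-- A differential bimodule `M` over the differential algebra `V`, given by the left and right
actions `l` and `r` and by the operator `S`, which is a derivation over `T`. -/
structure DiffBimod (V : GrDiffAlg k) (M : Type u) [AddCommGroup M] [Module k M] where
  l : V.V →ₗ[k] Module.End k M
  r : V.V →ₗ[k] Module.End k M
  S : Module.End k M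
  l_one : ∀ m, l 1 m = m
  l_mul : ∀ x y m, l (x * y) m = l x (l y m)
  r_one : ∀ m, r 1 m = m
  r_mul : ∀ x y m, r (x * y) m = r y (r x m)
  l_r : ∀ x y m, l x (r y m) = r y (l x m)
  S_l : ∀ x m, S (l x m) = l (V.T x) m + l x (S m)
  S_r : ∀ x m, S (r x m) = r (V.T x) m + r x (S m)

/-- The differential bimodule of linear maps `Y → M`. -/
def DiffBimod.hom {V : GrDiffAlg k} {M : Type u} [AddCommGroup M] [Module k M] (X : DiffBimod V M)
    (Y : Type u) [AddCommGroup Y] [Module k Y] : DiffBimod V (Y →ₗ[k] M) where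
  l := LinearMap.llcomp k Y M M ∘ₗ X.l
  r := LinearMap.llcomp k Y M M ∘ₗ X.r
  S := LinearMap.llcomp k Y M M X.S
  l_one _ := LinearMap.ext fun _ => X.l_one _
  l_mul _ _ _ := LinearMap.ext fun _ => X.l_mul _ _ _
  r_one _ := LinearMap.ext fun _ => X.r_one _
  r_mul _ _ _ := LinearMap.ext fun _ => X.r_mul _ _ _
  l_r _ _ _ := LinearMap.ext fun _ => X.l_r _ _ _
  S_l _ _ := LinearMap.ext fun _ => X.S_l _ _
  S_r _ _ := LinearMap.ext fun _ => X.S_r _ _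

/-- The linear map `δ : V → M` is a derivation of differential bimodules. -/
structure DiffBimod.IsDer {V : GrDiffAlg k} {M : Type u} [AddCommGroup M] [Module k M]
    (X : DiffBimod V M) (δ : V.V →ₗ[k] M) : Prop where
  mul : ∀ x y, δ (x * y) = X.l x (δ y) + X.r y (δ x)
  T : ∀ x, δ (V.T x) = X.S (δ x)

theorem DiffBimod.IsDer.ext {V : GrDiffAlg k} {M : Type u} [AddCommGroup M] [Module k M]
    {X : DiffBimod V M} {D : DerBimod k} {iA : D.A →ₗ[k] V.V} {iE : D.E →ₗ[k] V.V}
    (hg : GeneratedBy iA iE) {φ ψ : V.V →ₗ[k] M} (h : X.IsDer φ)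
    (h' : X.IsDer ψ) (hA : ∀ a, φ (iA a) = ψ (iA a)) (hE : ∀ e, φ (iE e) = ψ (iE e)) : φ = ψ := by
  refine LinearMap.ext fun x => ?_
  refine hg (fun x => φ x = ψ x) hA hE (fun x y hx hy => ?_) (fun x y hx hy => ?_)
    (fun x hx => ?_) x
  · rw [map_add, map_add, hx, hy]
  · rw [h.mul, h'.mul, hx, hy]
  · rw [h.T, h'.T, hx]

/-- The values `δA` and `δE` on `A` and `E` respect the bimodule structure of `E` and the relation
`T a = ∂ a`. -/
structure DiffBimod.Compatible {V : GrDiffAlg k} {M : Type u} [AddCommGroup M] [Module k M]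
    (X : DiffBimod V M) {D : DerBimod k} (iA : D.A →ₗ[k] V.V) (iE : D.E →ₗ[k] V.V)
    (δA : D.A →ₗ[k] M) (δE : D.E →ₗ[k] M) : Prop where
  mul : ∀ a b, δA (a * b) = X.l (iA a) (δA b) + X.r (iA b) (δA a)
  left : ∀ a e, δE (a • e) = X.l (iA a) (δE e) + X.r (iE e) (δA a)
  right : ∀ a e, δE (MulOpposite.op a • e) = X.l (iE e) (δA a) + X.r (iA a) (δE e)
  d : ∀ a, δE (D.d a) = X.S (δA a)

/-- Derivations from `V` to differential bimodules can be prescribed on `A` and `E`. -/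
def ExtendsDerivations {V : GrDiffAlg k} {D : DerBimod k} (iA : D.A →ₗ[k] V.V)
    (iE : D.E →ₗ[k] V.V) : Prop :=
  ∀ (M : Type u) [AddCommGroup M] [Module k M] (X : DiffBimod V M) (δA : D.A →ₗ[k] M)
    (δE : D.E →ₗ[k] M), X.Compatible iA iE δA δE →
    ∃ δ : V.V →ₗ[k] M, X.IsDer δ ∧ (∀ a, δ (iA a) = δA a) ∧ ∀ e, δ (iE e) = δE e

namespace DerBimod

variable (D : DerBimod k)

theorem freeA_one : D.freeA 1 = 1 := (D.quo_rel Rel.one_A).trans (map_one _)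

theorem freeA_mul (a b : D.A) : D.freeA (a * b) = D.freeA a * D.freeA b :=
  (D.quo_rel (Rel.mul_A a b)).trans (map_mul _ _ _)

theorem freeE_smul (a : D.A) (e : D.E) : D.freeE (a • e) = D.freeA a * D.freeE e :=
  (D.quo_rel (Rel.left_E a e)).trans (map_mul _ _ _)

theorem freeE_op_smul (a : D.A) (e : D.E) :
    D.freeE (MulOpposite.op a • e) = D.freeE e * D.freeA a :=
  (D.quo_rel (Rel.right_E a e)).trans (map_mul _ _ _)

theorem free_T_freeA (a : D.A) : D.free.T (D.freeA a) = D.freeE (D.d a) :=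
  (D.freeT_mk _).trans (D.quo_rel (Rel.der a))

/-- The quotient map from the free algebra on the symbols `T⁽ⁿ⁾ a`, `T⁽ⁿ⁾ e`. -/
def toFree : D.Pre →ₐ[k] D.free.V := D.quo

theorem toFree_surjective : Function.Surjective D.toFree := D.quo_surjective

theorem toFree_rel {x y : D.Pre} (h : D.Rel x y) : D.toFree x = D.toFree y := D.quo_rel h

theorem free_T_toFree (x : D.Pre) : D.free.T (D.toFree x) = D.toFree (D.preT x) := D.freeT_mk x

theorem toFree_preA (a : D.A) : D.toFree (D.preA a) = D.freeA a := rfl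

theorem toFree_preE (e : D.E) : D.toFree (D.preE e) = D.freeE e := rfl

/-- A homomorphism that respects the relations descends to the free differential algebra. -/
def freeLift {B : Type u} [Semiring B] [Algebra k B] (Φ : D.Pre →ₐ[k] B)
    (h : ∀ {x y}, D.Rel x y → Φ x = Φ y) : D.free.V →ₐ[k] B :=
  RingQuot.liftAlgHom k ⟨Φ, fun _ _ => h⟩

theorem freeLift_toFree {B : Type u} [Semiring B] [Algebra k B] (Φ : D.Pre →ₐ[k] B)
    (h : ∀ {x y}, D.Rel x y → Φ x = Φ y) (x : D.Pre) : D.freeLift Φ h (D.toFree x) = Φ x :=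
  RingQuot.liftAlgHom_mkAlgHom_apply k _ _ x

theorem free_generatedBy : GeneratedBy (V := D.free) D.freeA D.freeE := by
  intro p hA hE hadd hmul hT x
  obtain ⟨x, rfl⟩ := D.toFree_surjective x
  induction x using FreeAlgebra.induction with
  | grade0 c =>
    have : D.toFree (algebraMap k D.Pre c) = D.freeA (c • 1) := by
      rw [AlgHom.commutes, map_smul, freeA_one, Algebra.algebraMap_eq_smul_one]
    rw [this]
    exact hA _
  | grade1 g =>
    obtain ⟨n, x⟩ := g
    induction n with
    | zero => exact x.casesOn hA hE
    | succ n ih =>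
      have : D.toFree (FreeAlgebra.ι k (n + 1, x)) =
          D.free.T (D.toFree (FreeAlgebra.ι k (n, x))) := by
        rw [free_T_toFree, preT_ι]
      rw [this]
      exact hT _ ih
  | mul x y hx hy => rw [map_mul]; exact hmul _ _ hx hy
  | add x y hx hy => rw [map_add]; exact hadd _ _ hx hy

section Derivation

variable {D}
variable {M : Type u} [AddCommGroup M] [Module k M]

/-- The action of a generator `x` on `F ⊕ M`, where `F` is the free differential algebra, that
encodes a derivation with value `m` at `x`. -/
def genAct (X : DiffBimod D.free M) (x : D.free.V) (m : M) : Module.End k (D.free.V × M) :=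
  LinearMap.prod (LinearMap.mulLeft k x ∘ₗ LinearMap.fst k _ _)
    (X.r.flip m ∘ₗ LinearMap.fst k _ _ + X.l x ∘ₗ LinearMap.snd k _ _)

theorem genAct_apply (X : DiffBimod D.free M) (x : D.free.V) (m : M)
    (v : D.free.V) (n : M) : genAct X x m (v, n) = (x * v, X.r v m + X.l x n) := rfl

variable (D) in
/-- The universal property of the free differential algebra with respect to derivations. A
derivation `δ` is the same as an action of the algebra on `F ⊕ M` of the form `genAct`, from which
`δ x` is recovered as the component in `M` of the value at `(1, 0)`. -/
theorem extendsDerivations : ExtendsDerivations (V := D.free) D.freeA D.freeE := by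
  intro M _ _ X δA δE hX
  let val : D.Gen → M := fun g => (X.S ^ g.1) (Sum.elim δA δE g.2)
  let Φ : D.Pre →ₐ[k] Module.End k (D.free.V × M) :=
    FreeAlgebra.lift k fun g => genAct X (D.toFree (FreeAlgebra.ι k g)) (val g)
  let ev : Module.End k (D.free.V × M) →ₗ[k] M :=
    LinearMap.snd k _ _ ∘ₗ LinearMap.applyₗ (1, 0)
  have Φι : ∀ g, Φ (FreeAlgebra.ι k g) = genAct X (D.toFree (FreeAlgebra.ι k g)) (val g) := by
    simp [Φ]
  have hev : ∀ f, ev f = (f (1, 0)).2 := fun f => rfl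
  -- Every element acts in the form `genAct`, not only the symbols.
  have hΦ : ∀ x, Φ x = genAct X (D.toFree x) (ev (Φ x)) := by
    intro x
    induction x using FreeAlgebra.induction with
    | grade0 c =>
      rw [AlgHom.commutes, AlgHom.commutes]
      refine LinearMap.ext fun ⟨v, n⟩ => ?_
      rw [genAct_apply, hev, Module.algebraMap_end_apply, Module.algebraMap_end_apply,
        Algebra.algebraMap_eq_smul_one, map_smul, LinearMap.smul_apply, X.l_one]
      simp
    | grade1 g =>
      rw [hev, Φι]
      congr 1
      rw [genAct_apply, X.r_one, map_zero, add_zero]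
    | mul x y hx hy =>
      refine LinearMap.ext fun ⟨v, n⟩ => ?_
      rw [genAct_apply, hev, map_mul, Module.End.mul_apply, Module.End.mul_apply, hx, hy]
      simp only [genAct_apply, map_zero, add_zero, X.r_one, mul_one, map_add, map_mul, X.r_mul,
        X.l_mul, X.l_r, mul_assoc, add_assoc]
    | add x y hx hy =>
      refine LinearMap.ext fun ⟨v, n⟩ => ?_
      rw [genAct_apply, map_add, LinearMap.add_apply, map_add ev, hx, hy]
      simp only [genAct_apply, hev, map_zero, add_zero, X.r_one, map_add, LinearMap.add_apply,
        add_mul, Prod.mk_add_mk]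
      congr 1
      abel
  -- The derivation on the symbols, before passing to the quotient.
  let pd : D.Pre →ₗ[k] M := ev ∘ₗ Φ.toLinearMap
  have pd_def : ∀ x, pd x = ev (Φ x) := fun x => rfl
  have pd_mul : ∀ x y, pd (x * y) = X.l (D.toFree x) (pd y) + X.r (D.toFree y) (pd x) := by
    intro x y
    rw [pd_def, hev, map_mul, Module.End.mul_apply, hΦ x, hΦ y, genAct_apply, genAct_apply,
      mul_one, map_zero, add_zero, X.r_one, add_comm]
    rfl
  have pd_ι : ∀ g, pd (FreeAlgebra.ι k g) = val g := by
    intro g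
    rw [pd_def, Φι, hev, genAct_apply, X.r_one, map_zero, add_zero]
  have pd_one : pd 1 = 0 := by
    have := pd_mul 1 1
    rw [mul_one, map_one D.toFree, X.l_one, X.r_one] at this
    simpa using this
  have pd_T : ∀ x, pd (D.preT x) = X.S (pd x) := by
    intro x
    induction x using FreeAlgebra.induction with
    | grade0 c =>
      rw [preT_algebraMap, Algebra.algebraMap_eq_smul_one, map_smul, pd_one, smul_zero, map_zero,
        map_zero]
    | grade1 g =>
      rw [preT_ι, pd_ι, pd_ι]
      simp [val, pow_succ']
    | mul x y hx hy =>
      rw [preT_mul, map_add, pd_mul, pd_mul, hx, hy, pd_mul, map_add, X.S_l, X.S_r,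
        free_T_toFree, free_T_toFree]
      abel
    | add x y hx hy => simp only [map_add, hx, hy]
  have pdA : ∀ a, pd (D.preA a) = δA a := fun a => by rw [preA, pd_ι]; rfl
  have pdE : ∀ e, pd (D.preE e) = δE e := fun e => by rw [preE, pd_ι]; rfl
  have pd_rel : ∀ {x y}, D.Rel x y → pd x = pd y := by
    intro x y h
    induction h with
    | add_A a b => simp only [map_add, pdA]
    | smul_A c a => simp only [map_smul, pdA]
    | one_A =>
      rw [pdA, pd_one]
      have := hX.mul 1 1
      rw [mul_one, freeA_one, X.l_one, X.r_one] at this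
      simpa using this
    | mul_A a b => rw [pd_mul, pdA, pdA, pdA, hX.mul]; rfl
    | add_E e f => simp only [map_add, pdE]
    | smul_E c e => simp only [map_smul, pdE]
    | left_E a e => rw [pd_mul, pdA, pdE, pdE, hX.left]; rfl
    | right_E a e => rw [pd_mul, pdA, pdE, pdE, hX.right]; rfl
    | der a => rw [pd_T, pdA, pdE, hX.d]
    | diff _ ih => rw [pd_T, pd_T, ih]
  let Ψ : D.free.V →ₐ[k] Module.End k (D.free.V × M) := D.freeLift Φ fun {x y} h => by
    rw [hΦ x, hΦ y, D.toFree_rel h, ← pd_def, ← pd_def, pd_rel h]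
  have hΨ : ∀ x, Ψ (D.toFree x) = Φ x := D.freeLift_toFree Φ _
  have hδ : ∀ x, (ev ∘ₗ Ψ.toLinearMap) (D.toFree x) = pd x := fun x => congrArg ev (hΨ x)
  refine ⟨ev ∘ₗ Ψ.toLinearMap, ⟨fun x y => ?_, fun x => ?_⟩, fun a => ?_, fun e => ?_⟩
  · obtain ⟨x, rfl⟩ := D.toFree_surjective x
    obtain ⟨y, rfl⟩ := D.toFree_surjective y
    rw [← map_mul, hδ, hδ, hδ, pd_mul]
  · obtain ⟨x, rfl⟩ := D.toFree_surjective x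
    rw [free_T_toFree, hδ, hδ, pd_T]
  · exact (hδ _).trans (pdA a)
  · exact (hδ _).trans (pdE e)

end Derivation

end DerBimod

/-! ### Construction of the bracket from its values on generators -/

section Construction

variable {V : GrDiffAlg k}

variable (V) in
/-- `outL`, as a linear map in the multiplier. -/
def outLHom : V.V →ₗ[k] Module.End k (LPoly (V.V ⊗[k] V.V)) where
  toFun := outL
  map_add' a b := by
    refine LinearMap.ext fun x => ?_
    rw [LinearMap.add_apply, outL, outL, outL, ← coeffMap_add_map]
    congr 2
    ext p q
    simp [add_mul, add_tmul]
  map_smul' c a := by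
    refine LinearMap.ext fun x => ?_
    rw [LinearMap.smul_apply, outL, outL, ← coeffMap_smul_map]
    congr 2
    ext p q
    simp [smul_tmul']

variable (V) in
/-- `outR`, as a linear map in the multiplier. -/
def outRHom : V.V →ₗ[k] Module.End k (LPoly (V.V ⊗[k] V.V)) where
  toFun := outR
  map_add' a b := by
    refine LinearMap.ext fun x => ?_
    rw [LinearMap.add_apply, outR, outR, outR, ← coeffMap_add_map]
    congr 2
    ext p q
    simp [mul_add, tmul_add]
  map_smul' c a := by
    refine LinearMap.ext fun x => ?_
    rw [LinearMap.smul_apply, outR, outR, ← coeffMap_smul_map]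
    congr 2
    ext p q
    simp

variable (V) in
/-- `inL`, as a linear map in the multiplier. -/
def inLHom : V.V →ₗ[k] Module.End k (LPoly (V.V ⊗[k] V.V)) where
  toFun := inL
  map_add' a b := by
    refine LinearMap.ext fun x => ?_
    simp [inL, map_add]
  map_smul' c a := by
    refine LinearMap.ext fun x => ?_
    simp [inL]

variable (V) in
/-- `inR`, as a linear map in the multiplier. -/
def inRHom : V.V →ₗ[k] Module.End k (LPoly (V.V ⊗[k] V.V)) where
  toFun := inR
  map_add' a b := by
    refine LinearMap.ext fun x => ?_
    simp [inR, map_add]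
  map_smul' c a := by
    refine LinearMap.ext fun x => ?_
    simp [inR]

variable (V) in
/-- `(V ⊗ V)[lam]` with the outer bimodule structure and the operator `lam + T`. -/
def outerBimod : DiffBimod V (LPoly (V.V ⊗[k] V.V)) where
  l := outLHom V
  r := outRHom V
  S := mulVar k + coT
  l_one := outL_one
  l_mul := outL_mul
  r_one := outR_one
  r_mul := outR_mul
  l_r := outL_outR
  S_l x m := by
    change mulVar k (outL _ _) + coT (outL _ _) = outL _ _ + outL _ (mulVar k _ + coT _)
    rw [coT_outL, map_add, outL_mulVar]; abel
  S_r x m := by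
    change mulVar k (outR _ _) + coT (outR _ _) = outR _ _ + outR _ (mulVar k _ + coT _)
    rw [coT_outR, map_add, outR_mulVar]; abel

variable (V) in
/-- `(V ⊗ V)[lam]` with the inner bimodule structure and the operator `- lam`. It is conjugate to
the outer structure by `sk`. -/
def innerBimod : DiffBimod V (LPoly (V.V ⊗[k] V.V)) where
  l := inLHom V
  r := inRHom V
  S := - mulVar k
  l_one m := by
    change inL _ _ = _
    rw [inL_eq, outL_one, sk_sk]
  l_mul x y m := by
    change inL _ _ = inL _ (inL _ _)
    rw [inL_eq, inL_eq, inL_eq, sk_sk, outL_mul]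
  r_one m := by
    change inR _ _ = _
    rw [inR_eq, outR_one, sk_sk]
  r_mul x y m := by
    change inR _ _ = inR _ (inR _ _)
    rw [inR_eq, inR_eq, inR_eq, sk_sk, outR_mul]
  l_r x y m := by
    change inL _ (inR _ _) = inR _ (inL _ _)
    rw [inL_eq, inL_eq, inR_eq, inR_eq, sk_sk, sk_sk, outL_outR]
  S_l x m := by
    change - mulVar k (inL _ _) = inL _ _ + inL _ (- mulVar k _)
    rw [map_neg, inL_mulVar]
    abel
  S_r x m := by
    change - mulVar k (inR _ _) = inR _ _ + inR _ (- mulVar k _)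
    rw [map_neg, inR_mulVar]
    abel

/-- The property of `{a_lam -}`: a derivation to the outer bimodule. -/
abbrev IsOuterDer (φ : V.V →ₗ[k] LPoly (V.V ⊗[k] V.V)) : Prop := (outerBimod V).IsDer φ

theorem isOuterDer_iff {φ : V.V →ₗ[k] LPoly (V.V ⊗[k] V.V)} : IsOuterDer φ ↔
    (∀ b c, φ (b * c) = outL b (φ c) + outR c (φ b)) ∧
      ∀ b, φ (V.T b) = mulVar k (φ b) + coT (φ b) :=
  ⟨fun h => ⟨h.mul, h.T⟩, fun h => ⟨h.1, h.2⟩⟩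

theorem IsOuterDer.add {φ ψ : V.V →ₗ[k] LPoly (V.V ⊗[k] V.V)} (h : IsOuterDer φ)
    (h' : IsOuterDer ψ) : IsOuterDer (φ + ψ) := by
  rw [isOuterDer_iff] at *
  refine ⟨fun b c => ?_, fun b => ?_⟩
  · simp only [LinearMap.add_apply, h.1, h'.1, map_add]; abel
  · simp only [LinearMap.add_apply, h.2, h'.2, map_add]; abel

theorem IsOuterDer.inL {φ : V.V →ₗ[k] LPoly (V.V ⊗[k] V.V)} (h : IsOuterDer φ) (a : V.V) :
    IsOuterDer (inL a ∘ₗ φ) := by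
  rw [isOuterDer_iff] at *
  refine ⟨fun b c => ?_, fun b => ?_⟩
  · simp only [LinearMap.comp_apply, h.1, map_add, outL_inL, outR_inL]
  · simp only [LinearMap.comp_apply, h.2, map_add, inL_mulVar, coT_inL]; abel

theorem IsOuterDer.inR {φ : V.V →ₗ[k] LPoly (V.V ⊗[k] V.V)} (h : IsOuterDer φ) (a : V.V) :
    IsOuterDer (inR a ∘ₗ φ) := by
  rw [isOuterDer_iff] at *
  refine ⟨fun b c => ?_, fun b => ?_⟩
  · simp only [LinearMap.comp_apply, h.1, map_add, outL_inR, outR_inR]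
  · simp only [LinearMap.comp_apply, h.2, map_add, inR_mulVar, coT_inR]; abel

theorem IsOuterDer.neg_mulVar {φ : V.V →ₗ[k] LPoly (V.V ⊗[k] V.V)} (h : IsOuterDer φ) :
    IsOuterDer (-(mulVar k ∘ₗ φ)) := by
  rw [isOuterDer_iff] at *
  refine ⟨fun b c => ?_, fun b => ?_⟩
  · simp only [LinearMap.neg_apply, LinearMap.comp_apply, h.1, map_add, map_neg, outL_mulVar,
      outR_mulVar, neg_add]
  · simp only [LinearMap.neg_apply, LinearMap.comp_apply, h.2, map_add, map_neg, coT_mulVar,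
      neg_add]

/-- A bracket on the free differential algebra can be prescribed on generators, if its values are
skewsymmetric and respect the relations in the second argument. The bracket is extended first in
the second argument and then in the first; skewsymmetry transfers the relations to the first
argument. -/
theorem exists_bracket {D : DerBimod k} {iA : D.A →ₗ[k] V.V} {iE : D.E →ₗ[k] V.V}
    (hg : GeneratedBy iA iE) (hx : ExtendsDerivations iA iE)
    (g : D.A × D.E →ₗ[k] D.A × D.E →ₗ[k] LPoly (V.V ⊗[k] V.V))
    (hskew : ∀ x y, g x y = - sk (g y x))
    (hmul : ∀ y a b, g y (a * b, 0) = outL (iA a) (g y (b, 0)) + outR (iA b) (g y (a, 0)))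
    (hleft : ∀ y a e, g y (0, a • e) = outL (iA a) (g y (0, e)) + outR (iE e) (g y (a, 0)))
    (hright : ∀ y a e, g y (0, MulOpposite.op a • e) =
      outL (iE e) (g y (a, 0)) + outR (iA a) (g y (0, e)))
    (hd : ∀ y a, g y (0, D.d a) = mulVar k (g y (a, 0)) + coT (g y (a, 0))) :
    ∃ br : V.V →ₗ[k] V.V →ₗ[k] LPoly (V.V ⊗[k] V.V),
      IsSesqLeibniz br ∧ (∀ a b, br (iA a) (iA b) = g (a, 0) (b, 0)) ∧
      (∀ a f, br (iA a) (iE f) = g (a, 0) (0, f)) ∧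
      (∀ e b, br (iE e) (iA b) = g (0, e) (b, 0)) ∧
      ∀ e f, br (iE e) (iE f) = g (0, e) (0, f) := by
  -- Extension in the second argument; `δ.flip y` is the bracket with the generator `y` on the left.
  obtain ⟨δ, hδ, δA, δE⟩ := hx _ ((outerBimod V).hom (D.A × D.E))
    (g.flip ∘ₗ LinearMap.inl k _ _) (g.flip ∘ₗ LinearMap.inr k _ _)
    ⟨fun a b => LinearMap.ext fun y => hmul y a b, fun a e => LinearMap.ext fun y => hleft y a e,
      fun a e => LinearMap.ext fun y => hright y a e, fun a => LinearMap.ext fun y => hd y a⟩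
  have hδ : ∀ y, IsOuterDer (δ.flip y) := fun y =>
    ⟨fun b c => DFunLike.congr_fun (hδ.mul b c) y, fun b => DFunLike.congr_fun (hδ.T b) y⟩
  have δA : ∀ a y, δ.flip y (iA a) = g y (a, 0) := fun a y => DFunLike.congr_fun (δA a) y
  have δE : ∀ e y, δ.flip y (iE e) = g y (0, e) := fun e y => DFunLike.congr_fun (δE e) y
  -- Extension in the first argument. Both sides of each relation are outer derivations of the
  -- second argument, so the relation is checked on generators, where skewsymmetry turns it into a
  -- relation for the second argument.
  obtain ⟨br, hbr, bA, bE⟩ := hx _ ((innerBimod V).hom V.V)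
    (δ.flip ∘ₗ LinearMap.inl k _ _) (δ.flip ∘ₗ LinearMap.inr k _ _)
    { mul := fun a b => by
        change δ.flip (a * b, 0) = inL (iA a) ∘ₗ δ.flip (b, 0) + inR (iA b) ∘ₗ δ.flip (a, 0)
        refine DiffBimod.IsDer.ext hg (hδ _) (((hδ (b, 0)).inL (iA a)).add
          ((hδ (a, 0)).inR (iA b))) (fun c => ?_) (fun c => ?_)
        all_goals
          simp only [LinearMap.add_apply, LinearMap.comp_apply, δA, δE]
          rw [hskew, hmul, map_add, sk_outL, sk_outR, hskew (b, 0), map_neg, hskew (a, 0), map_neg,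
            neg_add]
      left := fun a e => by
        change δ.flip (0, a • e) = inL (iA a) ∘ₗ δ.flip (0, e) + inR (iE e) ∘ₗ δ.flip (a, 0)
        refine DiffBimod.IsDer.ext hg (hδ _) (((hδ (0, e)).inL (iA a)).add
          ((hδ (a, 0)).inR (iE e))) (fun c => ?_) (fun c => ?_)
        all_goals
          simp only [LinearMap.add_apply, LinearMap.comp_apply, δA, δE]
          rw [hskew, hleft, map_add, sk_outL, sk_outR, hskew (0, e), map_neg, hskew (a, 0), map_neg,
            neg_add]
      right := fun a e => by
        change δ.flip (0, MulOpposite.op a • e) =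
          inL (iE e) ∘ₗ δ.flip (a, 0) + inR (iA a) ∘ₗ δ.flip (0, e)
        refine DiffBimod.IsDer.ext hg (hδ _) (((hδ (a, 0)).inL (iE e)).add
          ((hδ (0, e)).inR (iA a))) (fun c => ?_) (fun c => ?_)
        all_goals
          simp only [LinearMap.add_apply, LinearMap.comp_apply, δA, δE]
          rw [hskew, hright, map_add, sk_outL, sk_outR, hskew (0, e), map_neg, hskew (a, 0),
            map_neg, neg_add]
      d := fun a => by
        change δ.flip (0, D.d a) = -(mulVar k ∘ₗ δ.flip (a, 0))
        refine DiffBimod.IsDer.ext hg (hδ _) (hδ (a, 0)).neg_mulVar (fun c => ?_) (fun c => ?_)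
        all_goals
          simp only [LinearMap.neg_apply, LinearMap.comp_apply, δA, δE]
          rw [hskew, hd, map_add, sk_mulVar, sk_coT, hskew (a, 0), map_neg]
          abel }
  have bmul : ∀ a b c, br (a * b) c = inR b (br a c) + inL a (br b c) := fun a b c =>
    (DFunLike.congr_fun (hbr.mul a b) c).trans (add_comm _ _)
  have bT : ∀ a c, br (V.T a) c = - mulVar k (br a c) := fun a c =>
    DFunLike.congr_fun (hbr.T a) c
  have bA : ∀ a, br (iA a) = δ.flip (a, 0) := bA
  have bE : ∀ e, br (iE e) = δ.flip (0, e) := bE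
  have outer : ∀ a, IsOuterDer (br a) := by
    refine hg _ (fun a => ?_) (fun e => ?_) (fun x y hx hy => ?_) (fun x y hx hy => ?_)
      (fun x hx => ?_)
    · rw [bA]; exact hδ _
    · rw [bE]; exact hδ _
    · rw [map_add]; exact hx.add hy
    · have : br (x * y) = inR y ∘ₗ br x + inL x ∘ₗ br y := LinearMap.ext (bmul x y)
      rw [this]
      exact (hx.inR y).add (hy.inL x)
    · have : br (V.T x) = -(mulVar k ∘ₗ br x) := LinearMap.ext (bT x)
      rw [this]
      exact hx.neg_mulVar
  refine ⟨br, ⟨bT, fun a b => (outer a).T b, fun a b c => (outer a).mul b c, bmul⟩, ?_, ?_, ?_, ?_⟩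
  · intro a b; rw [bA, δA]
  · intro a b; rw [bA, δE]
  · intro a b; rw [bE, δA]
  · intro a b; rw [bE, δE]

end Construction

/-! ### Weights of the coefficients of the bracket -/

section Weight

variable (V : GrDiffAlg k)

/-- The span of the monomials `x ⊗ y lam^q` of total weight `n - 1`, where `lam` has weight one. A
bracket of weight `-1` sends `V_i × V_j` to the submodule with index `i + j`. -/
def wtPoly (n : ℕ) : Submodule k (LPoly (V.V ⊗[k] V.V)) :=
  Submodule.span k {P | ∃ (i j q : ℕ) (x y : V.V), x ∈ V.wt i ∧ y ∈ V.wt j ∧ i + j + q + 1 = n ∧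
    P = Finsupp.single q (x ⊗ₜ[k] y)}

variable {V}

theorem mulVar_single (q : ℕ) (m : V.V ⊗[k] V.V) :
    mulVar k (Finsupp.single q m) = Finsupp.single (q + 1) m := by simp [mulVar]

theorem wtPoly_le_comap {φ : LPoly (V.V ⊗[k] V.V) →ₗ[k] LPoly (V.V ⊗[k] V.V)} {n m : ℕ}
    (h : ∀ (i j q : ℕ) (x y : V.V), x ∈ V.wt i → y ∈ V.wt j → i + j + q + 1 = n →
      φ (Finsupp.single q (x ⊗ₜ[k] y)) ∈ wtPoly V m) {P} (hP : P ∈ wtPoly V n) :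
    φ P ∈ wtPoly V m := by
  have : wtPoly V n ≤ (wtPoly V m).comap φ := by
    refine Submodule.span_le.2 ?_
    rintro _ ⟨i, j, q, x, y, hx, hy, hn, rfl⟩
    exact h i j q x y hx hy hn
  exact this hP

theorem single_mem_wtPoly {i j q n : ℕ} {x y : V.V} (hx : x ∈ V.wt i) (hy : y ∈ V.wt j)
    (hn : i + j + q + 1 = n) : Finsupp.single q (x ⊗ₜ[k] y) ∈ wtPoly V n :=
  Submodule.subset_span ⟨i, j, q, x, y, hx, hy, hn, rfl⟩

theorem mulVar_mem_wtPoly {n : ℕ} {P} (hP : P ∈ wtPoly V n) : mulVar k P ∈ wtPoly V (n + 1) :=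
  wtPoly_le_comap (fun i j q x y hx hy hn => by
    rw [mulVar_single]
    exact single_mem_wtPoly hx hy (by omega)) hP

theorem coT_mem_wtPoly {n : ℕ} {P} (hP : P ∈ wtPoly V n) : coT P ∈ wtPoly V (n + 1) :=
  wtPoly_le_comap (fun i j q x y hx hy hn => by
    have : coT (Finsupp.single q (x ⊗ₜ[k] y)) =
        Finsupp.single q (V.T x ⊗ₜ[k] y) + Finsupp.single q (x ⊗ₜ[k] V.T y) := by
      rw [← Finsupp.single_add, ← tensorT_tmul]; simp [coT, coeffMap]
    rw [this]
    exact add_mem (single_mem_wtPoly (V.T_wt _ _ hx) hy (by omega))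
      (single_mem_wtPoly hx (V.T_wt _ _ hy) (by omega))) hP

theorem outL_mem_wtPoly {n m : ℕ} {a : V.V} (ha : a ∈ V.wt m) {P} (hP : P ∈ wtPoly V n) :
    outL a P ∈ wtPoly V (m + n) :=
  wtPoly_le_comap (fun i j q x y hx hy hn => by
    have : outL a (Finsupp.single q (x ⊗ₜ[k] y)) = Finsupp.single q ((a * x) ⊗ₜ[k] y) := by
      simp [outL, coeffMap]
    rw [this]
    exact single_mem_wtPoly (SetLike.GradedMul.mul_mem ha hx) hy (by omega)) hP

theorem outR_mem_wtPoly {n m : ℕ} {a : V.V} (ha : a ∈ V.wt m) {P} (hP : P ∈ wtPoly V n) :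
    outR a P ∈ wtPoly V (n + m) :=
  wtPoly_le_comap (fun i j q x y hx hy hn => by
    have : outR a (Finsupp.single q (x ⊗ₜ[k] y)) = Finsupp.single q (x ⊗ₜ[k] (y * a)) := by
      simp [outR, coeffMap]
    rw [this]
    exact single_mem_wtPoly hx (SetLike.GradedMul.mul_mem hy ha) (by omega)) hP

theorem sk_mem_wtPoly {n : ℕ} {P} (hP : P ∈ wtPoly V n) : sk P ∈ wtPoly V n :=
  wtPoly_le_comap (fun i j q x y hx hy hn => by
    clear hP
    induction q generalizing n with
    | zero =>
      have : sk (Finsupp.single 0 (x ⊗ₜ[k] y)) = Finsupp.single 0 (y ⊗ₜ[k] x) := sk_const _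
      rw [this]
      exact single_mem_wtPoly hy hx (by omega)
    | succ q ih =>
      obtain ⟨n, rfl⟩ : ∃ m, n = m + 1 := ⟨n - 1, by omega⟩
      have := ih (n := n) (by omega)
      rw [← mulVar_single, sk_mulVar]
      exact sub_mem (neg_mem (mulVar_mem_wtPoly this)) (coT_mem_wtPoly this)) hP

theorem inL_mem_wtPoly {n m : ℕ} {a : V.V} (ha : a ∈ V.wt m) {P} (hP : P ∈ wtPoly V n) :
    inL a P ∈ wtPoly V (m + n) := by
  rw [inL_eq]
  exact sk_mem_wtPoly (outL_mem_wtPoly ha (sk_mem_wtPoly hP))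

theorem inR_mem_wtPoly {n m : ℕ} {a : V.V} (ha : a ∈ V.wt m) {P} (hP : P ∈ wtPoly V n) :
    inR a P ∈ wtPoly V (n + m) := by
  rw [inR_eq]
  exact sk_mem_wtPoly (outR_mem_wtPoly ha (sk_mem_wtPoly hP))

theorem tmul_mem_wtTensor {i j : ℕ} {x y : V.V} (hx : x ∈ V.wt i) (hy : y ∈ V.wt j) :
    x ⊗ₜ[k] y ∈ V.wtTensor (i + j) := by
  refine Submodule.mem_iSup_of_mem i (Submodule.mem_iSup_of_mem j
    (Submodule.mem_iSup_of_mem rfl ?_))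
  exact Submodule.apply_mem_map₂ _ hx hy

theorem apply_mem_wtTensor {n q m : ℕ} {P} (hP : P ∈ wtPoly V n) (h : m + q + 1 = n) :
    P q ∈ V.wtTensor m := by
  induction hP using Submodule.span_induction with
  | mem P hP =>
    obtain ⟨i, j, q', x, y, hx, hy, hn, rfl⟩ := hP
    rw [Finsupp.single_apply]
    split_ifs with hq
    · have := tmul_mem_wtTensor hx hy
      rwa [show i + j = m by omega] at this
    · exact zero_mem _
  | zero => exact zero_mem _
  | add P Q _ _ hP hQ => exact add_mem hP hQ
  | smul c P _ hP => exact Submodule.smul_mem _ c hP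

theorem apply_eq_zero_of_mem_wtPoly {n q : ℕ} {P} (hP : P ∈ wtPoly V n) (h : n < q + 1) :
    P q = 0 := by
  induction hP using Submodule.span_induction with
  | mem P hP =>
    obtain ⟨i, j, q', x, y, hx, hy, hn, rfl⟩ := hP
    rw [Finsupp.single_apply, if_neg (by omega)]
  | zero => rfl
  | add P Q _ _ hP hQ => rw [Finsupp.add_apply, hP, hQ, add_zero]
  | smul c P _ hP => rw [Finsupp.smul_apply, hP, smul_zero]

/-- The weight spaces of `V` are generated by `A` in weight `0` and `E` in weight `1`, as an
induction principle. -/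
def GradedGeneratedBy {D : DerBimod k} (iA : D.A →ₗ[k] V.V) (iE : D.E →ₗ[k] V.V) : Prop :=
  ∀ p : ℕ → V.V → Prop, (∀ n, p n 0) → (∀ a, p 0 (iA a)) → (∀ e, p 1 (iE e)) →
    (∀ n x y, p n x → p n y → p n (x + y)) → (∀ n (c : k) x, p n x → p n (c • x)) →
    (∀ m n x y, x ∈ V.wt m → y ∈ V.wt n → p m x → p n y → p (m + n) (x * y)) →
    (∀ n x, p n x → p (n + 1) (V.T x)) → ∀ n, ∀ x ∈ V.wt n, p n x

theorem DerBimod.free_gradedGeneratedBy (D : DerBimod k) :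
    GradedGeneratedBy (V := D.free) D.freeA D.freeE := by
  intro p h0 hA hE hadd hsmul hmul hT n x hx
  have hgen : ∀ g : D.Gen, p (D.genWt g) (D.toFree (FreeAlgebra.ι k g)) := by
    rintro ⟨n, x⟩
    induction n with
    | zero => exact x.casesOn hA hE
    | succ n ih =>
      have h1 : D.toFree (FreeAlgebra.ι k (n + 1, x)) =
          D.free.T (D.toFree (FreeAlgebra.ι k (n, x))) := by
        rw [free_T_toFree, preT_ι]
      have h2 : D.genWt (n + 1, x) = D.genWt (n, x) + 1 := by cases x <;> rfl
      rw [h1, h2]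
      exact hT _ _ ih
  have hone : p 0 (1 : D.free.V) := by rw [← freeA_one]; exact hA 1
  have hword : ∀ l : List D.Gen, p (l.map D.genWt).sum (D.word l) := by
    intro l
    induction l with
    | nil => exact hone
    | cons g l ih => exact hmul _ _ _ _ (D.gen_mem g) (D.word_mem l) (hgen g) ih
  replace hx : x ∈ D.freeWt n := hx
  induction hx using Submodule.span_induction with
  | mem x hx =>
    obtain ⟨l, rfl, rfl⟩ := hx
    exact hword l
  | zero => exact h0 n
  | add x y _ _ hx hy => exact hadd _ _ _ hx hy
  | smul c x _ hx => exact hsmul _ c _ hx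

/-- The weights of a bracket are determined by its weights on generators. -/
theorem IsSesqLeibniz.mem_wtPoly {br : V.V →ₗ[k] V.V →ₗ[k] LPoly (V.V ⊗[k] V.V)}
    (hb : IsSesqLeibniz br) {D : DerBimod k} {iA : D.A →ₗ[k] V.V} {iE : D.E →ₗ[k] V.V}
    (hg : GradedGeneratedBy iA iE)
    (hAA : ∀ a b, br (iA a) (iA b) ∈ wtPoly V 0) (hAE : ∀ a e, br (iA a) (iE e) ∈ wtPoly V 1)
    (hEA : ∀ e a, br (iE e) (iA a) ∈ wtPoly V 1) (hEE : ∀ e f, br (iE e) (iE f) ∈ wtPoly V 2)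
    {m n : ℕ} {x y : V.V} (hx : x ∈ V.wt m) (hy : y ∈ V.wt n) : br x y ∈ wtPoly V (m + n) := by
  have step : ∀ m x, (∀ a, br x (iA a) ∈ wtPoly V m) → (∀ e, br x (iE e) ∈ wtPoly V (m + 1)) →
      ∀ n, ∀ y ∈ V.wt n, br x y ∈ wtPoly V (m + n) := by
    intro m x hA hE
    refine hg (fun n y => br x y ∈ wtPoly V (m + n)) (fun n => ?_) hA hE (fun n y z hy hz => ?_)
      (fun n c y hy => ?_) (fun n n' y z hy hz hy' hz' => ?_) (fun n y hy => ?_)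
    · rw [map_zero]; exact zero_mem _
    · rw [map_add]; exact add_mem hy hz
    · rw [map_smul]; exact Submodule.smul_mem _ c hy
    · rw [hb.leibniz_left]
      refine add_mem ?_ ?_
      · have := outL_mem_wtPoly hy hz'
        rwa [show n + (m + n') = m + (n + n') by omega] at this
      · have := outR_mem_wtPoly hz hy'
        rwa [show m + n + n' = m + (n + n') by omega] at this
    · rw [hb.sesq_right]
      exact add_mem (mulVar_mem_wtPoly hy) (coT_mem_wtPoly hy)
  refine hg (fun m x => ∀ n, ∀ y ∈ V.wt n, br x y ∈ wtPoly V (m + n)) (fun m n y _ => ?_)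
    (fun a => step 0 _ (hAA a) (hAE a)) (fun e => step 1 _ (hEA e) (hEE e))
    (fun m x x' hx hx' n y hy => ?_) (fun m c x hx n y hy => ?_)
    (fun m m' x x' hx hx' hp hp' n y hy => ?_) (fun m x hx n y hy => ?_) m x hx n y hy
  · rw [map_zero]; exact zero_mem _
  · rw [map_add]; exact add_mem (hx n y hy) (hx' n y hy)
  · rw [map_smul]; exact Submodule.smul_mem _ c (hx n y hy)
  · rw [hb.leibniz_right]
    refine add_mem ?_ ?_
    · have := inR_mem_wtPoly hx' (hp n y hy)
      rwa [show m + n + m' = m + m' + n by omega] at this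
    · have := inL_mem_wtPoly hx (hp' n y hy)
      rwa [show m + (m' + n) = m + m' + n by omega] at this
  · rw [hb.sesq_left, show m + 1 + n = m + n + 1 by omega]
    exact neg_mem (mulVar_mem_wtPoly (hx n y hy))

end Weight

/-! ### Translation between brackets on generators and double Courant–Dorfman operations -/

section Realization

/-- The linear maps `iA : A → V` and `iE : E → V` are compatible with products and derivations. -/
structure IsRealization {D : DerBimod k} {V : GrDiffAlg k} (iA : D.A →ₗ[k] V.V)
    (iE : D.E →ₗ[k] V.V) : Prop where
  mul : ∀ a b, iA (a * b) = iA a * iA b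
  left : ∀ a e, iE (a • e) = iA a * iE e
  right : ∀ a e, iE (MulOpposite.op a • e) = iE e * iA a
  d : ∀ a, V.T (iA a) = iE (D.d a)

variable {D : DerBimod k} {V : GrDiffAlg k}

@[elab_as_elim]
theorem T₂.induction {p : T₂ D → Prop} (h1 : ∀ e a, p (e ⊗ₜ a, 0)) (h2 : ∀ a e, p (0, a ⊗ₜ e))
    (ha : ∀ x y, p x → p y → p (x + y)) (t : T₂ D) : p t := by
  have h0 : p 0 := by
    have := h1 0 0
    rw [zero_tmul] at this
    exact this
  obtain ⟨x, y⟩ := t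
  have hx : p (x, 0) := by
    induction x with
    | zero => exact h0
    | tmul e a => exact h1 e a
    | add x y hx hy => simpa using ha _ _ hx hy
  have hy : p (0, y) := by
    induction y with
    | zero => exact h0
    | tmul e a => exact h2 e a
    | add x y hx hy => simpa using ha _ _ hx hy
  simpa using ha _ _ hx hy

section Maps

variable (iA : D.A →ₗ[k] V.V) (iE : D.E →ₗ[k] V.V)

/-- The induced map `A ⊗ A → V ⊗ V`. -/
def mapAA : D.A ⊗[k] D.A →ₗ[k] V.V ⊗[k] V.V := TensorProduct.map iA iA

/-- The induced map `E ⊗ A ⊕ A ⊗ E → V ⊗ V`. -/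
def mapT₂ : T₂ D →ₗ[k] V.V ⊗[k] V.V :=
  TensorProduct.map iE iA ∘ₗ LinearMap.fst k _ _ + TensorProduct.map iA iE ∘ₗ LinearMap.snd k _ _

/-- The induced map `A ⊗ A ⊗ A → V ⊗ V ⊗ V`. -/
def mapAAA : D.A ⊗[k] (D.A ⊗[k] D.A) →ₗ[k] V.Tri := TensorProduct.map iA (TensorProduct.map iA iA)

/-- The induced map `E ⊗ A ⊗ A ⊕ A ⊗ E ⊗ A ⊕ A ⊗ A ⊗ E → V ⊗ V ⊗ V`. -/
def mapT₃ : T₃ D →ₗ[k] V.Tri :=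
  TensorProduct.map iE (TensorProduct.map iA iA) ∘ₗ LinearMap.fst k _ _ +
    TensorProduct.map iA (TensorProduct.map iE iA) ∘ₗ LinearMap.fst k _ _ ∘ₗ LinearMap.snd k _ _ +
    TensorProduct.map iA (TensorProduct.map iA iE) ∘ₗ LinearMap.snd k _ _ ∘ₗ LinearMap.snd k _ _

variable {iA iE}

theorem mapAA_tmul (a b : D.A) : mapAA iA (a ⊗ₜ b) = iA a ⊗ₜ[k] iA b := rfl

theorem mapT₂_mk (x : D.E ⊗[k] D.A) (y : D.A ⊗[k] D.E) :
    mapT₂ iA iE (x, y) = TensorProduct.map iE iA x + TensorProduct.map iA iE y := rfl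

theorem mapT₂_left (e : D.E) (a : D.A) : mapT₂ iA iE (e ⊗ₜ a, 0) = iE e ⊗ₜ[k] iA a := by
  simp [mapT₂_mk]

theorem mapT₂_right (a : D.A) (e : D.E) : mapT₂ iA iE (0, a ⊗ₜ e) = iA a ⊗ₜ[k] iE e := by
  simp [mapT₂_mk]

theorem mapT₃_mk (x y z) : mapT₃ iA iE (x, y, z) =
    TensorProduct.map iE (TensorProduct.map iA iA) x +
    TensorProduct.map iA (TensorProduct.map iE iA) y +
    TensorProduct.map iA (TensorProduct.map iA iE) z := rfl

theorem comm_mapAA (t : D.A ⊗[k] D.A) :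
    TensorProduct.comm k V.V V.V (mapAA iA t) = mapAA iA (TensorProduct.comm k _ _ t) := by
  induction t with
  | zero => simp
  | tmul a b => rfl
  | add x y hx hy => simp only [map_add, hx, hy]

theorem comm_mapT₂ (t : T₂ D) :
    TensorProduct.comm k V.V V.V (mapT₂ iA iE t) = mapT₂ iA iE (swap₂ D t) := by
  refine T₂.induction (fun e a => ?_) (fun a e => ?_) (fun x y hx hy => ?_) t
  · rw [mapT₂_left, comm_tmul, ← mapT₂_right]
    congr 1
  · rw [mapT₂_right, comm_tmul, ← mapT₂_left]
    congr 1
  · simp only [map_add, hx, hy]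

namespace IsRealization

theorem tensorT_mapAA (hr : IsRealization iA iE) (t : D.A ⊗[k] D.A) :
    tensorT V (mapAA iA t) = mapT₂ iA iE (dTensor D t) := by
  induction t with
  | zero => simp
  | tmul a b => simp [mapAA_tmul, tensorT_tmul, hr.d, dTensor, mapT₂_mk]
  | add x y hx hy => simp only [map_add, hx, hy]

theorem mapAA_mulLeft (hr : IsRealization iA iE) (a : D.A) (t : D.A ⊗[k] D.A) :
    mapAA iA ((LinearMap.mulLeft k a).rTensor D.A t) =
      (LinearMap.mulLeft k (iA a)).rTensor V.V (mapAA iA t) := by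
  induction t with
  | zero => simp
  | tmul x y => simp [mapAA_tmul, hr.mul]
  | add x y hx hy => simp only [map_add, hx, hy]

theorem mapAA_mulRight (hr : IsRealization iA iE) (a : D.A) (t : D.A ⊗[k] D.A) :
    mapAA iA ((LinearMap.mulRight k a).lTensor D.A t) =
      (LinearMap.mulRight k (iA a)).lTensor V.V (mapAA iA t) := by
  induction t with
  | zero => simp
  | tmul x y => simp [mapAA_tmul, hr.mul]
  | add x y hx hy => simp only [map_add, hx, hy]

theorem mapT₂_outerL (hr : IsRealization iA iE) (a : D.A) (t : T₂ D) : mapT₂ iA iE (outerL D a t) =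
    (LinearMap.mulLeft k (iA a)).rTensor V.V (mapT₂ iA iE t) := by
  refine T₂.induction (fun e b => ?_) (fun b e => ?_) (fun x y hx hy => ?_) t
  · simp [mapT₂_mk, outerL, lactE, hr.left]
  · simp [mapT₂_mk, outerL, hr.mul]
  · simp only [map_add, hx, hy]

theorem mapT₂_outerR (hr : IsRealization iA iE) (a : D.A) (t : T₂ D) : mapT₂ iA iE (outerR D a t) =
    (LinearMap.mulRight k (iA a)).lTensor V.V (mapT₂ iA iE t) := by
  refine T₂.induction (fun e b => ?_) (fun b e => ?_) (fun x y hx hy => ?_) t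
  · simp [mapT₂_mk, outerR, hr.mul]
  · simp [mapT₂_mk, outerR, ractE, hr.right]
  · simp only [map_add, hx, hy]

theorem mapT₂_elemMulL (hr : IsRealization iA iE) (f : D.E) (t : D.A ⊗[k] D.A) : mapT₂ iA iE
    (elemMulL D f t) =
    (LinearMap.mulLeft k (iE f)).rTensor V.V (mapAA iA t) := by
  induction t with
  | zero => simp
  | tmul x y => simp [mapT₂_mk, mapAA_tmul, elemMulL, elemR, hr.right]
  | add x y hx hy => simp only [map_add, hx, hy]

theorem mapT₂_elemMulR (hr : IsRealization iA iE) (f : D.E) (t : D.A ⊗[k] D.A) : mapT₂ iA iE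
    (elemMulR D f t) =
    (LinearMap.mulRight k (iE f)).lTensor V.V (mapAA iA t) := by
  induction t with
  | zero => simp
  | tmul x y => simp [mapT₂_mk, mapAA_tmul, elemMulR, elemL, hr.left]
  | add x y hx hy => simp only [map_add, hx, hy]

end IsRealization

end Maps

theorem map_asc {P Q Y P' Q' Y' : Type u} [AddCommGroup P] [Module k P] [AddCommGroup Q]
    [Module k Q] [AddCommGroup Y] [Module k Y] [AddCommGroup P'] [Module k P'] [AddCommGroup Q']
    [Module k Q'] [AddCommGroup Y'] [Module k Y'] (f : P →ₗ[k] P') (g : Q →ₗ[k] Q')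
    (h : Y →ₗ[k] Y') (t : P ⊗[k] Q) (y : Y) :
    TensorProduct.map f (TensorProduct.map g h) (asc k P Q Y (t ⊗ₜ y)) =
      asc k P' Q' Y' (TensorProduct.map f g t ⊗ₜ h y) := by
  induction t with
  | zero => simp
  | tmul p q => rfl
  | add x y hx hy => simp only [map_add, add_tmul, hx, hy]

theorem map_jump {P Q Y P' Q' Y' : Type u} [AddCommGroup P] [Module k P] [AddCommGroup Q]
    [Module k Q] [AddCommGroup Y] [Module k Y] [AddCommGroup P'] [Module k P'] [AddCommGroup Q']
    [Module k Q'] [AddCommGroup Y'] [Module k Y'] (f : P →ₗ[k] P') (g : Q →ₗ[k] Q')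
    (h : Y →ₗ[k] Y') (t : P ⊗[k] Q) (y : Y) :
    TensorProduct.map f (TensorProduct.map h g) (jump k P Q Y (t ⊗ₜ y)) =
      jump k P' Q' Y' (TensorProduct.map f g t ⊗ₜ h y) := by
  induction t with
  | zero => simp
  | tmul p q => rfl
  | add x y hx hy => simp only [map_add, add_tmul, hx, hy]

/-- The bracket `br` on `V` is given on `A` and `E` by the pairing `pr` and the bracket `cd`. -/
structure IsGivenBy (iA : D.A →ₗ[k] V.V) (iE : D.E →ₗ[k] V.V)
    (br : V.V →ₗ[k] V.V →ₗ[k] LPoly (V.V ⊗[k] V.V))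
    (pr : D.E →ₗ[k] D.E →ₗ[k] D.A ⊗[k] D.A) (cd : D.E →ₗ[k] D.E →ₗ[k] T₂ D) : Prop where
  AA : ∀ a b, br (iA a) (iA b) = 0
  AE : ∀ a e, br (iA a) (iE e) = - const k (mapAA iA (pr (D.d a) e))
  EA : ∀ e a, br (iE e) (iA a) = const k (mapAA iA (pr e (D.d a)))
  EE : ∀ e f, br (iE e) (iE f) =
    const k (mapT₂ iA iE (cd e f)) + mulVar k (const k (mapAA iA (pr e f)))

variable {iA : D.A →ₗ[k] V.V} {iE : D.E →ₗ[k] V.V}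
    {br : V.V →ₗ[k] V.V →ₗ[k] LPoly (V.V ⊗[k] V.V)}
    {pr : D.E →ₗ[k] D.E →ₗ[k] D.A ⊗[k] D.A} {cd : D.E →ₗ[k] D.E →ₗ[k] T₂ D}

namespace IsGivenBy

theorem brL_mapAA (h : IsGivenBy iA iE br pr cd) (e : D.E) (t : D.A ⊗[k] D.A) : brL br (iE e)
    (mapAA iA t) =
    const k (mapAAA iA (prL pr e (dTensor D t))) := by
  induction t with
  | zero => simp
  | tmul a b =>
    rw [mapAA_tmul, brL_tmul, h.EA, coeffMap_const]
    simp [mapAAA, prL, dTensor, map_asc, mapAA]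
  | add x y hx hy => simp only [map_add, hx, hy]

theorem brL_mapT₂ (h : IsGivenBy iA iE br pr cd) (e : D.E) (t : T₂ D) : brL br (iE e)
    (mapT₂ iA iE t) =
    const k (mapT₃ iA iE (cdL pr cd e t)) + mulVar k (const k (mapAAA iA (prL pr e t))) := by
  refine T₂.induction (fun f b => ?_) (fun b f => ?_) (fun x y hx hy => ?_) t
  · rw [mapT₂_left, brL_tmul, h.EE, map_add, coeffMap_mulVar, coeffMap_const, coeffMap_const]
    simp [mapAAA, mapT₃_mk, prL, cdL, map_asc, mapAA, mapT₂, brl, brr]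
  · rw [mapT₂_right, brL_tmul, h.EA, coeffMap_const]
    simp [mapAAA, mapT₃_mk, prL, cdL, map_asc, mapAA]
  · simp only [map_add, hx, hy]; abel

theorem brR_mapAA (h : IsGivenBy iA iE br pr cd) (e : D.E) (t : D.A ⊗[k] D.A) : brR br (iE e)
    (mapAA iA t) =
    const k (mapAAA iA (prR pr e (dTensor D t))) := by
  induction t with
  | zero => simp
  | tmul a b =>
    rw [mapAA_tmul, brR_tmul, h.EA, coeffMap_const]
    simp [mapAAA, prR, dTensor, mapAA]
  | add x y hx hy => simp only [map_add, hx, hy]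

theorem brR_mapT₂ (h : IsGivenBy iA iE br pr cd) (e : D.E) (t : T₂ D) : brR br (iE e)
    (mapT₂ iA iE t) =
    const k (mapT₃ iA iE (cdR pr cd e t)) + mulVar k (const k (mapAAA iA (prR pr e t))) := by
  refine T₂.induction (fun f b => ?_) (fun b f => ?_) (fun x y hx hy => ?_) t
  · rw [mapT₂_left, brR_tmul, h.EA, coeffMap_const]
    simp [mapAAA, mapT₃_mk, prR, cdR, mapAA]
  · rw [mapT₂_right, brR_tmul, h.EE, map_add, coeffMap_mulVar, coeffMap_const, coeffMap_const]
    simp [mapAAA, mapT₃_mk, prR, cdR, mapAA, mapT₂, brl, brr, tmul_add]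
  · simp only [map_add, hx, hy]; abel

theorem brFirst_mapAA (h : IsGivenBy iA iE br pr cd) (g : D.E) (t : D.A ⊗[k] D.A) : brFirst br
    (iE g) (mapAA iA t) =
    - const k (mapAAA iA (prFirst pr g (dTensor D t))) := by
  induction t with
  | zero => simp
  | tmul a b =>
    rw [mapAA_tmul, brFirst_tmul, h.AE, neg_tmul, map_neg, map_neg, arrow_const, coeffMap_const]
    simp [mapAAA, prFirst, dTensor, mapAA, map_jump]
  | add x y hx hy => simp only [map_add, hx, hy]; abel

theorem brFirst_mapT₂ (h : IsGivenBy iA iE br pr cd) (hr : IsRealization iA iE) (g : D.E)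
    (t : T₂ D) :
    brFirst br (iE g) (mapT₂ iA iE t) =
    const k (mapT₃ iA iE (cdFirst pr cd g t)) +
      mulVar k (const k (mapAAA iA (prFirst pr g t))) := by
  refine T₂.induction (fun f b => ?_) (fun b f => ?_) (fun x y hx hy => ?_) t
  · rw [mapT₂_left, brFirst_tmul, h.EE, add_tmul, map_add, map_add, arrow_mulVar, arrow_const,
      arrow_const, map_add, coeffMap_mulVar, coeffMap_const, coeffMap_const, coeffMap_const,
      coeffMap_const]
    simp [mapAAA, mapT₃_mk, prFirst, cdFirst, map_jump, mapAA, mapT₂, brl, brr, add_tmul, hr.d]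
    abel
  · rw [mapT₂_right, brFirst_tmul, h.AE, neg_tmul, map_neg, map_neg, arrow_const, coeffMap_const]
    simp [mapAAA, mapT₃_mk, prFirst, cdFirst, map_jump, mapAA]
  · simp only [map_add, hx, hy]; abel

theorem brR_A_mapAA (h : IsGivenBy iA iE br pr cd) (a : D.A) (t : D.A ⊗[k] D.A) : brR br (iA a)
    (mapAA iA t) = 0 := by
  induction t with
  | zero => simp
  | tmul b c => rw [mapAA_tmul, brR_tmul, h.AA, map_zero]
  | add x y hx hy => simp only [map_add, hx, hy, add_zero]

theorem brFirst_A_mapAA (h : IsGivenBy iA iE br pr cd) (a : D.A) (t : D.A ⊗[k] D.A) : brFirst br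
    (iA a) (mapAA iA t) = 0 := by
  induction t with
  | zero => simp
  | tmul b c => rw [mapAA_tmul, brFirst_tmul, h.AA, zero_tmul, map_zero, map_zero]
  | add x y hx hy => simp only [map_add, hx, hy, add_zero]

theorem brFirst_A_mapT₂ (h : IsGivenBy iA iE br pr cd) (a : D.A) (t : T₂ D) : brFirst br (iA a)
    (mapT₂ iA iE t) =
    const k (mapAAA iA (prFirst pr (D.d a) t)) := by
  refine T₂.induction (fun f b => ?_) (fun b f => ?_) (fun x y hx hy => ?_) t
  · rw [mapT₂_left, brFirst_tmul, h.EA, arrow_const, coeffMap_const]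
    simp [mapAAA, prFirst, map_jump, mapAA]
  · rw [mapT₂_right, brFirst_tmul, h.AA, zero_tmul, map_zero, map_zero]
    simp [prFirst]
  · simp only [map_add, hx, hy]

/-- The Jacobi identity for three elements of `E`, in terms of its coefficients: the constant
coefficient and the coefficients of `lam` and `mu`, in this order. -/
theorem jac_EEE_iff (h : IsGivenBy iA iE br pr cd) (hr : IsRealization iA iE) (e f g : D.E) :
    Jac br (iE e) (iE f) (iE g) ↔
      mapT₃ iA iE (cdL pr cd e (cd f g)) =
        mapT₃ iA iE (cdR pr cd f (cd e g) + cdFirst pr cd g (cd e f)) ∧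
      mapAAA iA (prL pr e (cd f g)) = mapAAA iA (prR pr f (dTensor D (pr e g)) +
        prFirst pr g (cd e f) - prFirst pr g (dTensor D (pr e f))) ∧
      mapAAA iA (prL pr e (dTensor D (pr f g))) =
        mapAAA iA (prR pr f (cd e g) + prFirst pr g (cd e f)) := by
  rw [← const₂_add_inj (k := k), Jac, h.EE, h.EE, h.EE]
  simp only [map_add, jacL_mulVar, jacL_const, jacR_mulVar, jacR_const, jacF_mulVar, jacF_const,
    h.brL_mapAA, h.brL_mapT₂, h.brR_mapAA, h.brR_mapT₂, h.brFirst_mapAA, h.brFirst_mapT₂ hr,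
    atLam_mulVar, atLam_const, atMu_mulVar, atMu_const, atLamMu_mulVar, atLamMu_const, map_neg,
    map_sub]
  congr! 1
  abel

theorem jac_EEA_iff (h : IsGivenBy iA iE br pr cd) (e f : D.E) (a : D.A) :
    Jac br (iE e) (iE f) (iA a) ↔
      mapAAA iA (prL pr e (dTensor D (pr f (D.d a)))) =
        mapAAA iA (prR pr f (dTensor D (pr e (D.d a))) + prFirst pr (D.d a) (cd e f)) := by
  have inj : Function.Injective (const₂ k : V.Tri →ₗ[k] V.TriPoly) :=
    (const_injective (k := k)).comp (const_injective (k := k))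
  rw [← inj.eq_iff, Jac, h.EE, h.EA, h.EA]
  simp only [map_add, jacL_const, jacR_const, jacF_mulVar, jacF_const,
    h.brL_mapAA, h.brR_mapAA, h.brFirst_A_mapAA, h.brFirst_A_mapT₂,
    atLam_const, atMu_const, atLamMu_const, map_zero, add_zero]

theorem jac_EAA (h : IsGivenBy iA iE br pr cd) (e : D.E) (a b : D.A) : Jac br (iE e) (iA a) (iA b)
    := by
  rw [Jac, h.AA, h.EA, h.EA, jacR_const, jacF_const, h.brR_A_mapAA, h.brFirst_A_mapAA]
  simp only [map_zero, add_zero]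

theorem jac_AAA (h : IsGivenBy iA iE br pr cd) (a b c : D.A) : Jac br (iA a) (iA b) (iA c) := by
  rw [Jac, h.AA, h.AA, h.AA]
  simp only [map_zero, add_zero]

end IsGivenBy

end Realization

/-! ### From double Courant–Dorfman algebras to brackets -/

section OfCD

variable {D : DerBimod k} {V : GrDiffAlg k} {iA : D.A →ₗ[k] V.V} {iE : D.E →ₗ[k] V.V}

/-- The prescribed bracket of two elements of `A ⊕ E`. -/
def genBracket (iA : D.A →ₗ[k] V.V) (iE : D.E →ₗ[k] V.V) (S : DoubleCD D) :
    D.A × D.E →ₗ[k] D.A × D.E →ₗ[k] LPoly (V.V ⊗[k] V.V) :=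
  LinearMap.mk₂ k
    (fun x y => const k (mapAA iA (S.pr x.2 (D.d y.1)) - mapAA iA (S.pr (D.d x.1) y.2) +
      mapT₂ iA iE (S.br x.2 y.2)) + mulVar k (const k (mapAA iA (S.pr x.2 y.2))))
    (fun x x' y => by
      simp only [Prod.fst_add, Prod.snd_add, map_add, LinearMap.add_apply, map_sub]; abel)
    (fun c x y => by
      simp only [Prod.smul_fst, Prod.smul_snd, map_smul, LinearMap.smul_apply, smul_add, map_add,
        smul_sub, map_sub])
    (fun x y y' => by
      simp only [Prod.fst_add, Prod.snd_add, map_add, map_sub]; abel)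
    (fun c x y => by
      simp only [Prod.smul_fst, Prod.smul_snd, map_smul, smul_add, map_add, smul_sub, map_sub])

theorem genBracket_apply (S : DoubleCD D) (x y : D.A × D.E) : genBracket iA iE S x y =
    const k (mapAA iA (S.pr x.2 (D.d y.1)) - mapAA iA (S.pr (D.d x.1) y.2) +
      mapT₂ iA iE (S.br x.2 y.2)) + mulVar k (const k (mapAA iA (S.pr x.2 y.2))) := rfl

theorem genBracket_left (S : DoubleCD D) (x : D.A × D.E) (a : D.A) :
    genBracket iA iE S x (a, 0) = const k (mapAA iA (S.pr x.2 (D.d a))) := by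
  simp [genBracket_apply]

theorem genBracket_right (S : DoubleCD D) (x : D.A × D.E) (e : D.E) :
    genBracket iA iE S x (0, e) = const k (mapT₂ iA iE (S.br x.2 e) - mapAA iA (S.pr (D.d x.1) e)) +
      mulVar k (const k (mapAA iA (S.pr x.2 e))) := by
  rw [genBracket_apply]
  simp only [map_zero, zero_sub]
  rw [neg_add_eq_sub]

theorem genBracket_skew (hr : IsRealization iA iE) (S : DoubleCD D) (x y : D.A × D.E) :
    genBracket iA iE S x y = - sk (genBracket iA iE S y x) := by
  rw [genBracket_apply, genBracket_apply]
  simp only [map_add, map_sub, sk_const, sk_mulVar, coT_const, comm_mapAA, comm_mapT₂,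
    ← S.pr_symm, hr.tensorT_mapAA, S.d_pr]
  abel

/-- `⟦e, ∂a⟧ = ∂ ⟪e, ∂a⟫`. -/
theorem DoubleCD.br_right_d (S : DoubleCD D) (e : D.E) (a : D.A) :
    S.br e (D.d a) = dTensor D (S.pr e (D.d a)) := by
  rw [S.d_pr, S.br_d, map_zero, add_zero]

/-- The cyclic permutation `x ⊗ y ⊗ z ↦ z ⊗ x ⊗ y` on `A ⊗ A ⊗ A`. -/
def rotA (D : DerBimod k) : D.A ⊗[k] (D.A ⊗[k] D.A) →ₗ[k] D.A ⊗[k] (D.A ⊗[k] D.A) :=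
  (TensorProduct.comm k (D.A ⊗[k] D.A) D.A).toLinearMap ∘ₗ
    (TensorProduct.assoc k D.A D.A D.A).symm.toLinearMap

theorem rotA_asc (t : D.A ⊗[k] D.A) (a : D.A) : rotA D (asc k D.A D.A D.A (t ⊗ₜ a)) = a ⊗ₜ t := by
  simp [rotA, asc]

theorem rotA_tmul (a : D.A) (t : D.A ⊗[k] D.A) :
    rotA D (a ⊗ₜ t) = jump k D.A D.A D.A (TensorProduct.comm k D.A D.A t ⊗ₜ a) := by
  induction t with
  | zero => simp
  | tmul x y => rfl
  | add x y hx hy => simp only [map_add, tmul_add, add_tmul, hx, hy]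

theorem rotA_jump (t : D.A ⊗[k] D.A) (a : D.A) :
    rotA D (jump k D.A D.A D.A (t ⊗ₜ a)) =
      asc k D.A D.A D.A (TensorProduct.comm k D.A D.A t ⊗ₜ a) := by
  induction t with
  | zero => simp
  | tmul x y => rfl
  | add x y hx hy => simp only [map_add, add_tmul, hx, hy]

theorem rotA_prL_dTensor (pr : D.E →ₗ[k] D.E →ₗ[k] D.A ⊗[k] D.A) (f : D.E) (t : D.A ⊗[k] D.A) :
    rotA D (prL pr f (dTensor D (TensorProduct.comm k D.A D.A t))) = prR pr f (dTensor D t) := by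
  induction t with
  | zero => simp
  | tmul a b => simp [prL, prR, dTensor, rotA_asc]
  | add x y hx hy => simp only [map_add, hx, hy]

theorem DoubleCD.rotA_prR (S : DoubleCD D) (g : D.E) (t : T₂ D) :
    rotA D (prR S.pr g t) = prFirst S.pr g (swap₂ D t) := by
  refine T₂.induction (fun e b => ?_) (fun b e => ?_) (fun x y hx hy => ?_) t
  · simp [prR, prFirst, swap₂]
  · simp [prR, prFirst, swap₂, rotA_tmul, ← S.pr_symm]
  · simp only [map_add, hx, hy]

theorem DoubleCD.rotA_prFirst (S : DoubleCD D) (e : D.E) (t : T₂ D) :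
    rotA D (prFirst S.pr e t) = prL S.pr e t := by
  refine T₂.induction (fun f b => ?_) (fun b f => ?_) (fun x y hx hy => ?_) t
  · simp [prL, prFirst, rotA_jump, ← S.pr_symm]
  · simp [prL, prFirst]
  · simp only [map_add, hx, hy]

/-- The invariance of the pairing after a cyclic permutation; it expresses the coefficient of `lam`
in the Jacobi identity, while the invariance itself expresses the coefficient of `mu`. -/
theorem DoubleCD.pr_inv_cyclic (S : DoubleCD D) (e f g : D.E) :
    prL S.pr e (S.br f g) = prR S.pr f (dTensor D (S.pr e g)) + prFirst S.pr g (S.br e f) -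
      prFirst S.pr g (dTensor D (S.pr e f)) := by
  rw [← rotA_prL_dTensor, ← S.pr_symm, S.pr_inv f g e, map_add, S.rotA_prR, S.rotA_prFirst,
    S.d_pr, map_add]
  abel

/-- The bracket on a freely generated differential algebra determined by a double Courant–Dorfman
algebra. -/
theorem exists_doublePVA (hr : IsRealization iA iE) (hg : GeneratedBy iA iE)
    (hx : ExtendsDerivations iA iE) (hw : GradedGeneratedBy iA iE) (hA : ∀ a, iA a ∈ V.wt 0)
    (hE : ∀ e, iE e ∈ V.wt 1) (S : DoubleCD D) :
    ∃ B : DoublePVA V, IsGivenBy iA iE B.br S.pr S.br := by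
  obtain ⟨br, hb, hAA, hAE, hEA, hEE⟩ := exists_bracket hg hx (genBracket iA iE S)
    (genBracket_skew hr S)
    (fun y a b => by
      rw [genBracket_left, genBracket_left, genBracket_left, outL_const, outR_const, D.d_mul,
        map_add, S.pr_outer_left, S.pr_outer_right, map_add, map_add, hr.mapAA_mulLeft,
        hr.mapAA_mulRight, add_comm])
    (fun y a e => by
      rw [genBracket_left, genBracket_right, genBracket_right, map_add, outL_mulVar, outL_const,
        outL_const, outR_const, S.br_left, S.pr_outer_left, S.pr_outer_left]
      simp only [map_add, map_sub, hr.mapT₂_outerL, hr.mapT₂_elemMulR, hr.mapAA_mulLeft]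
      abel)
    (fun y a e => by
      rw [genBracket_left, genBracket_right, genBracket_right, map_add, outR_mulVar, outR_const,
        outR_const, outL_const, S.br_right, S.pr_outer_right, S.pr_outer_right]
      simp only [map_add, map_sub, hr.mapT₂_outerR, hr.mapT₂_elemMulL, hr.mapAA_mulRight]
      abel)
    (fun y a => by
      rw [genBracket_left, genBracket_right, S.br_right_d, S.pr_d_d, map_zero, sub_zero, coT_const,
        hr.tensorT_mapAA, add_comm])
  have h : IsGivenBy iA iE br S.pr S.br :=
    { AA := fun a b => by rw [hAA, genBracket_left]; simp
      AE := fun a e => by rw [hAE, genBracket_right]; simp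
      EA := fun e a => by rw [hEA, genBracket_left]
      EE := fun e f => by rw [hEE, genBracket_right]; simp }
  have hs : ∀ x y, br x y = - sk (br y x) := hb.skew_of_generators hg
    (fun a b => by rw [hAA, hAA]; exact genBracket_skew hr S _ _)
    (fun a b => by rw [hAE, hEA]; exact genBracket_skew hr S _ _)
    (fun a b => by rw [hEE, hEE]; exact genBracket_skew hr S _ _)
  have hj : ∀ x y z, Jac br x y z := hb.jac_of_generators hs hg h.jac_AAA h.jac_EAA
    (fun e f a => by
      rw [h.jac_EEA_iff, S.pr_inv, S.br_right_d])
    (fun e f g => by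
      rw [h.jac_EEE_iff hr]
      exact ⟨congrArg _ (S.jacobi e f g), congrArg _ (S.pr_inv_cyclic e f g),
        congrArg _ (S.pr_inv e f g)⟩)
  have memAA : ∀ t, const k (mapAA iA t) ∈ wtPoly V 1 := fun t => by
    induction t with
    | zero => simp
    | tmul a b => exact single_mem_wtPoly (hA a) (hA b) (by omega)
    | add x y hx hy => rw [map_add, map_add]; exact add_mem hx hy
  have memT₂ : ∀ t, const k (mapT₂ iA iE t) ∈ wtPoly V 2 := fun t => by
    refine T₂.induction (fun f b => ?_) (fun b f => ?_) (fun x y hx hy => ?_) t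
    · rw [mapT₂_left]; exact single_mem_wtPoly (hE f) (hA b) (by omega)
    · rw [mapT₂_right]; exact single_mem_wtPoly (hA b) (hE f) (by omega)
    · rw [map_add, map_add]; exact add_mem hx hy
  have hwt : ∀ {m n : ℕ} {x y : V.V}, x ∈ V.wt m → y ∈ V.wt n → br x y ∈ wtPoly V (m + n) :=
    hb.mem_wtPoly hw (fun a b => by rw [h.AA]; exact zero_mem _)
      (fun a e => by rw [h.AE]; exact neg_mem (memAA _))
      (fun e a => by rw [h.EA]; exact memAA _)
      (fun e f => by rw [h.EE]; exact add_mem (memT₂ _) (mulVar_mem_wtPoly (memAA _)))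
  exact ⟨{
    br := br
    weight := fun i j q n v w hv hw' hn => apply_mem_wtTensor (hwt hv hw') hn
    weight_zero := fun i j q v w hv hw' hn => apply_eq_zero_of_mem_wtPoly (hwt hv hw') hn
    sesq_left := hb.sesq_left
    sesq_right := hb.sesq_right
    leibniz_left := hb.leibniz_left
    leibniz_right := hb.leibniz_right
    skew := hs
    jacobi := hj }, h⟩

end OfCD

/-! ### From brackets to double Courant–Dorfman algebras -/

section ToCD

variable {D : DerBimod k} {V : GrDiffAlg k} {iA : D.A →ₗ[k] V.V} {iE : D.E →ₗ[k] V.V}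

/-- In a double Poisson vertex algebra, the brackets of elements of `E` determine the brackets with
elements of `A`. -/
theorem IsGivenBy.of_EE (hr : IsRealization iA iE) (hA : ∀ a, iA a ∈ V.wt 0)
    (hE : ∀ e, iE e ∈ V.wt 1) (B : DoublePVA V) {pr : D.E →ₗ[k] D.E →ₗ[k] D.A ⊗[k] D.A}
    {cd : D.E →ₗ[k] D.E →ₗ[k] T₂ D} (h : ∀ e f, B.br (iE e) (iE f) =
      const k (mapT₂ iA iE (cd e f)) + mulVar k (const k (mapAA iA (pr e f)))) :
    IsGivenBy iA iE B.br pr cd where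
  AA a b := by
    ext1 q
    exact B.weight_zero 0 0 q _ _ (hA a) (hA b) (by omega)
  AE a e := by
    have h1 := eq_const_of_apply_succ (k := k) (x := B.br (iA a) (iE e))
      fun n => B.weight_zero 0 1 (n + 1) _ _ (hA a) (hE e) (by omega)
    have h2 := h (D.d a) e
    -- `{∂a_lam e} = - lam {a_lam e}`, so `{a_lam e}` is minus the coefficient of `lam` in
    -- `{∂a_lam e}`.
    rw [← hr.d, B.sesq_left, h1, ← map_neg, ← map_neg, ← zero_add (mulVar k _),
      ← map_zero (const k), const_add_mulVar_inj] at h2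
    rw [h1, ← h2.2, map_neg, neg_neg]
  EA e a := by
    have h1 := eq_const_of_apply_succ (k := k) (x := B.br (iE e) (iA a))
      fun n => B.weight_zero 1 0 (n + 1) _ _ (hE e) (hA a) (by omega)
    have h2 := h e (D.d a)
    rw [← hr.d, B.sesq_right, h1, coeffMap_const, add_comm, const_add_mulVar_inj] at h2
    rw [h1, ← h2.2]
  EE := h

/-- A double Poisson vertex algebra whose brackets of generators are given by `pr` and `cd` makes
these operations a double Courant–Dorfman algebra, if the generators embed. -/
def DoubleCD.ofIsGivenBy (hr : IsRealization iA iE)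
    (iAA : Function.Injective (mapAA iA)) (iT₂ : Function.Injective (mapT₂ iA iE))
    (iAAA : Function.Injective (mapAAA iA)) (iT₃ : Function.Injective (mapT₃ iA iE))
    (B : DoublePVA V) (pr : D.E →ₗ[k] D.E →ₗ[k] D.A ⊗[k] D.A)
    (cd : D.E →ₗ[k] D.E →ₗ[k] T₂ D) (h : IsGivenBy iA iE B.br pr cd) : DoubleCD D :=
  have hb := B.isSesqLeibniz
  have left (a : D.A) (e f : D.E) :
      cd e (a • f) = outerL D a (cd e f) + elemMulR D f (pr e (D.d a)) ∧
      pr e (a • f) = (LinearMap.mulLeft k a).rTensor D.A (pr e f) := by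
    have h1 := h.EE e (a • f)
    rw [hr.left, hb.leibniz_left, h.EE, h.EA, map_add, outL_mulVar, outL_const, outL_const,
      outR_const, ← hr.mapAA_mulLeft, ← hr.mapT₂_outerL, ← hr.mapT₂_elemMulR, add_right_comm,
      ← map_add, const_add_mulVar_inj, ← map_add, iAA.eq_iff, iT₂.eq_iff] at h1
    exact ⟨h1.1.symm, h1.2.symm⟩
  have right (a : D.A) (e f : D.E) :
      cd e (MulOpposite.op a • f) = outerR D a (cd e f) + elemMulL D f (pr e (D.d a)) ∧
      pr e (MulOpposite.op a • f) = (LinearMap.mulRight k a).lTensor D.A (pr e f) := by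
    have h1 := h.EE e (MulOpposite.op a • f)
    rw [hr.right, hb.leibniz_left, h.EE, h.EA, map_add, outR_mulVar, outR_const, outR_const,
      outL_const, ← hr.mapAA_mulRight, ← hr.mapT₂_outerR, ← hr.mapT₂_elemMulL, ← add_assoc,
      ← map_add, const_add_mulVar_inj, ← map_add, iAA.eq_iff, iT₂.eq_iff] at h1
    exact ⟨h1.1.symm.trans (add_comm _ _), h1.2.symm⟩
  have skew (e f : D.E) : cd e f = dTensor D (pr e f) - swap₂ D (cd f e) ∧
      pr e f = TensorProduct.comm k D.A D.A (pr f e) := by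
    have h1 := B.br_eq_neg_sk (iE e) (iE f)
    have h2 : - sk (B.br (iE f) (iE e)) =
        const k (mapT₂ iA iE (dTensor D (TensorProduct.comm k D.A D.A (pr f e)) -
          swap₂ D (cd f e))) +
        mulVar k (const k (mapAA iA (TensorProduct.comm k D.A D.A (pr f e)))) := by
      rw [h.EE, map_add, sk_const, sk_mulVar, sk_const, coT_const, comm_mapAA, comm_mapT₂,
        hr.tensorT_mapAA]
      simp only [map_sub]
      abel
    rw [h2, h.EE, const_add_mulVar_inj, iAA.eq_iff, iT₂.eq_iff] at h1
    exact ⟨by rw [h1.1, h1.2], h1.2⟩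
  have jac (e f g : D.E) := (h.jac_EEE_iff hr e f g).1 (B.jacobi (iE e) (iE f) (iE g))
  { pr := pr
    br := cd
    pr_outer_left := fun a e f => (left a e f).2
    pr_outer_right := fun a e f => (right a e f).2
    pr_inner_left := fun a e f => by
      rw [(skew (a • e) f).2, (left a f e).2, (skew e f).2]
      generalize pr f e = t
      induction t with
      | zero => simp
      | tmul x y => simp
      | add x y hx hy => simp only [map_add, hx, hy]
    pr_inner_right := fun a e f => by
      rw [(skew (MulOpposite.op a • e) f).2, (right a f e).2, (skew e f).2]
      generalize pr f e = t
      induction t with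
      | zero => simp
      | tmul x y => simp
      | add x y hx hy => simp only [map_add, hx, hy]
    pr_symm := fun e f => (skew e f).2
    d_pr := fun e f => by rw [(skew e f).1, sub_add_cancel]
    br_d := fun a e => by
      have h1 := h.EE (D.d a) e
      rw [← hr.d, B.sesq_left, h.AE, map_neg, neg_neg] at h1
      exact (map_eq_zero_iff _ iT₂).1 ((map_eq_zero_iff _ const_injective).1
        (add_eq_right.1 h1.symm))
    pr_d_d := fun a b => by
      have h1 := h.EE (D.d a) (D.d b)
      have h0 : (0 : LPoly (V.V ⊗[k] V.V)) = const k 0 + mulVar k (const k 0) := by simp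
      rw [← hr.d, ← hr.d, hb.sesq_left, hb.sesq_right, h.AA, map_zero, map_zero, add_zero,
        map_zero, neg_zero, h0, const_add_mulVar_inj] at h1
      exact iAA (h1.2.symm.trans (map_zero _).symm)
    br_right := fun e f a => (right a e f).1
    br_left := fun e f a => (left a e f).1
    jacobi := fun e f g => iT₃ (jac e f g).1
    pr_inv := fun e f g => iAAA (jac e f g).2.2 }

end ToCD

/-! ### The double Courant–Dorfman algebra of a double Poisson vertex algebra -/

section Low

theorem GrDiffAlg.wtTensor_le (V : GrDiffAlg k) {n : ℕ} {N : Submodule k (V.V ⊗[k] V.V)}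
    (h : ∀ (i j : ℕ) (x y : V.V), x ∈ V.wt i → y ∈ V.wt j → i + j = n → x ⊗ₜ[k] y ∈ N) :
    V.wtTensor n ≤ N := by
  refine iSup_le fun i => iSup_le fun j => iSup_le fun hij => ?_
  rw [Submodule.map₂_le]
  exact fun x hx y hy => h i j x y hx hy hij

namespace GrDiffAlg

variable (V : GrDiffAlg k)

/-- The projection to the weight `n` component. -/
def wtProj (n : ℕ) : V.V →ₗ[k] V.wt n :=
  DirectSum.component k ℕ (fun n => V.wt n) n ∘ₗ (DirectSum.decomposeLinearEquiv V.wt).toLinearMap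

theorem wtProj_coe_same {n : ℕ} {x : V.V} (hx : x ∈ V.wt n) : (V.wtProj n x : V.V) = x :=
  DirectSum.decompose_of_mem_same V.wt hx

theorem wtProj_ne {m n : ℕ} {x : V.V} (hx : x ∈ V.wt m) (h : m ≠ n) : V.wtProj n x = 0 :=
  Subtype.ext (DirectSum.decompose_of_mem_ne V.wt hx h)

/-- The projection `V → V₀`. -/
def projA : V.V →ₗ[k] V.low.A := V.wtProj 0

/-- The projection `V → V₁`. -/
def projE : V.V →ₗ[k] V.low.E := V.wtProj 1

theorem inclA_projA {x : V.V} (hx : x ∈ V.wt 0) : V.inclA (V.projA x) = x := V.wtProj_coe_same hx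

theorem inclE_projE {x : V.V} (hx : x ∈ V.wt 1) : V.inclE (V.projE x) = x := V.wtProj_coe_same hx

theorem projA_comp_inclA : V.projA ∘ₗ V.inclA = LinearMap.id :=
  LinearMap.ext fun a => Subtype.ext (V.wtProj_coe_same a.2)

theorem projE_comp_inclE : V.projE ∘ₗ V.inclE = LinearMap.id :=
  LinearMap.ext fun a => Subtype.ext (V.wtProj_coe_same a.2)

theorem projA_comp_inclE : V.projA ∘ₗ V.inclE = 0 :=
  LinearMap.ext fun a => V.wtProj_ne a.2 one_ne_zero

theorem projE_comp_inclA : V.projE ∘ₗ V.inclA = 0 :=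
  LinearMap.ext fun a => V.wtProj_ne a.2 zero_ne_one

theorem isRealization_low : IsRealization V.inclA V.inclE where
  mul _ _ := rfl
  left _ _ := rfl
  right _ _ := rfl
  d _ := rfl

theorem mapAA_proj (t : V.low.A ⊗[k] V.low.A) :
    TensorProduct.map V.projA V.projA (mapAA V.inclA t) = t := by
  rw [mapAA, ← LinearMap.comp_apply, ← TensorProduct.map_comp, projA_comp_inclA,
    TensorProduct.map_id, LinearMap.id_apply]

theorem mapT₂_proj (t : T₂ V.low) :
    (TensorProduct.map V.projE V.projA (mapT₂ V.inclA V.inclE t),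
      TensorProduct.map V.projA V.projE (mapT₂ V.inclA V.inclE t)) = t := by
  obtain ⟨x, y⟩ := t
  rw [mapT₂_mk]
  simp only [map_add, ← LinearMap.comp_apply, ← TensorProduct.map_comp, projA_comp_inclA,
    projE_comp_inclE, projA_comp_inclE, projE_comp_inclA, TensorProduct.map_id,
    TensorProduct.map_zero_left]
  simp

theorem mapAA_injective : Function.Injective (mapAA V.inclA) :=
  Function.LeftInverse.injective V.mapAA_proj

theorem mapT₂_injective : Function.Injective (mapT₂ V.inclA V.inclE) :=
  Function.LeftInverse.injective (g := fun x => (TensorProduct.map V.projE V.projA x,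
    TensorProduct.map V.projA V.projE x)) V.mapT₂_proj

theorem mapAAA_injective : Function.Injective (mapAAA V.inclA) := by
  refine Function.LeftInverse.injective
    (g := TensorProduct.map V.projA (TensorProduct.map V.projA V.projA)) fun t => ?_
  simp only [mapAAA, ← LinearMap.comp_apply, ← TensorProduct.map_comp, projA_comp_inclA,
    TensorProduct.map_id, LinearMap.id_apply]

theorem mapT₃_injective : Function.Injective (mapT₃ V.inclA V.inclE) := by
  refine Function.LeftInverse.injective (g := fun x =>
    (TensorProduct.map V.projE (TensorProduct.map V.projA V.projA) x,
      TensorProduct.map V.projA (TensorProduct.map V.projE V.projA) x,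
      TensorProduct.map V.projA (TensorProduct.map V.projA V.projE) x)) fun ⟨x, y, z⟩ => ?_
  simp only [mapT₃_mk, map_add, ← LinearMap.comp_apply, ← TensorProduct.map_comp,
    projA_comp_inclA, projE_comp_inclE, projA_comp_inclE, projE_comp_inclA, TensorProduct.map_id,
    TensorProduct.map_zero_left, TensorProduct.map_zero_right]
  simp

theorem mapAA_proj_of_mem {x : V.V ⊗[k] V.V} (hx : x ∈ V.wtTensor 0) :
    mapAA V.inclA (TensorProduct.map V.projA V.projA x) = x := by
  have : V.wtTensor 0 ≤ LinearMap.eqLocus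
      (mapAA V.inclA ∘ₗ TensorProduct.map V.projA V.projA) LinearMap.id := by
    refine V.wtTensor_le fun i j x y hx hy hij => ?_
    obtain ⟨rfl, rfl⟩ : i = 0 ∧ j = 0 := by omega
    rw [LinearMap.mem_eqLocus, LinearMap.comp_apply, TensorProduct.map_tmul, mapAA_tmul,
      inclA_projA _ hx, inclA_projA _ hy, LinearMap.id_apply]
  exact this hx

theorem mapT₂_proj_of_mem {x : V.V ⊗[k] V.V} (hx : x ∈ V.wtTensor 1) :
    mapT₂ V.inclA V.inclE (TensorProduct.map V.projE V.projA x,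
      TensorProduct.map V.projA V.projE x) = x := by
  have : V.wtTensor 1 ≤ LinearMap.eqLocus (mapT₂ V.inclA V.inclE ∘ₗ
      LinearMap.prod (TensorProduct.map V.projE V.projA) (TensorProduct.map V.projA V.projE))
      LinearMap.id := by
    refine V.wtTensor_le fun i j x y hx hy hij => ?_
    change mapT₂ V.inclA V.inclE (TensorProduct.map V.projE V.projA (x ⊗ₜ y),
      TensorProduct.map V.projA V.projE (x ⊗ₜ y)) = x ⊗ₜ y
    rw [TensorProduct.map_tmul, TensorProduct.map_tmul, mapT₂_mk, TensorProduct.map_tmul,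
      TensorProduct.map_tmul]
    obtain ⟨rfl, rfl⟩ | ⟨rfl, rfl⟩ : (i = 1 ∧ j = 0) ∨ (i = 0 ∧ j = 1) := by omega
    · have h0 : V.projE y = 0 := V.wtProj_ne hy zero_ne_one
      rw [inclE_projE _ hx, inclA_projA _ hy, h0, map_zero, tmul_zero, add_zero]
    · have h0 : V.projE x = 0 := V.wtProj_ne hx zero_ne_one
      rw [inclA_projA _ hx, inclE_projE _ hy, h0, map_zero, zero_tmul, zero_add]
  exact this hx

end GrDiffAlg

variable {V : GrDiffAlg k}

namespace DoublePVA

/-- The pairing `⟪e, f⟫` on `V₁`: the coefficient of `lam` in `{e_lam f}`. -/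
def lowPr (B : DoublePVA V) : V.low.E →ₗ[k] V.low.E →ₗ[k] V.low.A ⊗[k] V.low.A :=
  (B.br.compl₁₂ V.inclE V.inclE).compr₂ (TensorProduct.map V.projA V.projA ∘ₗ Finsupp.lapply 1)

/-- The bracket `⟦e, f⟧` on `V₁`: the constant coefficient of `{e_lam f}`. -/
def lowBr (B : DoublePVA V) : V.low.E →ₗ[k] V.low.E →ₗ[k] T₂ V.low :=
  (B.br.compl₁₂ V.inclE V.inclE).compr₂
    (LinearMap.prod (TensorProduct.map V.projE V.projA) (TensorProduct.map V.projA V.projE) ∘ₗ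
      Finsupp.lapply 0)

/-- The bracket of two elements of weight one has degree at most one in `lam`, by weights. -/
theorem br_low (B : DoublePVA V) (e f : V.low.E) : B.br (V.inclE e) (V.inclE f) =
    const k (mapT₂ V.inclA V.inclE (B.lowBr e f)) +
      mulVar k (const k (mapAA V.inclA (B.lowPr e f))) := by
  have h2 : mapT₂ V.inclA V.inclE (B.lowBr e f) = B.br (V.inclE e) (V.inclE f) 0 :=
    V.mapT₂_proj_of_mem (B.weight 1 1 0 1 _ _ e.2 f.2 rfl)
  have h1 : mapAA V.inclA (B.lowPr e f) = B.br (V.inclE e) (V.inclE f) 1 :=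
    V.mapAA_proj_of_mem (B.weight 1 1 1 0 _ _ e.2 f.2 rfl)
  rw [h1, h2]
  exact eq_const_add_mulVar fun n => B.weight_zero 1 1 (n + 2) _ _ e.2 f.2 (by omega)

theorem isGivenBy_low (B : DoublePVA V) : IsGivenBy V.inclA V.inclE B.br B.lowPr B.lowBr :=
  IsGivenBy.of_EE V.isRealization_low (fun a => a.2) (fun e => e.2) B B.br_low

/-- The double Courant–Dorfman structure on the weight zero and one parts of a double Poisson
vertex algebra. -/
def toCD (B : DoublePVA V) : DoubleCD V.low :=
  DoubleCD.ofIsGivenBy V.isRealization_low V.mapAA_injective V.mapT₂_injective V.mapAAA_injective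
    V.mapT₃_injective B B.lowPr B.lowBr B.isGivenBy_low

theorem isGivenBy_toCD (B : DoublePVA V) :
    IsGivenBy V.inclA V.inclE B.br B.toCD.pr B.toCD.br := B.isGivenBy_low

theorem toCD_unique (B : DoublePVA V) (S : DoubleCD V.low)
    (h : BracketFormula V.inclA V.inclE S B) : S = B.toCD := by
  have key : ∀ e f, S.br e f = B.lowBr e f ∧ S.pr e f = B.lowPr e f := fun e f => by
    have h1 : B.br (V.inclE e) (V.inclE f) = const k (mapT₂ V.inclA V.inclE (S.br e f)) +
      mulVar k (const k (mapAA V.inclA (S.pr e f))) := h e f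
    rw [B.br_low, const_add_mulVar_inj, V.mapT₂_injective.eq_iff, V.mapAA_injective.eq_iff] at h1
    exact ⟨h1.1.symm, h1.2.symm⟩
  exact DoubleCD.ext (LinearMap.ext₂ fun e f => (key e f).2) (LinearMap.ext₂ fun e f => (key e f).1)

end DoublePVA

end Low

/-! ### The weight zero and one parts of the free differential algebra -/

namespace DerBimod

variable (D : DerBimod k)

theorem free_isRealization : IsRealization (V := D.free) D.freeA D.freeE where
  mul := D.freeA_mul
  left := D.freeE_smul
  right := D.freeE_op_smul
  d := D.free_T_freeA

theorem freeA_mem (a : D.A) : D.freeA a ∈ D.free.wt 0 := D.gen_mem (0, Sum.inl a)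

theorem freeE_mem (e : D.E) : D.freeE e ∈ D.free.wt 1 := D.gen_mem (0, Sum.inr e)

/-- The homomorphism to the square zero extension `A ⊕ E` that forgets the weights above one, on
symbols. -/
def preTrunc : D.Pre →ₐ[k] TrivSqZeroExt D.A D.E :=
  FreeAlgebra.lift k fun g => match g with
    | (0, Sum.inl a) => TrivSqZeroExt.inl a
    | (0, Sum.inr e) => TrivSqZeroExt.inr e
    | (1, Sum.inl a) => TrivSqZeroExt.inr (D.d a)
    | _ => 0

theorem preTrunc_preA (a : D.A) : D.preTrunc (D.preA a) = TrivSqZeroExt.inl a := by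
  simp [preTrunc, preA]

theorem preTrunc_preE (e : D.E) : D.preTrunc (D.preE e) = TrivSqZeroExt.inr e := by
  simp [preTrunc, preE]

/-- On the square zero extension, `T` becomes `a + e ↦ ∂ a`. -/
theorem preTrunc_preT (x : D.Pre) :
    D.preTrunc (D.preT x) = TrivSqZeroExt.inr (D.d (D.preTrunc x).fst) := by
  induction x using FreeAlgebra.induction with
  | grade0 c =>
    have h1 : D.d 1 = 0 := by simpa using D.d_mul 1 1
    rw [preT_algebraMap, map_zero, AlgHom.commutes, TrivSqZeroExt.algebraMap_eq_inl',
      TrivSqZeroExt.fst_inl, Algebra.algebraMap_eq_smul_one, map_smul, h1, smul_zero,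
      TrivSqZeroExt.inr_zero]
  | grade1 g =>
    rw [preT_ι]
    rcases g with ⟨_ | _ | n, a | e⟩ <;> simp [preTrunc]
  | mul x y hx hy =>
    rw [preT_mul, map_add, map_mul, map_mul, hx, hy, map_mul, TrivSqZeroExt.fst_mul, D.d_mul]
    ext <;> simp [add_comm]
  | add x y hx hy =>
    rw [map_add, map_add, map_add, hx, hy, TrivSqZeroExt.fst_add, map_add, TrivSqZeroExt.inr_add]

theorem preTrunc_rel {x y : D.Pre} (h : D.Rel x y) : D.preTrunc x = D.preTrunc y := by
  induction h with
  | diff _ ih => rw [preTrunc_preT, preTrunc_preT, ih]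
  | der a => rw [preTrunc_preT, preTrunc_preA, preTrunc_preE]; rfl
  | one_A => rw [preTrunc_preA, map_one]; rfl
  | add_A a b => simp [preTrunc_preA]
  | smul_A c a => simp [preTrunc_preA]
  | mul_A a b => simp [preTrunc_preA]
  | add_E e f => simp [preTrunc_preE]
  | smul_E c e => simp [preTrunc_preE]
  | left_E a e => simp [preTrunc_preA, preTrunc_preE, TrivSqZeroExt.inl_mul_inr]
  | right_E a e => simp [preTrunc_preA, preTrunc_preE, TrivSqZeroExt.inr_mul_inl]

theorem freeA_injective : Function.Injective D.freeA := by
  intro a b h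
  have := congrArg (D.freeLift D.preTrunc D.preTrunc_rel) h
  rw [← toFree_preA, ← toFree_preA, freeLift_toFree, freeLift_toFree, preTrunc_preA,
    preTrunc_preA] at this
  exact TrivSqZeroExt.inl_injective this

theorem freeE_injective : Function.Injective D.freeE := by
  intro a b h
  have := congrArg (D.freeLift D.preTrunc D.preTrunc_rel) h
  rw [← toFree_preE, ← toFree_preE, freeLift_toFree, freeLift_toFree, preTrunc_preE,
    preTrunc_preE] at this
  exact TrivSqZeroExt.inr_injective this

/-- The elements of weight zero come from `A`, those of weight one from `E`: the latter are spanned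
by the products of elements of `A` with one element of `E`, since `T a = ∂ a`. -/
theorem exists_of_mem_low (n : ℕ) (x : D.free.V) (hx : x ∈ D.free.wt n) :
    (n = 0 → ∃ a, D.freeA a = x) ∧ (n = 1 → ∃ e, D.freeE e = x) := by
  refine D.free_gradedGeneratedBy
    (fun n x => (n = 0 → ∃ a, D.freeA a = x) ∧ (n = 1 → ∃ e, D.freeE e = x))
    (fun n => ⟨fun _ => ⟨0, map_zero _⟩, fun _ => ⟨0, map_zero _⟩⟩)
    (fun a => ⟨fun _ => ⟨a, rfl⟩, fun h => absurd h zero_ne_one⟩)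
    (fun e => ⟨fun h => absurd h one_ne_zero, fun _ => ⟨e, rfl⟩⟩)
    (fun n x y hx hy => ⟨fun h => ?_, fun h => ?_⟩) (fun n c x hx => ⟨fun h => ?_, fun h => ?_⟩)
    (fun m n x y _ _ hx hy => ⟨fun h => ?_, fun h => ?_⟩)
    (fun n x hx => ⟨fun h => ?_, fun h => ?_⟩) n x hx
  · obtain ⟨a, rfl⟩ := hx.1 h
    obtain ⟨b, rfl⟩ := hy.1 h
    exact ⟨a + b, map_add _ _ _⟩
  · obtain ⟨a, rfl⟩ := hx.2 h
    obtain ⟨b, rfl⟩ := hy.2 h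
    exact ⟨a + b, map_add _ _ _⟩
  · obtain ⟨a, rfl⟩ := hx.1 h
    exact ⟨c • a, map_smul _ _ _⟩
  · obtain ⟨a, rfl⟩ := hx.2 h
    exact ⟨c • a, map_smul _ _ _⟩
  · obtain ⟨a, rfl⟩ := hx.1 (by omega)
    obtain ⟨b, rfl⟩ := hy.1 (by omega)
    exact ⟨a * b, D.freeA_mul a b⟩
  · obtain ⟨rfl, rfl⟩ | ⟨rfl, rfl⟩ : (m = 0 ∧ n = 1) ∨ (m = 1 ∧ n = 0) := by omega
    · obtain ⟨a, rfl⟩ := hx.1 rfl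
      obtain ⟨e, rfl⟩ := hy.2 rfl
      exact ⟨a • e, D.freeE_smul a e⟩
    · obtain ⟨e, rfl⟩ := hx.2 rfl
      obtain ⟨a, rfl⟩ := hy.1 rfl
      exact ⟨MulOpposite.op a • e, D.freeE_op_smul a e⟩
  · omega
  · obtain ⟨a, rfl⟩ := hx.1 (by omega)
    exact ⟨D.d a, (D.free_T_freeA a).symm⟩

theorem inclE_unit (e : D.E) : D.free.inclE (D.unit.onE e) = D.freeE e := rfl

theorem unit_bijective_A : Function.Bijective D.unit.onA := by
  refine ⟨fun a b h => D.freeA_injective (congrArg D.free.inclA h), fun x => ?_⟩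
  obtain ⟨a, ha⟩ := (D.exists_of_mem_low 0 _ x.2).1 rfl
  exact ⟨a, Subtype.ext ha⟩

theorem unit_bijective_E : Function.Bijective D.unit.onE := by
  refine ⟨fun a b h => D.freeE_injective (congrArg D.free.inclE h), fun x => ?_⟩
  obtain ⟨a, ha⟩ := (D.exists_of_mem_low 1 _ x.2).2 rfl
  exact ⟨a, Subtype.ext ha⟩

end DerBimod

/-! ### Functoriality and isomorphisms -/

section Lift

/-- Differential homomorphisms are determined on generators. -/
theorem algHom_ext_of_generatedBy {D : DerBimod k} {V W : GrDiffAlg k} {iA : D.A →ₗ[k] V.V}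
    {iE : D.E →ₗ[k] V.V} (hg : GeneratedBy iA iE) {h h' : V.V →ₐ[k] W.V}
    (hT : ∀ x, h (V.T x) = W.T (h x)) (hT' : ∀ x, h' (V.T x) = W.T (h' x))
    (hA : ∀ a, h (iA a) = h' (iA a)) (hE : ∀ e, h (iE e) = h' (iE e)) (x : V.V) : h x = h' x := by
  refine hg (fun x => h x = h' x) hA hE (fun x y hx hy => ?_) (fun x y hx hy => ?_)
    (fun x hx => ?_) x
  · rw [map_add, map_add, hx, hy]
  · rw [map_mul, map_mul, hx, hy]
  · rw [hT, hT', hx]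

variable {D : DerBimod k} {W : GrDiffAlg k} {iA : D.A →ₗ[k] W.V} {iE : D.E →ₗ[k] W.V}

/-- The universal property of the free differential algebra with respect to homomorphisms. -/
theorem exists_lift (hr : IsRealization iA iE) (h1 : iA 1 = 1) :
    ∃ h : D.free.V →ₐ[k] W.V, (∀ x, h (D.free.T x) = W.T (h x)) ∧
      (∀ a, h (D.freeA a) = iA a) ∧ ∀ e, h (D.freeE e) = iE e := by
  let Φ : D.Pre →ₐ[k] W.V := FreeAlgebra.lift k fun g => (W.T ^ g.1) (Sum.elim iA iE g.2)
  have ΦA : ∀ a, Φ (D.preA a) = iA a := fun a => by simp [Φ, DerBimod.preA]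
  have ΦE : ∀ e, Φ (D.preE e) = iE e := fun e => by simp [Φ, DerBimod.preE]
  have ΦT : ∀ x, Φ (D.preT x) = W.T (Φ x) := fun x => by
    induction x using FreeAlgebra.induction with
    | grade0 c =>
      rw [DerBimod.preT_algebraMap, map_zero, AlgHom.commutes, Algebra.algebraMap_eq_smul_one,
        map_smul, W.T_one, smul_zero]
    | grade1 g =>
      rw [DerBimod.preT_ι]
      simp [Φ, pow_succ']
    | mul x y hx hy => rw [DerBimod.preT_mul, map_add, map_mul, map_mul, hx, hy, map_mul, W.T_mul]
    | add x y hx hy => rw [map_add, map_add, map_add, map_add, hx, hy]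
  have Φrel : ∀ {x y}, D.Rel x y → Φ x = Φ y := fun {x y} h => by
    induction h with
    | diff _ ih => rw [ΦT, ΦT, ih]
    | der a => rw [ΦT, ΦA, ΦE, hr.d]
    | one_A => rw [ΦA, h1, map_one]
    | add_A a b => simp only [map_add, ΦA]
    | smul_A c a => simp only [map_smul, ΦA]
    | mul_A a b => simp only [map_mul, ΦA, hr.mul]
    | add_E e f => simp only [map_add, ΦE]
    | smul_E c e => simp only [map_smul, ΦE]
    | left_E a e => simp only [map_mul, ΦA, ΦE, hr.left]
    | right_E a e => simp only [map_mul, ΦA, ΦE, hr.right]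
  refine ⟨D.freeLift Φ Φrel, fun x => ?_, fun a => ?_, fun e => ?_⟩
  · obtain ⟨x, rfl⟩ := D.toFree_surjective x
    rw [D.free_T_toFree, D.freeLift_toFree, D.freeLift_toFree, ΦT]
  · rw [← D.toFree_preA, D.freeLift_toFree, ΦA]
  · rw [← D.toFree_preE, D.freeLift_toFree, ΦE]

theorem map_mem_wt {V W : GrDiffAlg k} {iA : D.A →ₗ[k] V.V} {iE : D.E →ₗ[k] V.V}
    (hg : GradedGeneratedBy iA iE) {h : V.V →ₐ[k] W.V} (hT : ∀ x, h (V.T x) = W.T (h x))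
    (hA : ∀ a, h (iA a) ∈ W.wt 0) (hE : ∀ e, h (iE e) ∈ W.wt 1) (n : ℕ) (x : V.V)
    (hx : x ∈ V.wt n) : h x ∈ W.wt n := by
  refine hg (fun n x => h x ∈ W.wt n) (fun n => ?_) hA hE (fun n x y hx hy => ?_)
    (fun n c x hx => ?_) (fun m n x y _ _ hx hy => ?_) (fun n x hx => ?_) n x hx
  · rw [map_zero]; exact zero_mem _
  · rw [map_add]; exact add_mem hx hy
  · rw [map_smul]; exact Submodule.smul_mem _ c hx
  · rw [map_mul]; exact SetLike.GradedMul.mul_mem hx hy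
  · rw [hT]; exact W.T_wt _ _ hx

/-- An injective homomorphism that preserves weights also reflects them. -/
theorem mem_wt_iff {V W : GrDiffAlg k} {h : V.V →ₐ[k] W.V} (hi : Function.Injective h)
    (hw : ∀ n x, x ∈ V.wt n → h x ∈ W.wt n) (n : ℕ) (x : V.V) : x ∈ V.wt n ↔ h x ∈ W.wt n := by
  refine ⟨hw n x, fun hx => ?_⟩
  have key : ∀ x, h (V.wtProj n x) = W.wtProj n (h x) := fun x => by
    induction x using DirectSum.Decomposition.inductionOn V.wt with
    | zero => simp
    | @homogeneous i m =>
      by_cases hi : i = n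
      · subst hi
        rw [V.wtProj_coe_same m.2, W.wtProj_coe_same (hw _ _ m.2)]
      · rw [V.wtProj_ne m.2 hi, W.wtProj_ne (hw _ _ m.2) hi]
        simp
    | add x y hx hy => simp only [map_add, Submodule.coe_add, hx, hy]
  have h1 : x = V.wtProj n x := hi (by rw [key, W.wtProj_coe_same hx])
  rw [h1]
  exact (V.wtProj n x).2

/-- The homomorphism of free differential algebras induced by a morphism of triples. -/
theorem DerBimod.Hom.exists_freeMap {D D' : DerBimod k} (f : D.Hom D') :
    ∃ h : D.free.V →ₐ[k] D'.free.V, (∀ x, h (D.free.T x) = D'.free.T (h x)) ∧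
      (∀ a, h (D.freeA a) = D'.freeA (f.onA a)) ∧ ∀ e, h (D.freeE e) = D'.freeE (f.onE e) :=
  exists_lift (iA := D'.freeA ∘ₗ f.onA.toLinearMap) (iE := D'.freeE ∘ₗ f.onE)
    { mul := fun a b => by simp [D'.freeA_mul]
      left := fun a e => by simp [f.left_smul, D'.freeE_smul]
      right := fun a e => by simp [f.right_smul, D'.freeE_op_smul]
      d := fun a => by simp [f.comm_d, D'.free_T_freeA] }
    (by simp [D'.freeA_one])

theorem DerBimod.Hom.exists_inverse {D D' : DerBimod k} (f : D.Hom D')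
    (hA : Function.Bijective f.onA) (hE : Function.Bijective f.onE) :
    ∃ g : D'.Hom D, (∀ a, g.onA (f.onA a) = a) ∧ ∀ e, g.onE (f.onE e) = e := by
  let α := AlgEquiv.ofBijective f.onA hA
  let ε := LinearEquiv.ofBijective f.onE hE
  have hα : ∀ x, f.onA (α.symm x) = x := fun x => α.apply_symm_apply x
  have hε : ∀ x, f.onE (ε.symm x) = x := fun x => ε.apply_symm_apply x
  refine ⟨⟨α.symm.toAlgHom, ε.symm.toLinearMap, fun a e => hE.1 ?_, fun a e => hE.1 ?_,
    fun a => hE.1 ?_⟩, fun a => α.symm_apply_apply a, fun e => ε.symm_apply_apply e⟩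
  · rw [f.left_smul]
    exact (hε _).trans (congrArg₂ (· • ·) (hα a) (hε e)).symm
  · rw [f.right_smul]
    exact (hε _).trans (congrArg₂ (fun a e => MulOpposite.op a • e) (hα a) (hε e)).symm
  · rw [f.comm_d]
    exact (hε _).trans (congrArg D'.d (hα a)).symm

/-- A differential homomorphism that is surjective on generators is surjective. -/
theorem surjective_of_generatedBy {D D' : DerBimod k} {V W : GrDiffAlg k} {iA : D.A →ₗ[k] V.V}
    {iE : D.E →ₗ[k] V.V} {jA : D'.A →ₗ[k] W.V} {jE : D'.E →ₗ[k] W.V} (hg : GeneratedBy jA jE)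
    {h : V.V →ₐ[k] W.V} (hT : ∀ x, h (V.T x) = W.T (h x)) {f : D.Hom D'}
    (hA : Function.Surjective f.onA) (hE : Function.Surjective f.onE)
    (hhA : ∀ a, h (iA a) = jA (f.onA a)) (hhE : ∀ e, h (iE e) = jE (f.onE e)) :
    Function.Surjective h := by
  refine hg (fun y => ∃ x, h x = y) (fun a => ?_) (fun e => ?_) ?_ ?_ ?_
  · obtain ⟨a, rfl⟩ := hA a
    exact ⟨_, hhA a⟩
  · obtain ⟨e, rfl⟩ := hE e
    exact ⟨_, hhE e⟩
  · rintro _ _ ⟨x, rfl⟩ ⟨y, rfl⟩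
    exact ⟨x + y, map_add _ _ _⟩
  · rintro _ _ ⟨x, rfl⟩ ⟨y, rfl⟩
    exact ⟨x * y, map_mul _ _ _⟩
  · rintro _ ⟨x, rfl⟩
    exact ⟨V.T x, hT x⟩

theorem DerBimod.Hom.freeMap_bijective {D D' : DerBimod k} (f : D.Hom D')
    (hA : Function.Bijective f.onA) (hE : Function.Bijective f.onE)
    {h : D.free.V →ₐ[k] D'.free.V} (hT : ∀ x, h (D.free.T x) = D'.free.T (h x))
    (hhA : ∀ a, h (D.freeA a) = D'.freeA (f.onA a))
    (hhE : ∀ e, h (D.freeE e) = D'.freeE (f.onE e)) : Function.Bijective h := by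
  refine ⟨?_, surjective_of_generatedBy D'.free_generatedBy hT hA.2 hE.2 hhA hhE⟩
  obtain ⟨g, gA, gE⟩ := f.exists_inverse hA hE
  obtain ⟨h', hT', hhA', hhE'⟩ := g.exists_freeMap
  refine Function.LeftInverse.injective (g := h') fun x => ?_
  exact algHom_ext_of_generatedBy (V := D.free) (W := D.free) (h := h'.comp h)
    (h' := AlgHom.id k _) D.free_generatedBy
    (fun x => by simp [hT, hT']) (fun x => rfl) (fun a => by simp [hhA, hhA', gA])
    (fun e => by simp [hhE, hhE', gE]) x

end Lift

section Counit

variable (V : GrDiffAlg k)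

theorem GrDiffAlg.counit_toFree (x : V.low.Pre) : V.counit (V.low.toFree x) = V.preEval x :=
  RingQuot.liftAlgHom_mkAlgHom_apply k _ _ x

theorem GrDiffAlg.counit_freeA (a : V.low.A) : V.counit (V.low.freeA a) = V.inclA a := by
  rw [← DerBimod.toFree_preA, counit_toFree, preEval_preA]

theorem GrDiffAlg.counit_freeE (e : V.low.E) : V.counit (V.low.freeE e) = V.inclE e := by
  rw [← DerBimod.toFree_preE, counit_toFree, preEval_preE]

theorem GrDiffAlg.counit_T (x : V.low.free.V) : V.counit (V.low.free.T x) = V.T (V.counit x) := by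
  obtain ⟨x, rfl⟩ := V.low.toFree_surjective x
  rw [DerBimod.free_T_toFree, counit_toFree, counit_toFree, preEval_preT]

/-- The free differential algebra is freely generated in weights `0` and `1`: the map induced by
the unit is a section of the counit. -/
theorem DerBimod.free_freelyGenerated (D : DerBimod k) : D.free.FreelyGenerated := by
  obtain ⟨h, hT, hA, hE⟩ := D.unit.exists_freeMap
  have hs : Function.Surjective h := surjective_of_generatedBy D.free.low.free_generatedBy hT
    D.unit_bijective_A.2 D.unit_bijective_E.2 hA hE
  have hc : ∀ x, D.free.counit (h x) = x := fun x =>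
    algHom_ext_of_generatedBy (V := D.free) (W := D.free) (h := D.free.counit.comp h)
      (h' := AlgHom.id k _) D.free_generatedBy
      (fun x => by simp [hT, D.free.counit_T]) (fun x => rfl)
      (fun a => by
        rw [AlgHom.comp_apply, hA, D.free.counit_freeA]; rfl)
      (fun e => by
        rw [AlgHom.comp_apply, hE, D.free.counit_freeE]; rfl) x
  refine ⟨fun x y hxy => ?_, fun x => ⟨h x, hc x⟩⟩
  obtain ⟨x, rfl⟩ := hs x
  obtain ⟨y, rfl⟩ := hs y
  rw [hc, hc] at hxy
  rw [hxy]

end Counit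

section Transport

variable {V W : GrDiffAlg k} (h : V.V →ₐ[k] W.V)

/-- The map induced by a homomorphism `h` on `(V ⊗ V)[lam]`. -/
def polyMap : LPoly (V.V ⊗[k] V.V) →ₗ[k] LPoly (W.V ⊗[k] W.V) :=
  coeffMap k (TensorProduct.map h.toLinearMap h.toLinearMap)

variable {h}

theorem polyMap_mulVar (x) : polyMap h (mulVar k x) = mulVar k (polyMap h x) := by
  simp [polyMap]

theorem polyMap_const (x) : polyMap h (const k x) =
    const k (TensorProduct.map h.toLinearMap h.toLinearMap x) := by
  simp [polyMap]

theorem polyMap_outL (a : V.V) (x) : polyMap h (outL a x) = outL (h a) (polyMap h x) := by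
  simp only [polyMap, outL, coeffMap_coeffMap]
  congr 2
  ext p q
  simp

theorem polyMap_outR (a : V.V) (x) : polyMap h (outR a x) = outR (h a) (polyMap h x) := by
  simp only [polyMap, outR, coeffMap_coeffMap]
  congr 2
  ext p q
  simp

theorem polyMap_coT (hT : ∀ x, h (V.T x) = W.T (h x)) (x) :
    polyMap h (coT x) = coT (polyMap h x) := by
  simp only [polyMap, coT, coeffMap_coeffMap]
  congr 2
  ext p q
  simp [tensorT_tmul, hT]

theorem polyMap_sk (hT : ∀ x, h (V.T x) = W.T (h x)) (x) :
    polyMap h (sk x) = sk (polyMap h x) := by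
  refine LPoly.induction k (fun m => ?_) (fun x hx => ?_) (fun x y hx hy => ?_) x
  · rw [sk_const, polyMap_const, polyMap_const, sk_const, TensorProduct.map_comm]
  · rw [sk_mulVar, polyMap_mulVar, sk_mulVar, map_sub, map_neg, polyMap_mulVar, polyMap_coT hT, hx]
  · simp only [map_add, hx, hy]

theorem polyMap_inL (hT : ∀ x, h (V.T x) = W.T (h x)) (a : V.V) (x) :
    polyMap h (inL a x) = inL (h a) (polyMap h x) := by
  rw [inL_eq, inL_eq, polyMap_sk hT, polyMap_outL, polyMap_sk hT]

theorem polyMap_inR (hT : ∀ x, h (V.T x) = W.T (h x)) (a : V.V) (x) :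
    polyMap h (inR a x) = inR (h a) (polyMap h x) := by
  rw [inR_eq, inR_eq, polyMap_sk hT, polyMap_outR, polyMap_sk hT]

variable {D D' : DerBimod k} {iA : D.A →ₗ[k] V.V} {iE : D.E →ₗ[k] V.V} {jA : D'.A →ₗ[k] W.V}
  {jE : D'.E →ₗ[k] W.V}

/-- A differential homomorphism preserves the brackets if it preserves the brackets of
generators. -/
theorem IsSesqLeibniz.polyMap_br {br : V.V →ₗ[k] V.V →ₗ[k] LPoly (V.V ⊗[k] V.V)}
    {br' : W.V →ₗ[k] W.V →ₗ[k] LPoly (W.V ⊗[k] W.V)} (hb : IsSesqLeibniz br)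
    (hb' : IsSesqLeibniz br') (hg : GeneratedBy iA iE) (hT : ∀ x, h (V.T x) = W.T (h x))
    (hAA : ∀ a b, polyMap h (br (iA a) (iA b)) = br' (h (iA a)) (h (iA b)))
    (hAE : ∀ a e, polyMap h (br (iA a) (iE e)) = br' (h (iA a)) (h (iE e)))
    (hEA : ∀ e a, polyMap h (br (iE e) (iA a)) = br' (h (iE e)) (h (iA a)))
    (hEE : ∀ e f, polyMap h (br (iE e) (iE f)) = br' (h (iE e)) (h (iE f))) (x y : V.V) :
    polyMap h (br x y) = br' (h x) (h y) := by
  have step : ∀ x, (∀ a, polyMap h (br x (iA a)) = br' (h x) (h (iA a))) →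
      (∀ e, polyMap h (br x (iE e)) = br' (h x) (h (iE e))) →
      ∀ y, polyMap h (br x y) = br' (h x) (h y) := by
    intro x hA hE
    refine hg _ hA hE (fun y z hy hz => ?_) (fun y z hy hz => ?_) (fun y hy => ?_)
    · simp only [map_add, hy, hz]
    · rw [hb.leibniz_left, map_mul, hb'.leibniz_left, map_add, polyMap_outL, polyMap_outR, hy, hz]
    · rw [hb.sesq_right, hT, hb'.sesq_right, map_add, polyMap_mulVar, polyMap_coT hT, hy]
  refine hg (fun x => ∀ y, polyMap h (br x y) = br' (h x) (h y)) (fun a => step _ (hAA a) (hAE a))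
    (fun e => step _ (hEA e) (hEE e)) (fun x x' hx hx' y => ?_) (fun x x' hx hx' y => ?_)
    (fun x hx y => ?_) x y
  · simp only [map_add, LinearMap.add_apply, hx, hx']
  · rw [hb.leibniz_right, map_mul, hb'.leibniz_right, map_add, polyMap_inL hT, polyMap_inR hT, hx,
      hx']
  · rw [hb.sesq_left, hT, hb'.sesq_left, map_neg, polyMap_mulVar, hx]

theorem map_mapAA {f : D.Hom D'} (hA : ∀ a, h (iA a) = jA (f.onA a)) (t : D.A ⊗[k] D.A) :
    TensorProduct.map h.toLinearMap h.toLinearMap (mapAA iA t) =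
      mapAA jA (TensorProduct.map f.onA.toLinearMap f.onA.toLinearMap t) := by
  induction t with
  | zero => simp
  | tmul a b => simp [mapAA_tmul, hA]
  | add x y hx hy => simp only [map_add, hx, hy]

theorem map_mapT₂ {f : D.Hom D'} (hA : ∀ a, h (iA a) = jA (f.onA a))
    (hE : ∀ e, h (iE e) = jE (f.onE e)) (t : T₂ D) :
    TensorProduct.map h.toLinearMap h.toLinearMap (mapT₂ iA iE t) =
      mapT₂ jA jE (TensorProduct.map f.onE f.onA.toLinearMap t.1,
        TensorProduct.map f.onA.toLinearMap f.onE t.2) := by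
  refine T₂.induction (fun f b => ?_) (fun b f => ?_) (fun x y hx hy => ?_) t
  · simp [mapT₂_mk, hA, hE]
  · simp [mapT₂_mk, hA, hE]
  · simp only [map_add, hx, hy, Prod.fst_add, Prod.snd_add, mapT₂_mk]
    abel

/-- A bijective differential homomorphism that restricts to an isomorphism of double
Courant–Dorfman algebras on generators is an isomorphism of double Poisson vertex algebras. -/
theorem isPVAIso_of_isCDIso {S : DoubleCD D} {S' : DoubleCD D'} {f : D.Hom D'}
    (hf : IsCDIso S S' f) {B : DoublePVA V} {C : DoublePVA W}
    (hB : IsGivenBy iA iE B.br S.pr S.br) (hC : IsGivenBy jA jE C.br S'.pr S'.br)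
    (hg : GeneratedBy iA iE) (hgg : GradedGeneratedBy iA iE) (hjA : ∀ a, jA a ∈ W.wt 0)
    (hjE : ∀ e, jE e ∈ W.wt 1) (hbij : Function.Bijective h) (hT : ∀ x, h (V.T x) = W.T (h x))
    (hA : ∀ a, h (iA a) = jA (f.onA a)) (hE : ∀ e, h (iE e) = jE (f.onE e)) :
    IsPVAIso B C h where
  bijective := hbij
  map_wt := mem_wt_iff hbij.1 (map_mem_wt hgg hT (fun a => by rw [hA]; exact hjA _)
    (fun e => by rw [hE]; exact hjE _))
  map_T := hT
  map_br := by
    refine B.isSesqLeibniz.polyMap_br C.isSesqLeibniz hg hT (fun a b => ?_) (fun a e => ?_)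
      (fun e a => ?_) (fun e e' => ?_)
    · rw [hA, hA, hB.AA, hC.AA, map_zero]
    · rw [hA, hE, hB.AE, hC.AE, map_neg, polyMap_const, map_mapAA hA, hf.map_pr, f.comm_d]
    · rw [hA, hE, hB.EA, hC.EA, polyMap_const, map_mapAA hA, hf.map_pr, f.comm_d]
    · rw [hE, hE, hB.EE, hC.EE, map_add, polyMap_mulVar, polyMap_const, polyMap_const,
        map_mapAA hA, map_mapT₂ hA hE, hf.map_pr, hf.map_brl, hf.map_brr]

/-- The restriction of an isomorphism of double Poisson vertex algebras to the weights zero and one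
is an isomorphism of double Courant–Dorfman algebras. -/
theorem IsPVAIso.exists_isCDIso {B : DoublePVA V} {C : DoublePVA W} (hh : IsPVAIso B C h) :
    ∃ f : V.low.Hom W.low, IsCDIso B.toCD C.toCD f := by
  let onA : V.low.A →ₗ[k] W.low.A := h.toLinearMap.restrict fun x hx => (hh.map_wt 0 x).1 hx
  let onE : V.low.E →ₗ[k] W.low.E := h.toLinearMap.restrict fun x hx => (hh.map_wt 1 x).1 hx
  let f : V.low.Hom W.low :=
    { onA := AlgHom.ofLinearMap onA (Subtype.ext (map_one h))
        (fun a b => Subtype.ext (map_mul h _ _))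
      onE := onE
      left_smul := fun a e => Subtype.ext (map_mul h _ _)
      right_smul := fun a e => Subtype.ext (map_mul h _ _)
      comm_d := fun a => Subtype.ext (hh.map_T _) }
  have hA : ∀ a, h (V.inclA a) = W.inclA (f.onA a) := fun a => rfl
  have hE : ∀ e, h (V.inclE e) = W.inclE (f.onE e) := fun e => rfl
  have key : ∀ e e', mapT₂ W.inclA W.inclE (TensorProduct.map f.onE f.onA.toLinearMap
        (B.toCD.br e e').1, TensorProduct.map f.onA.toLinearMap f.onE (B.toCD.br e e').2) =
        mapT₂ W.inclA W.inclE (C.toCD.br (f.onE e) (f.onE e')) ∧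
      mapAA W.inclA (TensorProduct.map f.onA.toLinearMap f.onA.toLinearMap (B.toCD.pr e e')) =
        mapAA W.inclA (C.toCD.pr (f.onE e) (f.onE e')) := fun e e' => by
    have h1 : polyMap h (B.br (V.inclE e) (V.inclE e')) = _ := hh.map_br _ _
    rwa [B.isGivenBy_toCD.EE, hE, hE, C.isGivenBy_toCD.EE, map_add, polyMap_mulVar,
      polyMap_const, polyMap_const, map_mapAA hA, map_mapT₂ hA hE, const_add_mulVar_inj] at h1
  refine ⟨f, ⟨fun a b hab => Subtype.ext (hh.bijective.1 (congrArg W.inclA hab)), fun y => ?_⟩,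
    ⟨fun a b hab => Subtype.ext (hh.bijective.1 (congrArg W.inclE hab)), fun y => ?_⟩,
    fun e e' => W.mapAA_injective (key e e').2,
    fun e e' => congrArg Prod.fst (W.mapT₂_injective (key e e').1),
    fun e e' => congrArg Prod.snd (W.mapT₂_injective (key e e').1)⟩
  · obtain ⟨x, hx⟩ := hh.bijective.2 (W.inclA y)
    exact ⟨⟨x, (hh.map_wt 0 x).2 (by rw [hx]; exact y.2)⟩, Subtype.ext hx⟩
  · obtain ⟨x, hx⟩ := hh.bijective.2 (W.inclE y)
    exact ⟨⟨x, (hh.map_wt 1 x).2 (by rw [hx]; exact y.2)⟩, Subtype.ext hx⟩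

end Transport

/-! ### The correspondence -/

section Correspondence

variable {D : DerBimod k}

theorem exists_free_doublePVA (S : DoubleCD D) :
    ∃ B : DoublePVA D.free, IsGivenBy (V := D.free) D.freeA D.freeE B.br S.pr S.br :=
  exists_doublePVA D.free_isRealization D.free_generatedBy D.extendsDerivations
    D.free_gradedGeneratedBy D.freeA_mem D.freeE_mem S

/-- The double Poisson vertex algebra structure on the free differential algebra determined by a
double Courant–Dorfman algebra. -/
def DoubleCD.toPVA (S : DoubleCD D) : DoublePVA D.free := (exists_free_doublePVA S).choose

theorem DoubleCD.isGivenBy_toPVA (S : DoubleCD D) :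
    IsGivenBy (V := D.free) D.freeA D.freeE S.toPVA.br S.pr S.br :=
  (exists_free_doublePVA S).choose_spec

theorem IsGivenBy.actionFormulas {V : GrDiffAlg k} {iA : D.A →ₗ[k] V.V} {iE : D.E →ₗ[k] V.V}
    {S : DoubleCD D} {B : DoublePVA V} (h : IsGivenBy iA iE B.br S.pr S.br) :
    ActionFormulas iA iE S B := ⟨h.EA, h.AE, h.AA⟩

theorem IsGivenBy.bracketFormula {V : GrDiffAlg k} {iA : D.A →ₗ[k] V.V} {iE : D.E →ₗ[k] V.V}
    {S : DoubleCD D} {B : DoublePVA V} (h : IsGivenBy iA iE B.br S.pr S.br) :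
    BracketFormula iA iE S B := h.EE

/-- An isomorphism of double Courant–Dorfman algebras extends to the free double Poisson vertex
algebras. -/
theorem IsCDIso.exists_isPVAIso {D' : DerBimod k} {S : DoubleCD D} {S' : DoubleCD D'}
    {f : D.Hom D'} (hf : IsCDIso S S' f) :
    ∃ h : D.free.V →ₐ[k] D'.free.V, IsPVAIso S.toPVA S'.toPVA h := by
  obtain ⟨h, hT, hA, hE⟩ := f.exists_freeMap
  exact ⟨h, isPVAIso_of_isCDIso hf S.isGivenBy_toPVA S'.isGivenBy_toPVA D.free_generatedBy
    D.free_gradedGeneratedBy D'.freeA_mem D'.freeE_mem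
    (f.freeMap_bijective hf.bijective_A hf.bijective_E hT hA hE) hT hA hE⟩

/-- The identity map preserves the brackets of generators, hence all brackets. -/
theorem DoubleCD.toPVA_unique (S : DoubleCD D) (B : DoublePVA D.free)
    (h : BracketFormula D.freeA D.freeE S B) : B = S.toPVA := by
  have hB : IsGivenBy (V := D.free) D.freeA D.freeE B.br S.pr S.br :=
    IsGivenBy.of_EE D.free_isRealization D.freeA_mem D.freeE_mem B h
  have hi := isPVAIso_of_isCDIso (h := AlgHom.id k D.free.V) (IsCDIso.refl S) hB S.isGivenBy_toPVA
    D.free_generatedBy D.free_gradedGeneratedBy D.freeA_mem D.freeE_mem Function.bijective_id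
    (fun _ => rfl) (fun _ => rfl) (fun _ => rfl)
  refine DoublePVA.ext (LinearMap.ext₂ fun x y => ?_)
  have h1 := hi.map_br x y
  have h2 : TensorProduct.map (AlgHom.id k D.free.V).toLinearMap (AlgHom.id k D.free.V).toLinearMap
      = LinearMap.id := TensorProduct.map_id
  rwa [h2, coeffMap_id] at h1

/-- The counit is an isomorphism of double Poisson vertex algebras. -/
theorem DoublePVA.isPVAIso_counit {V : GrDiffAlg k} (hV : V.FreelyGenerated) (B : DoublePVA V) :
    IsPVAIso B.toCD.toPVA B V.counit :=
  isPVAIso_of_isCDIso (IsCDIso.refl B.toCD) B.toCD.isGivenBy_toPVA B.isGivenBy_toCD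
    V.low.free_generatedBy V.low.free_gradedGeneratedBy (fun a => a.2) (fun e => e.2) hV
    V.counit_T V.counit_freeA V.counit_freeE

/-- The unit is an isomorphism of double Courant–Dorfman algebras. -/
theorem DoubleCD.isCDIso_unit (S : DoubleCD D) : IsCDIso S S.toPVA.toCD D.unit := by
  have hA : ∀ a, (AlgHom.id k D.free.V) (D.freeA a) = D.free.inclA (D.unit.onA a) := fun _ => rfl
  have hE : ∀ e, (AlgHom.id k D.free.V) (D.freeE e) = D.free.inclE (D.unit.onE e) := fun _ => rfl
  have h2 : TensorProduct.map (AlgHom.id k D.free.V).toLinearMap (AlgHom.id k D.free.V).toLinearMap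
      = LinearMap.id := TensorProduct.map_id
  have key : ∀ e f, (TensorProduct.map D.unit.onE D.unit.onA.toLinearMap (S.br e f).1,
        TensorProduct.map D.unit.onA.toLinearMap D.unit.onE (S.br e f).2) =
        S.toPVA.toCD.br (D.unit.onE e) (D.unit.onE f) ∧
      TensorProduct.map D.unit.onA.toLinearMap D.unit.onA.toLinearMap (S.pr e f) =
        S.toPVA.toCD.pr (D.unit.onE e) (D.unit.onE f) := fun e f => by
    have h1 := S.isGivenBy_toPVA.EE e f
    have h3 := map_mapT₂ hA hE (S.br e f)
    have h4 := map_mapAA hA (S.pr e f)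
    rw [h2, LinearMap.id_apply] at h3 h4
    rw [← D.inclE_unit, ← D.inclE_unit, S.toPVA.isGivenBy_toCD.EE, h3, h4, const_add_mulVar_inj,
      D.free.mapT₂_injective.eq_iff, D.free.mapAA_injective.eq_iff] at h1
    exact ⟨h1.1.symm, h1.2.symm⟩
  exact ⟨D.unit_bijective_A, D.unit_bijective_E, fun e f => (key e f).2,
    fun e f => congrArg Prod.fst (key e f).1, fun e f => congrArg Prod.snd (key e f).1⟩

end Correspondence

end DoubleCourant

end

theorem mainTheorem1 (k : Type u) [Field k] [CharZero k] :
    ∃ (hfree : ∀ D : DerBimod k, D.free.FreelyGenerated)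
      (F : ∀ V : FreeDPVA k, DoubleCD V.alg.low)
      (G : ∀ C : DCDAlg k, DoublePVA C.base.free),
      (∀ V : FreeDPVA k,
        BracketFormula V.alg.inclA V.alg.inclE (F V) V.str ∧
        ActionFormulas V.alg.inclA V.alg.inclE (F V) V.str ∧
        ∀ S : DoubleCD V.alg.low, BracketFormula V.alg.inclA V.alg.inclE S V.str → S = F V) ∧
      (∀ C : DCDAlg k,
        BracketFormula C.base.freeA C.base.freeE C.str (G C) ∧
        ActionFormulas C.base.freeA C.base.freeE C.str (G C) ∧
        ∀ B : DoublePVA C.base.free,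
          BracketFormula C.base.freeA C.base.freeE C.str B → B = G C) ∧
      (∀ V : FreeDPVA k, IsPVAIso (G ⟨V.alg.low, F V⟩) V.str V.alg.counit) ∧
      (∀ C : DCDAlg k,
        IsCDIso C.str (F ⟨C.base.free, hfree C.base, G C⟩) C.base.unit) ∧
      ∃ Φ : Quotient (FreeDPVA.isoSetoid k) ≃ Quotient (DCDAlg.isoSetoid k),
        (∀ V : FreeDPVA k, Φ (Quotient.mk _ V) = Quotient.mk _ ⟨V.alg.low, F V⟩) ∧
        (∀ C : DCDAlg k,
          Φ.symm (Quotient.mk _ C) = Quotient.mk _ ⟨C.base.free, hfree C.base, G C⟩) := by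
  refine ⟨DerBimod.free_freelyGenerated, fun V => V.str.toCD, fun C => C.str.toPVA,
    fun V => ⟨V.str.isGivenBy_toCD.bracketFormula, V.str.isGivenBy_toCD.actionFormulas,
      V.str.toCD_unique⟩,
    fun C => ⟨C.str.isGivenBy_toPVA.bracketFormula, C.str.isGivenBy_toPVA.actionFormulas,
      C.str.toPVA_unique⟩,
    fun V => V.str.isPVAIso_counit V.free, fun C => C.str.isCDIso_unit,
    { toFun := Quotient.map (fun V => ⟨V.alg.low, V.str.toCD⟩) fun _ _ ⟨_, h⟩ => h.exists_isCDIso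
      invFun := Quotient.map (fun C => ⟨C.base.free, C.base.free_freelyGenerated, C.str.toPVA⟩)
        fun _ _ ⟨_, h⟩ => h.exists_isPVAIso
      left_inv := ?_
      right_inv := ?_ }, fun _ => rfl, fun _ => rfl⟩
  · rintro ⟨V⟩
    exact Quotient.sound ⟨_, V.str.isPVAIso_counit V.free⟩
  · rintro ⟨C⟩
    exact Quotient.sound (Setoid.symm ⟨_, C.str.isCDIso_unit⟩)
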